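/- **Definitions.** An instance of *Dual Power Assignment* (DPA) is a nonempty finite simple digraph $G=(V,E)$ that is strongly connected and bidirected ($uv\in E$ implies $vu\in E$), with costs $c:E\to\{0,1\}$ satisfying $c(uv)=c(vu)$. A feasible solution is a power assignment $p:V\to\mathbb{R}_{\ge 0}$ such that the spanning subgraph $H(p)$, whose arcs are the $uv\in E$ with $p(u)\ge c(uv)$, is strongly connected; its cost is $\sum_v p(v)$. Let $OPT$ be the minimum cost. An instance of *Star Strong Connectivity* (SSC) is a strongly connected digraph given as the union of a finite family $\mathcal{C}$ of stars, a star $F$ being a nonempty set of arcs with a common source $\mathrm{source}(F)$, and $\mathrm{sinks}(F)$ the set of their heads. The SSC instance of a DPA instance has as vertices the strong components of $H(0)$, and for every $v\in V$ the star $F_v$ from the component of $v$ to all other components containing an out-neighbour of $v$ (omitted if empty). Let $n$ be its number of vertices. A nonempty set $Q\subseteq\mathcal{C}$ is *perfect* if its stars have distinct sources, $\mathrm{sinks}(F)\subseteq\mathrm{source}(Q)=\{\mathrm{source}(F'):F'\in Q\}$ for all $F\in Q$, and its arcs form a strongly connected digraph on $\mathrm{source}(Q)$. A *cut* is a nonempty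 proper subset $S$ of the vertices; a star *crosses* $S$ if its source is in $S$ and some sink is not. Two cuts are *star-disjoint* if no star crosses both. A cut is *internal* to $Q$ if every star crossing it has its source and all its sinks in $\mathrm{source}(Q)$. *Contracting* $Q$ identifies the vertices of $\mathrm{source}(Q)$ into one vertex, deletes loops, merges parallel arcs within each star, and removes stars that become empty. **Theorem.** Dual Power Assignment has a polynomial-time dual-based $1.5$-approximation algorithm. Precisely, there are a single program for a random access machine (with unit-cost addition and truncated subtraction, and the instance given as a matrix) and a polynomial $q$ such that, for every DPA instance with $N$ vertices, the SSC instance above is a valid SSC instance with bidirected digraph, and the program halts after at most $q(N)$ steps and outputs $k\ge 0$, sets of stars $Q_1,\dots,Q_k$, two cuts for each $Q_i$, and a power assignment $p_A:V\to\{0,1\}$, such that: 1. starting from the SSC instance, successively contracting $Q_1,\dots,Q_k$ leads to an instance with a single vertex; each instance before the last has more than one vertex; and in the instance current at step $i$, $Q_i$ is a perfect set and its two cuts are star-disjoint and internal to $Q_i$; 2. the $2k$ cuts, read as cuts of the initial SSC instance, are pairwise star-disjoint (they form an integral solution of the dual of the cut-based linear program); 3. $p_A(v)=1$ exactly if $F_v\in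 Q_1\cup\dots\cup Q_k$; $p_A$ is feasible, and its cost is $A=n+k-1$; 4. $OPT\ge 2k$ and $A\le\frac32\,OPT$; and if $n\ge 2$, then moreover $OPT\ge n$, hence $OPT\ge\max(n,2k)$, and $A<\frac32\,OPT$. -/

import Mathlib

/-! ## Strong connectivity -/

/-- The digraph with vertex set `W` whose arcs are the pairs of `arc` with both endpoints in `W` is
strongly connected. Arcs leaving `W` are ignored. -/
def StronglyConnectedOn {V : Type*} (W : Finset V) (arc : V → V → Prop) : Prop :=
  ∀ u ∈ W, ∀ v ∈ W, Relation.ReflTransGen (fun x y => x ∈ W ∧ y ∈ W ∧ arc x y) u v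

/-! ## Star Strong Connectivity -/

/-- The data of an instance of Star Strong Connectivity (SSC): a finite vertex set and a finite
family of stars. The star `F` is the set of arcs from `src F` to the members of `sinks F`. The
digraph of the instance is the union of all stars. Stars are an indexed family, since two stars with
different names may become equal as sets of arcs after a contraction. -/
structure StarSystem (V S : Type*) where
  verts : Finset V
  stars : Finset S
  src : S → V
  sinks : S → Finset V

namespace StarSystem

variable {V S : Type*}

/-- The arcs of the union of the stars in `R`. -/
def ArcOf (G : StarSystem V S) (R : Finset S) (u v : V) : Prop :=
  ∃ F ∈ R, G.src F = u ∧ v ∈ G.sinks F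

/-- `G` is an instance of SSC: every star is a nonempty set of (non-loop) arcs between vertices, and
the digraph formed by all stars is strongly connected (and has a vertex). -/
structure IsInstance (G : StarSystem V S) : Prop where
  verts_nonempty : G.verts.Nonempty
  src_mem : ∀ F ∈ G.stars, G.src F ∈ G.verts
  sinks_subset : ∀ F ∈ G.stars, G.sinks F ⊆ G.verts
  sinks_nonempty : ∀ F ∈ G.stars, (G.sinks F).Nonempty
  loopless : ∀ F ∈ G.stars, G.src F ∉ G.sinks F
  stronglyConnected : StronglyConnectedOn G.verts (G.ArcOf G.stars)

/-- The digraph of `G` is bidirected. -/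
def Bidirected (G : StarSystem V S) : Prop :=
  ∀ u v, G.ArcOf G.stars u v → G.ArcOf G.stars v u

/-- A cut: a nonempty proper subset of the vertices. -/
def IsCut (G : StarSystem V S) (T : Finset V) : Prop :=
  T.Nonempty ∧ T ⊂ G.verts

/-- The star `F` of `G` has an arc from `T` to the complement of `T`. -/
def Crosses (G : StarSystem V S) (T : Finset V) (F : S) : Prop :=
  F ∈ G.stars ∧ G.src F ∈ T ∧ ∃ v ∈ G.sinks F, v ∈ G.verts ∧ v ∉ T

/-- No star crosses both cuts. -/
def StarDisjoint (G : StarSystem V S) (T₁ T₂ : Finset V) : Prop :=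
  ∀ F, ¬ (G.Crosses T₁ F ∧ G.Crosses T₂ F)

variable [DecidableEq V]

/-- The set of sources of the stars in `Q`. -/
def sources (G : StarSystem V S) (Q : Finset S) : Finset V := Q.image G.src

/-- A (nonempty) set of stars with distinct sources that induces a strongly connected digraph on
its set of sources. -/
structure QuasiPerfect (G : StarSystem V S) (Q : Finset S) : Prop where
  nonempty : Q.Nonempty
  subset_stars : Q ⊆ G.stars
  distinct_sources : ∀ F ∈ Q, ∀ F' ∈ Q, G.src F = G.src F' → F = F'
  stronglyConnected : StronglyConnectedOn (G.sources Q) (G.ArcOf Q)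

/-- A quasiperfect set all of whose arcs stay inside its set of sources. -/
structure Perfect (G : StarSystem V S) (Q : Finset S) : Prop extends G.QuasiPerfect Q where
  sinks_subset : ∀ F ∈ Q, G.sinks F ⊆ G.sources Q

/-- The cut `T` is internal to `Q`: every star crossing `T` has its source and all its sinks among
the sources of `Q`. -/
def InternalTo (G : StarSystem V S) (T : Finset V) (Q : Finset S) : Prop :=
  ∀ F, G.Crosses T F → G.src F ∈ G.sources Q ∧ G.sinks F ⊆ G.sources Q

/-- Contraction of the vertices in `X` into one supervertex, named `z`. Arcs that become loops
disappear, parallel arcs of a star are merged, and stars without remaining arcs are removed. -/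
def contract (G : StarSystem V S) (X : Finset V) (z : V) : StarSystem V S :=
  let f : V → V := fun x => if x ∈ X then z else x
  { verts := G.verts.image f
    stars := G.stars.filter fun F => (((G.sinks F).image f).erase (f (G.src F))).Nonempty
    src := fun F => f (G.src F)
    sinks := fun F => ((G.sinks F).image f).erase (f (G.src F)) }

end StarSystem

/-! ## The dual-based contraction scheme -/

/-- One iteration of the scheme, for an SSC instance whose vertices are disjoint blocks of elements
of `α` and whose stars are named by elements of `α`: a set of stars and two cuts. -/
structure Stage (α : Type*) where
  Q : Finset α
  cut₁ : Finset (Finset α)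
  cut₂ : Finset (Finset α)

/-- `IsDualRun G L`: the list `L` records a complete run of the dual-based scheme started at `G`.
While there is more than one vertex, a perfect set `Q` with two star-disjoint internal cuts of the
current instance is selected, and the sources of `Q` are contracted into a single vertex (the union
of the contracted blocks). -/
def IsDualRun {α : Type*} [DecidableEq α] :
    StarSystem (Finset α) α → List (Stage α) → Prop
  | G, [] => G.verts.card = 1
  | G, st :: L =>
      G.verts.card ≠ 1 ∧ G.Perfect st.Q ∧
      G.IsCut st.cut₁ ∧ G.IsCut st.cut₂ ∧
      G.InternalTo st.cut₁ st.Q ∧ G.InternalTo st.cut₂ st.Q ∧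
      G.StarDisjoint st.cut₁ st.cut₂ ∧
      IsDualRun (G.contract (G.sources st.Q) ((G.sources st.Q).biUnion id)) L

/-- A cut of a contracted instance, as a cut of the uncontracted instance `G`: all the vertices of
`G` that were merged into a supervertex of the cut. -/
def liftCut {α : Type*} [DecidableEq α] (G : StarSystem (Finset α) α)
    (T : Finset (Finset α)) : Finset (Finset α) :=
  G.verts.filter fun B => B ⊆ T.biUnion id

/-- The cuts of all iterations of a run (two per iteration), as cuts of the initial instance `G`. -/
def runCuts {α : Type*} [DecidableEq α] (G : StarSystem (Finset α) α)
    (L : List (Stage α)) : List (Finset (Finset α)) :=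
  L.flatMap fun st => [liftCut G st.cut₁, liftCut G st.cut₂]

/-- An integral feasible solution of the dual of the cut-based linear program of `G`: a list of cuts
such that no star of `G` crosses two of them. -/
def IsDualSolution {V S : Type*} (G : StarSystem V S) (D : List (Finset V)) : Prop :=
  (∀ T ∈ D, G.IsCut T) ∧ D.Pairwise G.StarDisjoint

/-! ## Dual Power Assignment -/

/-- An instance of Dual Power Assignment with vertex set `Fin N`: a simple bidirected digraph with
symmetric arc costs in `{0, 1}` (costs of non-arcs are irrelevant). The digraph is nonempty and
strongly connected, that is, the instance has a feasible solution. -/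
structure DPAInstance (N : ℕ) where
  Arc : Fin N → Fin N → Prop
  cost : Fin N → Fin N → ℕ
  pos : 0 < N
  loopless : ∀ v, ¬ Arc v v
  arc_symm : ∀ u v, Arc u v → Arc v u
  cost_symm : ∀ u v, Arc u v → cost u v = cost v u
  cost_le_one : ∀ u v, Arc u v → cost u v ≤ 1
  stronglyConnected : StronglyConnectedOn Finset.univ Arc

namespace DPAInstance

variable {N : ℕ}

/-- The arcs of the digraph `H(p)` induced by the power assignment `p`. -/
def PowerArc (I : DPAInstance N) (p : Fin N → ℝ) (u v : Fin N) : Prop :=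
  I.Arc u v ∧ (I.cost u v : ℝ) ≤ p u

/-- A feasible solution: a nonnegative power assignment that induces a strongly connected digraph.
Its objective value is `∑ v, p v`. -/
def Feasible (I : DPAInstance N) (p : Fin N → ℝ) : Prop :=
  (∀ v, 0 ≤ p v) ∧ StronglyConnectedOn Finset.univ (I.PowerArc p)

open Classical in
/-- The strong component of `v` in the digraph `H(0)`, in which no vertex has high power. -/
noncomputable def comp (I : DPAInstance N) (v : Fin N) : Finset (Fin N) :=
  Finset.univ.filter fun u =>
    Relation.ReflTransGen (I.PowerArc 0) v u ∧ Relation.ReflTransGen (I.PowerArc 0) u v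

open Classical in
/-- The components other than that of `v` to which `v` has an arc. -/
noncomputable def outComps (I : DPAInstance N) (v : Fin N) : Finset (Finset (Fin N)) :=
  ((Finset.univ.filter fun u => I.Arc v u).image I.comp).erase (I.comp v)

/-- The SSC instance of a DPA instance: its vertices are the strong components of `H(0)`, and every
vertex `v` names a star, from the component of `v` to all other components to which `v` has an arc
(empty stars are left out). Giving `v` high power corresponds to selecting the star `v`. -/
noncomputable def ssc (I : DPAInstance N) : StarSystem (Finset (Fin N)) (Fin N) where
  verts := Finset.univ.image I.comp
  stars := Finset.univ.filter fun v => (I.outComps v).Nonempty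
  src := I.comp
  sinks := I.outComps

open Classical in
/-- The input matrix presented to an algorithm: entry `0` for a non-arc, `1` for an arc of cost `0`,
`2` for an arc of cost `1`. -/
noncomputable def code (I : DPAInstance N) (i j : ℕ) : ℕ :=
  if h : i < N ∧ j < N then
    if I.Arc ⟨i, h.1⟩ ⟨j, h.2⟩ then I.cost ⟨i, h.1⟩ ⟨j, h.2⟩ + 1 else 0
  else 0

end DPAInstance

/-! ## The machine model

A random access machine, programmed in a structured way, with a read-only input matrix. Its
arithmetic is addition and truncated subtraction only (no multiplication), so that numbers of more
than polynomially many bits cannot be built in polynomially many steps. -/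

namespace RAM

/-- Memory: registers and (two-dimensional, randomly accessible) arrays of natural numbers. -/
structure Store where
  reg : ℕ → ℕ
  mem : ℕ → ℕ → ℕ → ℕ

/-- Expressions. The names of the registers and arrays are literals of the program. -/
inductive Expr where
  | const (c : ℕ)
  | reg (x : ℕ)
  | input (i j : Expr)
  | read (a : ℕ) (i j : Expr)
  | add (e₁ e₂ : Expr)
  | sub (e₁ e₂ : Expr)
  | eq (e₁ e₂ : Expr)
  | lt (e₁ e₂ : Expr)

/-- Value of an expression, with input matrix `inp`; truth values are `1` and `0`. -/
def Expr.eval (inp : ℕ → ℕ → ℕ) (s : Store) : Expr → ℕ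
  | .const c => c
  | .reg x => s.reg x
  | .input i j => inp (i.eval inp s) (j.eval inp s)
  | .read a i j => s.mem a (i.eval inp s) (j.eval inp s)
  | .add e₁ e₂ => e₁.eval inp s + e₂.eval inp s
  | .sub e₁ e₂ => e₁.eval inp s - e₂.eval inp s
  | .eq e₁ e₂ => if e₁.eval inp s = e₂.eval inp s then 1 else 0
  | .lt e₁ e₂ => if e₁.eval inp s < e₂.eval inp s then 1 else 0

/-- Number of steps needed to evaluate an expression. -/
def Expr.steps : Expr → ℕ
  | .const _ => 1
  | .reg _ => 1
  | .input i j => i.steps + j.steps + 1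
  | .read _ i j => i.steps + j.steps + 1
  | .add e₁ e₂ => e₁.steps + e₂.steps + 1
  | .sub e₁ e₂ => e₁.steps + e₂.steps + 1
  | .eq e₁ e₂ => e₁.steps + e₂.steps + 1
  | .lt e₁ e₂ => e₁.steps + e₂.steps + 1

/-- Programs. -/
inductive Program where
  | skip
  | assign (x : ℕ) (e : Expr)
  | write (a : ℕ) (i j e : Expr)
  | seq (P₁ P₂ : Program)
  | cond (e : Expr) (P₁ P₂ : Program)
  | loop (e : Expr) (P : Program)

def Store.setReg (s : Store) (x c : ℕ) : Store :=
  { s with reg := Function.update s.reg x c }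

def Store.setMem (s : Store) (a i j c : ℕ) : Store :=
  { s with mem := fun a' i' j' => if a' = a ∧ i' = i ∧ j' = j then c else s.mem a' i' j' }

/-- `Exec inp P s t s'`: on input `inp`, the program `P` started in the store `s` halts after exactly
`t` steps in the store `s'`. (`loop e P` repeats `P` while `e` is nonzero.) -/
inductive Exec (inp : ℕ → ℕ → ℕ) : Program → Store → ℕ → Store → Prop
  | skip (s : Store) : Exec inp .skip s 1 s
  | assign (x : ℕ) (e : Expr) (s : Store) :
      Exec inp (.assign x e) s (e.steps + 1) (s.setReg x (e.eval inp s))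
  | write (a : ℕ) (i j e : Expr) (s : Store) :
      Exec inp (.write a i j e) s (i.steps + j.steps + e.steps + 1)
        (s.setMem a (i.eval inp s) (j.eval inp s) (e.eval inp s))
  | seq {P₁ P₂ : Program} {s s₁ s₂ : Store} {t₁ t₂ : ℕ} :
      Exec inp P₁ s t₁ s₁ → Exec inp P₂ s₁ t₂ s₂ → Exec inp (.seq P₁ P₂) s (t₁ + t₂) s₂
  | cond_true {e : Expr} {P₁ P₂ : Program} {s s₁ : Store} {t : ℕ} :
      e.eval inp s ≠ 0 → Exec inp P₁ s t s₁ → Exec inp (.cond e P₁ P₂) s (e.steps + 1 + t) s₁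
  | cond_false {e : Expr} {P₁ P₂ : Program} {s s₁ : Store} {t : ℕ} :
      e.eval inp s = 0 → Exec inp P₂ s t s₁ → Exec inp (.cond e P₁ P₂) s (e.steps + 1 + t) s₁
  | loop_true {e : Expr} {P : Program} {s s₁ s₂ : Store} {t₁ t₂ : ℕ} :
      e.eval inp s ≠ 0 → Exec inp P s t₁ s₁ → Exec inp (.loop e P) s₁ t₂ s₂ →
      Exec inp (.loop e P) s (e.steps + 1 + t₁ + t₂) s₂
  | loop_false {e : Expr} {P : Program} {s : Store} :
      e.eval inp s = 0 → Exec inp (.loop e P) s (e.steps + 1) s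

/-- The initial memory for an input with `N` vertices: register `0` holds `N`, all else is zero. -/
def start (N : ℕ) : Store where
  reg := fun x => if x = 0 then N else 0
  mem := fun _ _ _ => 0

/-- The power assignment written to row `0` of array `0`. -/
def Store.power (s : Store) (N : ℕ) : Fin N → ℝ := fun v => (s.mem 0 0 v : ℝ)

/-- The final memory `s` holds the record `L`: register `1` contains the number of iterations, and
row `i` of the arrays `1`, `2` and `3` is the characteristic function of the set of stars, of the
first cut and of the second cut of iteration `i` (a cut is given by the original vertices in it). -/
def Store.Holds {N : ℕ} (s : Store) (L : List (Stage (Fin N))) : Prop :=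
  s.reg 1 = L.length ∧
  ∀ (i : ℕ) (h : i < L.length) (v : Fin N),
    s.mem 1 i v = (if v ∈ L[i].Q then 1 else 0) ∧
    s.mem 2 i v = (if v ∈ L[i].cut₁.biUnion id then 1 else 0) ∧
    s.mem 3 i v = (if v ∈ L[i].cut₂.biUnion id then 1 else 0)

end RAM

/-! ## Strong connectivity and cuts -/

/-! Everything is done with sets of original vertices. An SSC instance reached by contractions is
`quot lab` for a labelling `lab` whose classes (blocks) are the current supervertices, and a
contraction is a coarsening of the labelling (`contract_quot`). A cut is a union of blocks, and the
star of a vertex crosses it exactly if that vertex has an arc leaving the union.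

Upper bound. A stage replaces |Q| blocks by one, and a star used in one stage has no arcs left
afterwards, so the stages use n - 1 + k distinct stars in total (`IsRun.sum_eq`). Each Q connects
the blocks that it merges, so the arcs of all selected stars together with the arcs of cost 0
connect everything (`IsRun.feasible`).

Lower bound. Arcs between different components have cost 1, so for every cut a feasible solution has
a vertex of power at least 1 with an arc leaving it. Cuts without a common star have different such
vertices, hence any integral dual solution bounds OPT from below (`Feasible.length_le`). The single
blocks give OPT ≥ n if n ≥ 2. The cuts of a run give OPT ≥ 2k: a star crossing an internal cut
becomes empty by the contraction, so it crosses no later cut (`IsRun.pairwise_vertexCuts`).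
Therefore A = n + k - 1 ≤ OPT + OPT/2 - 1 if n ≥ 2.

Existence of a stage. Take a path of blocks v_1, …, v_m and let j be the lowest position of a
neighbour of v_m, where blocks off the path have position 0. If j = 0, extend the path. If 0 < j < m
- 1, the path v_1, …, v_j, v_m, …, v_{j+1} is also available; if its end has a neighbour below j,
use it. If j = m - 1, then v_m is a leaf attached to v_j; if v_j has a neighbour off the path that
is adjacent to a block other than v_j, let it replace v_m. Each change makes the path longer or
lowers j, so a potential bounds their number. When no change is possible, one of three cases holds:
(a) v_m and v_{j+1} are distinct and have all their neighbours on the cycle v_j, …, v_m; these two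
blocks are the cuts (`IsPath.isCore_cycle`). (b) A star of v_j reaches v_m and a block off the path,
which is then also a leaf attached to v_j; the two leaves are the cuts (`IsPath.isCore_two_leaves`).
(c) All stars from v_j to v_m stay on the path. Take one that reaches furthest back, to v_i say; the
cuts are v_m and its complement, and the core is the cycle v_i, …, v_j closed by this star
(`IsPath.isCore_leaf`). The core grows to a perfect set: whenever a selected star has an arc to a
block without a selected star, select the star of the head of that arc. As the digraph is
bidirected, this star leads back, so strong connectivity persists (`IsSelection.insert`).

Machine. The algorithm is written with for-loops of length N only. Such a program has a denotation
as a function on stores and a step bound that is a polynomial read off its syntax (`exec_compile`);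
correctness is proved for the denotation by loop invariants. -/

theorem exists_arc_of_reflTransGen {V : Type*} {r : V → V → Prop} {u v : V}
    (h : Relation.ReflTransGen r u v) (S : V → Prop) (hu : S u) (hv : ¬ S v) :
    ∃ x y, r x y ∧ S x ∧ ¬ S y := by
  induction h with
  | refl => exact absurd hu hv
  | @tail b c _ hbc ih =>
    by_cases hb : S b
    · exact ⟨b, c, hbc, hb, hv⟩
    · exact ih hb

namespace DPAInstance

variable {N : ℕ} (I : DPAInstance N)

/-! ## The SSC instance of a labelling of the vertices -/

/-- The vertices with the same label as `v`. -/
def block (lab : Fin N → ℕ) (v : Fin N) : Finset (Fin N) :=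
  Finset.univ.filter fun u => lab u = lab v

open Classical in
/-- The blocks other than that of `v` to which `v` has an arc. -/
noncomputable def outBlocks (lab : Fin N → ℕ) (v : Fin N) : Finset (Finset (Fin N)) :=
  ((Finset.univ.filter fun u => I.Arc v u).image (block lab)).erase (block lab v)

/-- The SSC instance whose vertices are the blocks of a labelling. -/
noncomputable def quot (lab : Fin N → ℕ) : StarSystem (Finset (Fin N)) (Fin N) where
  verts := Finset.univ.image (block lab)
  stars := Finset.univ.filter fun v => (I.outBlocks lab v).Nonempty
  src := block lab
  sinks := I.outBlocks lab

variable {I} {lab lab' : Fin N → ℕ}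

@[simp] theorem mem_block {u v : Fin N} : u ∈ block lab v ↔ lab u = lab v := by
  simp [block]

@[simp] theorem block_eq_iff {u v : Fin N} : block lab u = block lab v ↔ lab u = lab v := by
  constructor
  · intro h
    have : u ∈ block lab u := mem_block.2 rfl
    rw [h] at this
    exact mem_block.1 this
  · intro h
    ext x
    simp [h]

theorem mem_outBlocks {v : Fin N} {B : Finset (Fin N)} :
    B ∈ I.outBlocks lab v ↔ ∃ w, I.Arc v w ∧ lab w ≠ lab v ∧ block lab w = B := by
  simp only [outBlocks, Finset.mem_erase, Finset.mem_image, Finset.mem_filter, Finset.mem_univ,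
    true_and]
  constructor
  · rintro ⟨h, w, hw, rfl⟩
    exact ⟨w, hw, by simpa using h, rfl⟩
  · rintro ⟨w, hw, h, rfl⟩
    exact ⟨by simpa using h, w, hw, rfl⟩

theorem mem_stars {v : Fin N} :
    v ∈ (I.quot lab).stars ↔ ∃ w, I.Arc v w ∧ lab w ≠ lab v := by
  refine Finset.mem_filter.trans ⟨?_, ?_⟩
  · rintro ⟨-, B, hB⟩
    obtain ⟨w, h, h', -⟩ := mem_outBlocks.1 hB
    exact ⟨w, h, h'⟩
  · rintro ⟨w, h, h'⟩
    exact ⟨Finset.mem_univ _, _, mem_outBlocks.2 ⟨w, h, h', rfl⟩⟩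

theorem mem_verts {B : Finset (Fin N)} :
    B ∈ (I.quot lab).verts ↔ ∃ v, block lab v = B := by
  simp [quot]

/-- `U` is a union of blocks. -/
def Saturated (lab : Fin N → ℕ) (U : Finset (Fin N)) : Prop :=
  ∀ u v, lab u = lab v → u ∈ U → v ∈ U

/-- `v` has an arc leaving `U`. -/
def Leaves (I : DPAInstance N) (U : Finset (Fin N)) (v : Fin N) : Prop :=
  v ∈ U ∧ ∃ w, I.Arc v w ∧ w ∉ U

/-- No vertex has arcs leaving both sets. -/
def LeaveDisjoint (I : DPAInstance N) (U₁ U₂ : Finset (Fin N)) : Prop :=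
  ∀ v, ¬ (I.Leaves U₁ v ∧ I.Leaves U₂ v)

theorem mem_image_block {U : Finset (Fin N)} (hU : Saturated lab U) {v : Fin N} :
    block lab v ∈ U.image (block lab) ↔ v ∈ U := by
  rw [Finset.mem_image]
  constructor
  · rintro ⟨u, hu, h⟩
    exact hU u v (block_eq_iff.1 h) hu
  · exact fun h => ⟨v, h, rfl⟩

theorem biUnion_image_block {U : Finset (Fin N)} (hU : Saturated lab U) :
    (U.image (block lab)).biUnion id = U := by
  ext v
  simp only [Finset.mem_biUnion, Finset.mem_image, id]
  constructor
  · rintro ⟨_, ⟨u, hu, rfl⟩, h⟩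
    exact hU u v (mem_block.1 h).symm hu
  · exact fun h => ⟨_, ⟨v, h, rfl⟩, mem_block.2 rfl⟩

/-- An arc leaving a union of blocks joins different blocks, so it is not lost when loops are
erased. This lets cuts be treated as vertex sets. -/
theorem crosses_image_block {U : Finset (Fin N)} (hU : Saturated lab U) {v : Fin N} :
    (I.quot lab).Crosses (U.image (block lab)) v ↔ I.Leaves U v := by
  constructor
  · rintro ⟨-, h, B, hB, -, hBU⟩
    obtain ⟨w, hw, -, rfl⟩ := mem_outBlocks.1 hB
    exact ⟨(mem_image_block hU).1 h, w, hw, fun h => hBU ((mem_image_block hU).2 h)⟩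
  · rintro ⟨h, w, hw, hwU⟩
    have hne : lab w ≠ lab v := fun e => hwU (hU v w e.symm h)
    exact ⟨mem_stars.2 ⟨w, hw, hne⟩, (mem_image_block hU).2 h, block lab w,
      mem_outBlocks.2 ⟨w, hw, hne, rfl⟩, mem_verts.2 ⟨w, rfl⟩,
      fun h => hwU ((mem_image_block hU).1 h)⟩

theorem isCut_image_block {U : Finset (Fin N)} (hU : Saturated lab U) (h : U.Nonempty)
    (h' : ∃ v, v ∉ U) : (I.quot lab).IsCut (U.image (block lab)) := by
  refine ⟨h.image _, Finset.ssubset_iff_subset_ne.2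
    ⟨Finset.image_subset_image (Finset.subset_univ _), fun e => ?_⟩⟩
  obtain ⟨v, hv⟩ := h'
  exact hv ((mem_image_block hU).1 (e ▸ mem_verts.2 ⟨v, rfl⟩))

/-! ## One iteration -/

/-- Vertex-level description of a perfect set `Q` with two star-disjoint internal cuts. -/
structure IsStage (I : DPAInstance N) (lab : Fin N → ℕ) (Q U₁ U₂ : Finset (Fin N)) : Prop where
  nonempty : Q.Nonempty
  star : ∀ q ∈ Q, ∃ w, I.Arc q w ∧ lab w ≠ lab q
  inj : ∀ q ∈ Q, ∀ q' ∈ Q, lab q = lab q' → q = q'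
  closed : ∀ q ∈ Q, ∀ w, I.Arc q w → ∃ q' ∈ Q, lab q' = lab w
  conn : ∀ q ∈ Q, ∀ q' ∈ Q, Relation.ReflTransGen
    (fun x y => x ∈ Q ∧ y ∈ Q ∧ ∃ w, I.Arc x w ∧ lab w = lab y) q q'
  sat₁ : Saturated lab U₁
  sat₂ : Saturated lab U₂
  nonempty₁ : U₁.Nonempty
  nonempty₂ : U₂.Nonempty
  disj : Disjoint U₁ U₂
  internal₁ : ∀ v, I.Leaves U₁ v →
    (∃ q ∈ Q, lab q = lab v) ∧ ∀ w, I.Arc v w → ∃ q ∈ Q, lab q = lab w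
  internal₂ : ∀ v, I.Leaves U₂ v →
    (∃ q ∈ Q, lab q = lab v) ∧ ∀ w, I.Arc v w → ∃ q ∈ Q, lab q = lab w

/-- `lab'` arises from `lab` by merging the blocks that meet `Q`. -/
def Merges (lab : Fin N → ℕ) (Q : Finset (Fin N)) (lab' : Fin N → ℕ) : Prop :=
  ∀ u v, lab' u = lab' v ↔
    lab u = lab v ∨ ((∃ q ∈ Q, lab q = lab u) ∧ ∃ q ∈ Q, lab q = lab v)

variable {Q U₁ U₂ : Finset (Fin N)}

theorem mem_sources {v : Fin N} :
    block lab v ∈ (I.quot lab).sources Q ↔ ∃ q ∈ Q, lab q = lab v := by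
  simp [StarSystem.sources, quot]

theorem mem_biUnion_sources {v : Fin N} :
    v ∈ ((I.quot lab).sources Q).biUnion id ↔ ∃ q ∈ Q, lab q = lab v := by
  simp [StarSystem.sources, quot, eq_comm]

/-- The supervertex is named by the union of the merged blocks, which is precisely the block of the
coarser labelling. So this is an equality of structures, not just an isomorphism, and runs can be
followed through labellings. -/
theorem contract_quot (h : Merges lab Q lab') :
    (I.quot lab).contract ((I.quot lab).sources Q) (((I.quot lab).sources Q).biUnion id) =
      I.quot lab' := by
  set X := (I.quot lab).sources Q with hX
  set f : Finset (Fin N) → Finset (Fin N) := fun x => if x ∈ X then X.biUnion id else x with hf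
  have key : ∀ v, f (block lab v) = block lab' v := by
    intro v
    ext u
    by_cases hv : ∃ q ∈ Q, lab q = lab v
    · have : f (block lab v) = X.biUnion id := if_pos (mem_sources.2 hv)
      rw [this, mem_biUnion_sources, mem_block, h u v]
      constructor
      · exact fun hu => Or.inr ⟨hu, hv⟩
      · rintro (e | ⟨hu, -⟩)
        · rw [e]
          exact hv
        · exact hu
    · have : f (block lab v) = block lab v := if_neg fun h => hv (mem_sources.1 h)
      rw [this, mem_block, mem_block, h u v]
      exact ⟨Or.inl, fun h => h.elim id fun h => absurd h.2 hv⟩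
  have hsinks : ∀ v, ((I.outBlocks lab v).image f).erase (f (block lab v)) =
      I.outBlocks lab' v := by
    intro v
    ext B
    rw [key, Finset.mem_erase, Finset.mem_image, mem_outBlocks]
    constructor
    · rintro ⟨hB, C, hC, rfl⟩
      obtain ⟨w, hw, -, rfl⟩ := mem_outBlocks.1 hC
      rw [key] at hB ⊢
      exact ⟨w, hw, fun e => hB (block_eq_iff.2 e), rfl⟩
    · rintro ⟨w, hw, hne, rfl⟩
      exact ⟨fun e => hne (block_eq_iff.1 e), block lab w,
        mem_outBlocks.2 ⟨w, hw, fun e => hne ((h _ _).2 (Or.inl e)), rfl⟩, key w⟩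
  have hstars : ((I.quot lab).stars.filter fun F =>
      (((I.outBlocks lab F).image f).erase (f (block lab F))).Nonempty) = (I.quot lab').stars := by
    ext v
    rw [Finset.mem_filter, hsinks, mem_stars, mem_stars]
    constructor
    · rintro ⟨-, B, hB⟩
      obtain ⟨w, hw, hne, -⟩ := mem_outBlocks.1 hB
      exact ⟨w, hw, hne⟩
    · rintro ⟨w, hw, hne⟩
      exact ⟨⟨w, hw, fun e => hne ((h _ _).2 (Or.inl e))⟩, _, mem_outBlocks.2 ⟨w, hw, hne, rfl⟩⟩
  have hverts : (I.quot lab).verts.image f = (I.quot lab').verts := by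
    ext B
    rw [Finset.mem_image, mem_verts]
    constructor
    · rintro ⟨C, hC, rfl⟩
      obtain ⟨v, rfl⟩ := mem_verts.1 hC
      exact ⟨v, (key v).symm⟩
    · rintro ⟨v, rfl⟩
      exact ⟨block lab v, mem_verts.2 ⟨v, rfl⟩, key v⟩
  have h1 : (fun F => f ((I.quot lab).src F)) = (I.quot lab').src := funext key
  have h2 : (fun F => (((I.quot lab).sinks F).image f).erase (f ((I.quot lab).src F))) =
      (I.quot lab').sinks := funext hsinks
  change StarSystem.mk _ _ _ _ = _
  rw [hverts, h1, h2]
  exact congrArg (fun s => StarSystem.mk _ s _ _) hstars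

theorem IsStage.perfect (h : I.IsStage lab Q U₁ U₂) : (I.quot lab).Perfect Q where
  nonempty := h.nonempty
  subset_stars q hq := mem_stars.2 (h.star q hq)
  distinct_sources q hq q' hq' e := h.inj q hq q' hq' (block_eq_iff.1 e)
  stronglyConnected := by
    intro B hB C hC
    obtain ⟨q, hq, rfl⟩ := Finset.mem_image.1 hB
    obtain ⟨q', hq', rfl⟩ := Finset.mem_image.1 hC
    have := h.conn q hq q' hq'
    clear hB hC
    induction this with
    | refl => exact .refl
    | @tail x y _ hxy ih =>
      obtain ⟨hx, hy, w, hw, e⟩ := hxy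
      have ih := ih hx
      -- `conn` also admits arcs inside a block; by `inj` such a step does not move.
      by_cases hxy : lab x = lab y
      · rwa [h.inj x hx y hy hxy] at ih
      · exact ih.tail ⟨mem_sources.2 ⟨x, hx, rfl⟩, mem_sources.2 ⟨y, hy, rfl⟩, x, hx, rfl,
          mem_outBlocks.2 ⟨w, hw, fun e' => hxy (e'.symm.trans e), block_eq_iff.2 e⟩⟩
  sinks_subset := by
    intro q hq B hB
    obtain ⟨w, hw, -, rfl⟩ := mem_outBlocks.1 hB
    exact mem_sources.2 (h.closed q hq w hw)

theorem internalTo_image_block {U : Finset (Fin N)} (hU : Saturated lab U)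
    (h : ∀ v, I.Leaves U v →
      (∃ q ∈ Q, lab q = lab v) ∧ ∀ w, I.Arc v w → ∃ q ∈ Q, lab q = lab w) :
    (I.quot lab).InternalTo (U.image (block lab)) Q := by
  intro v hv
  obtain ⟨h1, h2⟩ := h v ((crosses_image_block hU).1 hv)
  refine ⟨mem_sources.2 h1, fun B hB => ?_⟩
  obtain ⟨w, hw, -, rfl⟩ := mem_outBlocks.1 hB
  exact mem_sources.2 (h2 w hw)

theorem IsStage.exists_notMem₁ (h : I.IsStage lab Q U₁ U₂) : ∃ v, v ∉ U₁ :=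
  let ⟨v, hv⟩ := h.nonempty₂
  ⟨v, fun h' => Finset.disjoint_left.1 h.disj h' hv⟩

theorem IsStage.exists_notMem₂ (h : I.IsStage lab Q U₁ U₂) : ∃ v, v ∉ U₂ :=
  let ⟨v, hv⟩ := h.nonempty₁
  ⟨v, fun h' => Finset.disjoint_left.1 h.disj hv h'⟩

/-! ## Runs of the scheme -/

/-- Vertex-level description of a run of the dual-based scheme. -/
inductive IsRun (I : DPAInstance N) : (Fin N → ℕ) → List (Stage (Fin N)) → Prop
  | nil {lab : Fin N → ℕ} : (∀ u v, lab u = lab v) → IsRun I lab []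
  | cons {lab lab' : Fin N → ℕ} {Q U₁ U₂ : Finset (Fin N)} {L : List (Stage (Fin N))} :
      I.IsStage lab Q U₁ U₂ → Merges lab Q lab' → IsRun I lab' L →
      IsRun I lab (⟨Q, U₁.image (block lab), U₂.image (block lab)⟩ :: L)

theorem card_verts_eq_one (I : DPAInstance N) (h : ∀ u v, lab u = lab v) :
    (I.quot lab).verts.card = 1 := by
  rw [Finset.card_eq_one]
  refine ⟨block lab ⟨0, I.pos⟩, Finset.ext fun B => ?_⟩
  rw [mem_verts, Finset.mem_singleton]
  constructor
  · rintro ⟨v, rfl⟩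
    exact block_eq_iff.2 (h _ _)
  · rintro rfl
    exact ⟨_, rfl⟩

theorem IsRun.isDualRun {L : List (Stage (Fin N))} (h : I.IsRun lab L) :
    IsDualRun (I.quot lab) L := by
  induction h with
  | nil h => exact card_verts_eq_one I h
  | @cons lab lab' Q U₁ U₂ L hs hm _ ih =>
    refine ⟨fun hc => ?_, hs.perfect, isCut_image_block hs.sat₁ hs.nonempty₁ hs.exists_notMem₁,
      isCut_image_block hs.sat₂ hs.nonempty₂ hs.exists_notMem₂,
      internalTo_image_block hs.sat₁ hs.internal₁, internalTo_image_block hs.sat₂ hs.internal₂,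
      fun v hv => ?_, ?_⟩
    · obtain ⟨q, hq⟩ := hs.nonempty
      obtain ⟨w, -, hne⟩ := hs.star q hq
      obtain ⟨B, hB⟩ := Finset.card_eq_one.1 hc
      have h1 : block lab q ∈ (I.quot lab).verts := mem_verts.2 ⟨q, rfl⟩
      have h2 : block lab w ∈ (I.quot lab).verts := mem_verts.2 ⟨w, rfl⟩
      rw [hB, Finset.mem_singleton] at h1 h2
      exact hne (block_eq_iff.1 (h2.trans h1.symm))
    -- Disjoint cuts are star-disjoint because a star has only one source.
    · exact Finset.disjoint_left.1 hs.disj ((crosses_image_block hs.sat₁).1 hv.1).1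
        ((crosses_image_block hs.sat₂).1 hv.2).1
    · rw [contract_quot hm]
      exact ih

/-- The cuts of a run, as sets of vertices. -/
def vertexCuts (L : List (Stage (Fin N))) : List (Finset (Fin N)) :=
  L.flatMap fun st => [st.cut₁.biUnion id, st.cut₂.biUnion id]

theorem Saturated.of_merges {U : Finset (Fin N)} (hm : Merges lab Q lab')
    (h : Saturated lab' U) : Saturated lab U :=
  fun u v e => h u v ((hm u v).2 (Or.inl e))

theorem IsStage.vertexCuts_cons (hs : I.IsStage lab Q U₁ U₂) (L : List (Stage (Fin N))) :
    vertexCuts (⟨Q, U₁.image (block lab), U₂.image (block lab)⟩ :: L) =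
      U₁ :: U₂ :: vertexCuts L := by
  simp only [vertexCuts, List.flatMap_cons, biUnion_image_block hs.sat₁,
    biUnion_image_block hs.sat₂, List.cons_append, List.nil_append]

theorem IsRun.vertexCuts_spec {L : List (Stage (Fin N))} (h : I.IsRun lab L) :
    ∀ U ∈ vertexCuts L, Saturated lab U ∧ U.Nonempty ∧ ∃ v, v ∉ U := by
  induction h with
  | nil => simp [vertexCuts]
  | cons hs hm _ ih =>
    rw [hs.vertexCuts_cons]
    intro U hU
    rcases List.mem_cons.1 hU with rfl | hU
    · exact ⟨hs.sat₁, hs.nonempty₁, hs.exists_notMem₁⟩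
    rcases List.mem_cons.1 hU with rfl | hU
    · exact ⟨hs.sat₂, hs.nonempty₂, hs.exists_notMem₂⟩
    exact ⟨(ih U hU).1.of_merges hm, (ih U hU).2⟩

/-- The two cuts of a stage are disjoint sets. If a vertex leaves a cut of some stage, then by
internality it and all its out-neighbours lie in merged blocks; later cuts are unions of blocks of
the coarser labelling, so this vertex leaves none of them. -/
theorem IsRun.pairwise_vertexCuts {L : List (Stage (Fin N))} (h : I.IsRun lab L) :
    (vertexCuts L).Pairwise I.LeaveDisjoint := by
  induction h with
  | nil => simp [vertexCuts]
  | @cons lab lab' Q U₁ U₂ L hs hm hr ih =>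
    rw [hs.vertexCuts_cons]
    have later : ∀ U ∈ vertexCuts L, ∀ v, (∃ q ∈ Q, lab q = lab v) →
        (∀ w, I.Arc v w → ∃ q ∈ Q, lab q = lab w) → ¬ I.Leaves U v := by
      rintro U hU v hv hvw ⟨hvU, w, hw, hwU⟩
      exact hwU ((hr.vertexCuts_spec U hU).1 v w ((hm v w).2 (Or.inr ⟨hv, hvw w hw⟩)) hvU)
    refine List.pairwise_cons.2 ⟨fun U hU => ?_, List.pairwise_cons.2 ⟨fun U hU => ?_, ih⟩⟩
    · rcases List.mem_cons.1 hU with rfl | hU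
      · exact fun v hv => Finset.disjoint_left.1 hs.disj hv.1.1 hv.2.1
      · exact fun v hv => later U hU v (hs.internal₁ v hv.1).1 (hs.internal₁ v hv.1).2 hv.2
    · exact fun v hv => later U hU v (hs.internal₂ v hv.1).1 (hs.internal₂ v hv.1).2 hv.2

theorem IsRun.isDualSolution {L : List (Stage (Fin N))} (h : I.IsRun lab L) :
    IsDualSolution (I.quot lab) (runCuts (I.quot lab) L) := by
  have e : runCuts (I.quot lab) L = (vertexCuts L).map
      fun U => (I.quot lab).verts.filter fun B => B ⊆ U := by
    simp [runCuts, vertexCuts, List.map_flatMap, liftCut]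
  -- Cuts of later stages are unions of initial blocks as well, so lifting such a cut is the same as
  -- taking the initial blocks of its vertices.
  have e' : ∀ U, Saturated lab U →
      ((I.quot lab).verts.filter fun B => B ⊆ U) = U.image (block lab) := by
    intro U hU
    ext B
    rw [Finset.mem_filter, mem_verts, Finset.mem_image]
    constructor
    · rintro ⟨⟨v, rfl⟩, hv⟩
      exact ⟨v, hv (mem_block.2 rfl), rfl⟩
    · rintro ⟨v, hv, rfl⟩
      exact ⟨⟨v, rfl⟩, fun u hu => hU v u (mem_block.1 hu).symm hv⟩
  rw [e]
  refine ⟨fun T hT => ?_, ?_⟩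
  · obtain ⟨U, hU, rfl⟩ := List.mem_map.1 hT
    obtain ⟨h1, h2, h3⟩ := h.vertexCuts_spec U hU
    rw [e' U h1]
    exact isCut_image_block h1 h2 h3
  · rw [List.pairwise_map]
    refine h.pairwise_vertexCuts.imp_of_mem fun {U U'} hU hU' hd => ?_
    rw [e' U (h.vertexCuts_spec U hU).1, e' U' (h.vertexCuts_spec U' hU').1]
    intro v hv
    exact hd v ⟨(crosses_image_block (h.vertexCuts_spec U hU).1).1 hv.1,
      (crosses_image_block (h.vertexCuts_spec U' hU').1).1 hv.2⟩

theorem length_vertexCuts (L : List (Stage (Fin N))) : (vertexCuts L).length = 2 * L.length := by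
  induction L with
  | nil => rfl
  | cons st L ih =>
    have : vertexCuts (st :: L) = st.cut₁.biUnion id :: st.cut₂.biUnion id :: vertexCuts L := rfl
    rw [this, List.length_cons, List.length_cons, ih, List.length_cons]
    ring

/-! ## Cost and feasibility -/

/-- By `inj` the blocks meeting `Q` number |Q|; they become one block, and the others stay literally
the same. -/
theorem IsStage.card_verts (hs : I.IsStage lab Q U₁ U₂) (hm : Merges lab Q lab') :
    (I.quot lab).verts.card + 1 = (I.quot lab').verts.card + Q.card := by
  classical
  have h1 : (Q.image (block lab)).card = Q.card :=
    Finset.card_image_of_injOn fun q hq q' hq' e => hs.inj q hq q' hq' (block_eq_iff.1 e)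
  obtain ⟨q₀, hq₀⟩ := hs.nonempty
  set R : Finset (Fin N) := Finset.univ.filter fun v => ¬ ∃ q ∈ Q, lab q = lab v with hR
  have hRm : ∀ v, v ∈ R ↔ ¬ ∃ q ∈ Q, lab q = lab v := by simp [hR]
  have h2 : (I.quot lab).verts = Q.image (block lab) ∪ R.image (block lab) := by
    ext B
    rw [mem_verts, Finset.mem_union, Finset.mem_image, Finset.mem_image]
    constructor
    · rintro ⟨v, rfl⟩
      by_cases hv : ∃ q ∈ Q, lab q = lab v
      · obtain ⟨q, hq, e⟩ := hv
        exact Or.inl ⟨q, hq, block_eq_iff.2 e⟩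
      · exact Or.inr ⟨v, (hRm v).2 hv, rfl⟩
    · rintro (⟨v, -, rfl⟩ | ⟨v, -, rfl⟩) <;> exact ⟨v, rfl⟩
  have h3 : (I.quot lab').verts = insert (block lab' q₀) (R.image (block lab')) := by
    ext B
    rw [mem_verts, Finset.mem_insert, Finset.mem_image]
    constructor
    · rintro ⟨v, rfl⟩
      by_cases hv : ∃ q ∈ Q, lab q = lab v
      · exact Or.inl (block_eq_iff.2 ((hm _ _).2 (Or.inr ⟨hv, q₀, hq₀, rfl⟩)))
      · exact Or.inr ⟨v, (hRm v).2 hv, rfl⟩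
    · rintro (rfl | ⟨v, -, rfl⟩) <;> exact ⟨_, rfl⟩
  have h4 : Disjoint (Q.image (block lab)) (R.image (block lab)) := by
    rw [Finset.disjoint_left]
    rintro B hB hB'
    obtain ⟨q, hq, rfl⟩ := Finset.mem_image.1 hB
    obtain ⟨v, hv, e⟩ := Finset.mem_image.1 hB'
    exact (hRm v).1 hv ⟨q, hq, (block_eq_iff.1 e).symm⟩
  have h5 : block lab' q₀ ∉ R.image (block lab') := by
    intro h
    obtain ⟨v, hv, e⟩ := Finset.mem_image.1 h
    have hv := (hRm v).1 hv
    rcases (hm v q₀).1 (block_eq_iff.1 e) with e | ⟨h, -⟩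
    · exact hv ⟨q₀, hq₀, e.symm⟩
    · exact hv h
  have h6 : (R.image (block lab')) = R.image (block lab) := by
    refine Finset.image_congr fun v hv => ?_
    have hv := (hRm v).1 hv
    ext u
    rw [mem_block, mem_block, hm]
    exact ⟨fun h => h.elim id fun h => absurd h.2 hv, Or.inl⟩
  rw [h2, h3, Finset.card_union_of_disjoint h4, h1, Finset.card_insert_of_notMem h5, h6]
  ring

/-- A star of `Q` reaches a second block, which by closedness contains another member of `Q`. Hence
every stage reduces the number of blocks. -/
theorem IsStage.one_lt_card (hs : I.IsStage lab Q U₁ U₂) : 1 < Q.card := by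
  obtain ⟨q, hq⟩ := hs.nonempty
  obtain ⟨w, hw, hne⟩ := hs.star q hq
  obtain ⟨q', hq', e⟩ := hs.closed q hq w hw
  exact Finset.one_lt_card.2 ⟨q, hq, q', hq', fun e' => hne (by rw [← e, e'])⟩

theorem IsRun.star {L : List (Stage (Fin N))} (h : I.IsRun lab L) :
    ∀ st ∈ L, ∀ v ∈ st.Q, ∃ w, I.Arc v w ∧ lab w ≠ lab v := by
  induction h with
  | nil => simp
  | cons hs hm _ ih =>
    intro st hst v hv
    rcases List.mem_cons.1 hst with rfl | hst
    · exact hs.star v hv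
    · obtain ⟨w, hw, hne⟩ := ih st hst v hv
      exact ⟨w, hw, fun e => hne ((hm _ _).2 (Or.inl e))⟩

/-- Telescoping of `IsStage.card_verts`. No vertex is selected twice: after the stage that uses `v`,
all out-neighbours of `v` carry the label of `v`, whereas a star of a later stage must leave its
block. -/
theorem IsRun.sum_eq {L : List (Stage (Fin N))} (h : I.IsRun lab L) (p : Fin N → ℝ)
    (hp : ∀ v, p v = if ∃ st ∈ L, v ∈ st.Q then 1 else 0) :
    ∑ v, p v = ((I.quot lab).verts.card : ℝ) + (L.length : ℝ) - 1 := by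
  induction h generalizing p with
  | nil h => simp [hp, card_verts_eq_one I h]
  | @cons lab lab' Q U₁ U₂ L hs hm hr ih =>
    classical
    have ih := ih (fun v => if ∃ st ∈ L, v ∈ st.Q then 1 else 0) fun v => by congr
    have hd : ∀ v ∈ Q, ¬ ∃ st ∈ L, v ∈ st.Q := by
      rintro v hv ⟨st, hst, hv'⟩
      obtain ⟨w, hw, hne⟩ := hr.star st hst v hv'
      exact hne ((hm _ _).2 (Or.inr ⟨hs.closed v hv w hw, v, hv, rfl⟩))
    have hsplit : ∀ v, p v = (if v ∈ Q then (1 : ℝ) else 0) +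
        if ∃ st ∈ L, v ∈ st.Q then 1 else 0 := by
      intro v
      rw [hp]
      simp only [List.exists_mem_cons_iff]
      by_cases hv : v ∈ Q
      · rw [if_pos (Or.inl hv), if_pos hv, if_neg (hd v hv), add_zero]
      · simp [hv]
    have hc : ((I.quot lab).verts.card : ℝ) + 1 = (I.quot lab').verts.card + Q.card := by
      exact_mod_cast hs.card_verts hm
    rw [Finset.sum_congr rfl fun v _ => hsplit v, Finset.sum_add_distrib, ih, Finset.sum_boole,
      Finset.filter_univ_mem, List.length_cons]
    push_cast
    linarith

/-- Induction along the run: if `r` connects the present blocks inside, it also connects the merged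
block, since it contains all arcs of the selected vertices and it does not matter where in a block
such an arc ends. At the end there is only one block. -/
theorem IsRun.reflTransGen {L : List (Stage (Fin N))} (h : I.IsRun lab L)
    {r : Fin N → Fin N → Prop} (h₁ : ∀ u v, lab u = lab v → Relation.ReflTransGen r u v)
    (h₂ : ∀ st ∈ L, ∀ u ∈ st.Q, ∀ v, I.Arc u v → r u v) (u v : Fin N) :
    Relation.ReflTransGen r u v := by
  induction h with
  | nil h => exact h₁ u v (h u v)
  | @cons lab lab' Q U₁ U₂ L hs hm hr ih =>
    refine ih (fun u v e => ?_) fun st hst => h₂ st (List.mem_cons_of_mem _ hst)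
    rcases (hm u v).1 e with e | ⟨⟨q, hq, e⟩, q', hq', e'⟩
    · exact h₁ u v e
    · refine ((h₁ u q e.symm).trans ?_).trans (h₁ q' v e')
      have := hs.conn q hq q' hq'
      clear e e' hq hq'
      induction this with
      | refl => exact .refl
      | tail _ hxy ih =>
        obtain ⟨hx, -, w, hw, e⟩ := hxy
        exact (ih.tail (h₂ _ List.mem_cons_self _ hx w hw)).trans (h₁ _ _ e)

theorem powerArc_zero_symm {u v : Fin N} (h : I.PowerArc 0 u v) : I.PowerArc 0 v u :=
  ⟨I.arc_symm _ _ h.1, by rw [← I.cost_symm _ _ h.1]; exact h.2⟩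

/-- The labelling describes the strong components of `H(0)`. -/
def IsComponents (I : DPAInstance N) (lab : Fin N → ℕ) : Prop :=
  ∀ u v, lab u = lab v ↔ Relation.ReflTransGen (I.PowerArc 0) u v

theorem IsRun.feasible (hl : I.IsComponents lab) {L : List (Stage (Fin N))} (h : I.IsRun lab L)
    (p : Fin N → ℝ) (hp : ∀ v, p v = if ∃ st ∈ L, v ∈ st.Q then 1 else 0) : I.Feasible p := by
  classical
  have h0 : ∀ v, 0 ≤ p v := by
    intro v
    rw [hp]
    split_ifs <;> norm_num
  refine ⟨h0, fun u _ v _ => ?_⟩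
  have := h.reflTransGen (r := I.PowerArc p)
    (fun u v e => Relation.ReflTransGen.mono (fun x y h => ⟨h.1, h.2.trans (h0 x)⟩) _ _
      ((hl u v).1 e))
    (fun st hst u hu v ha => ⟨ha, by
      rw [hp, if_pos ⟨st, hst, hu⟩]
      exact_mod_cast I.cost_le_one _ _ ha⟩) u v
  simpa using this

/-! ## The lower bound -/

/-- The induced digraph has an arc leaving `U`. Its cost is not 0, since otherwise both ends would
lie in one component and `U` is a union of components. -/
theorem Feasible.exists_leaves (hl : I.IsComponents lab) {p : Fin N → ℝ} (hp : I.Feasible p)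
    {U : Finset (Fin N)} (hU : Saturated lab U) (h : U.Nonempty) (h' : ∃ v, v ∉ U) :
    ∃ v, I.Leaves U v ∧ 1 ≤ p v := by
  obtain ⟨u, hu⟩ := h
  obtain ⟨v, hv⟩ := h'
  obtain ⟨x, y, ⟨-, -, ha, hc⟩, hx, hy⟩ := exists_arc_of_reflTransGen
    (hp.2 u (Finset.mem_univ _) v (Finset.mem_univ _)) (· ∈ U) hu hv
  refine ⟨x, ⟨hx, y, ha, hy⟩, le_trans ?_ hc⟩
  have hne : I.cost x y ≠ 0 := by
    intro h0
    exact hy (hU x y ((hl x y).2 (.single ⟨ha, by simp [h0]⟩)) hx)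
  exact_mod_cast Nat.one_le_iff_ne_zero.2 hne

/-- Weak duality, by counting: the high-power vertices provided by `Feasible.exists_leaves` are
different for different cuts, because no vertex leaves two of them. -/
theorem Feasible.length_le (hl : I.IsComponents lab) {p : Fin N → ℝ} (hp : I.Feasible p)
    {D : List (Finset (Fin N))} (hD : ∀ U ∈ D, Saturated lab U ∧ U.Nonempty ∧ ∃ v, v ∉ U)
    (hd : D.Pairwise I.LeaveDisjoint) : (D.length : ℝ) ≤ ∑ v, p v := by
  classical
  have key : D.length ≤
      (Finset.univ.filter fun v => 1 ≤ p v ∧ ∃ U ∈ D, I.Leaves U v).card := by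
    induction D with
    | nil => simp
    | cons U D ih =>
      have ih := ih (fun U h => hD U (List.mem_cons_of_mem _ h)) (List.pairwise_cons.1 hd).2
      obtain ⟨h1, h2, h3⟩ := hD U List.mem_cons_self
      obtain ⟨v, hv, hpv⟩ := hp.exists_leaves hl h1 h2 h3
      have hnot : v ∉ Finset.univ.filter fun v => 1 ≤ p v ∧ ∃ U ∈ D, I.Leaves U v := by
        simp only [Finset.mem_filter, Finset.mem_univ, true_and, not_and]
        rintro - ⟨U', hU', hv'⟩
        exact (List.pairwise_cons.1 hd).1 U' hU' v ⟨hv, hv'⟩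
      rw [List.length_cons]
      refine le_trans (Nat.succ_le_succ ih) ?_
      rw [Nat.succ_eq_add_one, ← Finset.card_insert_of_notMem hnot]
      refine Finset.card_le_card fun x hx => ?_
      simp only [Finset.mem_insert, Finset.mem_filter, Finset.mem_univ, true_and,
        List.exists_mem_cons_iff] at hx ⊢
      rcases hx with rfl | ⟨hx, hx'⟩
      · exact ⟨hpv, Or.inl hv⟩
      · exact ⟨hx, Or.inr hx'⟩
  calc (D.length : ℝ)
      ≤ ((Finset.univ.filter fun v => 1 ≤ p v ∧ ∃ U ∈ D, I.Leaves U v).card : ℝ) := by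
        exact_mod_cast key
    _ = ∑ v ∈ Finset.univ.filter fun v => 1 ≤ p v ∧ ∃ U ∈ D, I.Leaves U v, (1 : ℝ) := by simp
    _ ≤ ∑ v ∈ Finset.univ.filter fun v => 1 ≤ p v ∧ ∃ U ∈ D, I.Leaves U v, p v :=
        Finset.sum_le_sum fun v hv => (Finset.mem_filter.1 hv).2.1
    _ ≤ ∑ v, p v :=
        Finset.sum_le_sum_of_subset_of_nonneg (Finset.subset_univ _) fun v _ _ => hp.1 v

/-- The blocks themselves form a dual solution: they are disjoint, and having at least two of them
makes each one a proper subset. -/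
theorem Feasible.card_verts_le (hl : I.IsComponents lab) {p : Fin N → ℝ} (hp : I.Feasible p)
    (h : 2 ≤ (I.quot lab).verts.card) : ((I.quot lab).verts.card : ℝ) ≤ ∑ v, p v := by
  rw [← Finset.length_toList]
  refine hp.length_le hl (fun U hU => ?_) ?_
  · obtain ⟨v, rfl⟩ := mem_verts.1 (Finset.mem_toList.1 hU)
    refine ⟨fun x y e hx => mem_block.2 (e ▸ mem_block.1 hx), ⟨v, mem_block.2 rfl⟩, ?_⟩
    obtain ⟨B, hB, hne⟩ := Finset.exists_mem_ne h (block lab v)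
    obtain ⟨w, rfl⟩ := mem_verts.1 hB
    exact ⟨w, fun hw => hne (block_eq_iff.2 (mem_block.1 hw))⟩
  · refine (Finset.nodup_toList _).imp_of_mem fun {U U'} hU hU' hne => ?_
    obtain ⟨v, rfl⟩ := mem_verts.1 (Finset.mem_toList.1 hU)
    obtain ⟨w, rfl⟩ := mem_verts.1 (Finset.mem_toList.1 hU')
    exact fun x hx => hne (block_eq_iff.2
      ((mem_block.1 hx.1.1).symm.trans (mem_block.1 hx.2.1)))

/-! ## The SSC instance of strong components -/

/-- Equality of labels is symmetric, so under `IsComponents` reachability in `H(0)` is symmetric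
too, and one direction determines the strong component. -/
theorem ssc_eq_quot (hl : I.IsComponents lab) : I.ssc = I.quot lab := by
  have hc : I.comp = block lab := by
    funext v
    ext u
    simp only [comp, Finset.mem_filter, Finset.mem_univ, true_and, mem_block]
    rw [hl u v]
    refine ⟨fun h => h.2, fun h => ⟨?_, h⟩⟩
    rw [← hl, eq_comm, hl]
    exact h
  unfold ssc quot outComps outBlocks
  simp only [hc]

theorem arcOf_quot {B C : Finset (Fin N)} :
    (I.quot lab).ArcOf (I.quot lab).stars B C ↔
      ∃ v w, I.Arc v w ∧ lab w ≠ lab v ∧ block lab v = B ∧ block lab w = C := by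
  constructor
  · rintro ⟨v, -, rfl, hC⟩
    obtain ⟨w, hw, hne, rfl⟩ := mem_outBlocks.1 hC
    exact ⟨v, w, hw, hne, rfl, rfl⟩
  · rintro ⟨v, w, hw, hne, rfl, rfl⟩
    exact ⟨v, mem_stars.2 ⟨w, hw, hne⟩, rfl, mem_outBlocks.2 ⟨w, hw, hne, rfl⟩⟩

theorem bidirected_quot : (I.quot lab).Bidirected := by
  intro B C h
  obtain ⟨v, w, hw, hne, rfl, rfl⟩ := arcOf_quot.1 h
  exact arcOf_quot.2 ⟨w, v, I.arc_symm _ _ hw, hne.symm, rfl, rfl⟩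

theorem isInstance_quot (I : DPAInstance N) (lab : Fin N → ℕ) : (I.quot lab).IsInstance where
  verts_nonempty := ⟨_, mem_verts.2 ⟨⟨0, I.pos⟩, rfl⟩⟩
  src_mem v _ := mem_verts.2 ⟨v, rfl⟩
  sinks_subset v _ B hB := by
    obtain ⟨w, -, -, rfl⟩ := mem_outBlocks.1 hB
    exact mem_verts.2 ⟨w, rfl⟩
  sinks_nonempty v hv := by
    obtain ⟨w, hw, hne⟩ := mem_stars.1 hv
    exact ⟨_, mem_outBlocks.2 ⟨w, hw, hne, rfl⟩⟩
  loopless v _ h := by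
    obtain ⟨w, -, hne, e⟩ := mem_outBlocks.1 h
    exact hne (block_eq_iff.1 e)
  stronglyConnected := by
    intro B hB C hC
    obtain ⟨u, rfl⟩ := mem_verts.1 hB
    obtain ⟨v, rfl⟩ := mem_verts.1 hC
    have h := I.stronglyConnected u (Finset.mem_univ _) v (Finset.mem_univ _)
    clear hB hC
    induction h with
    | refl => exact .refl
    | @tail x y _ hxy ih =>
      by_cases e : lab y = lab x
      · rwa [block_eq_iff.2 e]
      · exact ih.tail ⟨mem_verts.2 ⟨x, rfl⟩, mem_verts.2 ⟨y, rfl⟩,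
          arcOf_quot.2 ⟨x, y, hxy.2.2, e, rfl, rfl⟩⟩

end DPAInstance

/-! ## Programs with bounded loops -/

namespace RAM

/-- Programs whose only loops run through the numbers below the content of register `0`. -/
inductive ForProg where
  | skip
  | assign (x : ℕ) (e : Expr)
  | write (a : ℕ) (i j e : Expr)
  | seq (P₁ P₂ : ForProg)
  | cond (e : Expr) (P₁ P₂ : ForProg)
  | forLoop (x : ℕ) (P : ForProg)

namespace ForProg

/-- Translation into a program of the machine. -/
def compile : ForProg → Program
  | skip => .skip
  | assign x e => .assign x e
  | write a i j e => .write a i j e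
  | seq P₁ P₂ => .seq P₁.compile P₂.compile
  | cond e P₁ P₂ => .cond e P₁.compile P₂.compile
  | .forLoop x P => .seq (.assign x (.const 0)) (.loop (.lt (.reg x) (.reg 0))
      (.seq P.compile (.assign x (.add (.reg x) (.const 1)))))

/-- The final memory. -/
def den (inp : ℕ → ℕ → ℕ) : ForProg → Store → Store
  | skip, s => s
  | assign x e, s => s.setReg x (e.eval inp s)
  | write a i j e, s => s.setMem a (i.eval inp s) (j.eval inp s) (e.eval inp s)
  | seq P₁ P₂, s => P₂.den inp (P₁.den inp s)
  | cond e P₁ P₂, s => if e.eval inp s = 0 then P₂.den inp s else P₁.den inp s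
  | .forLoop x P, s => (fun t => (P.den inp t).setReg x ((P.den inp t).reg x + 1))^[s.reg 0]
      (s.setReg x 0)

/-- The registers that are assigned to. -/
def regs : ForProg → List ℕ
  | skip => []
  | assign x _ => [x]
  | write _ _ _ _ => []
  | seq P₁ P₂ => P₁.regs ++ P₂.regs
  | cond _ P₁ P₂ => P₁.regs ++ P₂.regs
  | .forLoop x P => x :: P.regs

/-- The arrays that are written to. -/
def arrs : ForProg → List ℕ
  | skip => []
  | assign _ _ => []
  | write a _ _ _ => [a]
  | seq P₁ P₂ => P₁.arrs ++ P₂.arrs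
  | cond _ P₁ P₂ => P₁.arrs ++ P₂.arrs
  | .forLoop _ P => P.arrs

/-- No loop modifies its own counter. -/
def wf : ForProg → Bool
  | skip => true
  | assign _ _ => true
  | write _ _ _ _ => true
  | seq P₁ P₂ => P₁.wf && P₂.wf
  | cond _ P₁ P₂ => P₁.wf && P₂.wf
  | .forLoop x P => decide (x ∉ P.regs) && P.wf

/-- A bound on the number of steps, in terms of the content of register `0`. -/
noncomputable def cost : ForProg → Polynomial ℕ
  | skip => 1
  | assign _ e => (e.steps + 1 : ℕ)
  | write _ i j e => (i.steps + j.steps + e.steps + 1 : ℕ)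
  | seq P₁ P₂ => P₁.cost + P₂.cost
  | cond e P₁ P₂ => (e.steps + 1 : ℕ) + (P₁.cost + P₂.cost)
  | .forLoop _ P => Polynomial.X * (P.cost + 8) + 6

end ForProg

/-! ### Frame conditions and execution of for-programs -/

@[simp] theorem Store.setReg_reg (s : Store) (x c y : ℕ) :
    (s.setReg x c).reg y = if y = x then c else s.reg y := by
  simp [Store.setReg, Function.update_apply]

@[simp] theorem Store.setReg_mem (s : Store) (x c : ℕ) : (s.setReg x c).mem = s.mem := rfl

@[simp] theorem Store.setMem_mem (s : Store) (a i j c a' i' j' : ℕ) :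
    (s.setMem a i j c).mem a' i' j' =
      if a' = a ∧ i' = i ∧ j' = j then c else s.mem a' i' j' := rfl

/-- `t` agrees with `s` outside the registers in `R` and the arrays in `A`. -/
structure Store.Same (R A : List ℕ) (s t : Store) : Prop where
  reg : ∀ {x}, x ∉ R → t.reg x = s.reg x
  mem : ∀ {a}, a ∉ A → t.mem a = s.mem a

theorem Store.Same.refl (R A : List ℕ) (s : Store) : s.Same R A s := ⟨fun _ => rfl, fun _ => rfl⟩

theorem Store.Same.trans {R A R' A' : List ℕ} {s t u : Store} (h : s.Same R A t)
    (h' : t.Same R' A' u) (hR : R ⊆ R') (hA : A ⊆ A') : s.Same R' A' u :=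
  ⟨fun hx => (h'.reg hx).trans (h.reg fun hx' => hx (hR hx')),
    fun ha => (h'.mem ha).trans (h.mem fun ha' => ha (hA ha'))⟩

theorem Store.Same.mono {R A R' A' : List ℕ} {s t : Store} (h : s.Same R A t)
    (hR : R ⊆ R') (hA : A ⊆ A') : s.Same R' A' t :=
  h.trans (.refl _ _ _) hR hA

theorem Store.Same.setReg {R A : List ℕ} {s t : Store} (h : s.Same R A t) {x : ℕ} (c : ℕ)
    (hx : x ∈ R) : s.Same R A (t.setReg x c) :=
  ⟨fun {y} hy => by
    rw [Store.setReg_reg, if_neg (by rintro rfl; exact hy hx)]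
    exact h.reg hy, h.mem⟩

namespace ForProg

variable {inp : ℕ → ℕ → ℕ}

/-- The lists of assigned registers and written arrays are computed from the syntax, so for a
concrete program the unchanged part of the store can be found by `decide`. -/
theorem den_same (P : ForProg) (s : Store) : s.Same P.regs P.arrs (P.den inp s) := by
  induction P generalizing s with
  | skip => exact .refl _ _ _
  | assign x e => exact (Store.Same.refl _ _ s).setReg _ (List.mem_singleton.2 rfl)
  | write a i j e =>
    refine ⟨fun _ => rfl, fun {a'} ha => ?_⟩
    have : a' ≠ a := fun e => ha (List.mem_singleton.2 e)
    funext i j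
    simp [den, this]
  | seq P₁ P₂ h₁ h₂ =>
    exact ((h₁ s).mono (List.subset_append_left _ _) (List.subset_append_left _ _)).trans
      ((h₂ _).mono (List.subset_append_right _ _) (List.subset_append_right _ _))
      (List.Subset.refl _) (List.Subset.refl _)
  | cond e P₁ P₂ h₁ h₂ =>
    unfold den
    split_ifs
    · exact (h₂ s).mono (List.subset_append_right _ _) (List.subset_append_right _ _)
    · exact (h₁ s).mono (List.subset_append_left _ _) (List.subset_append_left _ _)
  | forLoop x P h =>
    have key : ∀ k, s.Same (x :: P.regs) P.arrs
        ((fun t => (P.den inp t).setReg x ((P.den inp t).reg x + 1))^[k] (s.setReg x 0)) := by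
      intro k
      induction k with
      | zero => exact (Store.Same.refl _ _ s).setReg _ List.mem_cons_self
      | succ k ih =>
        rw [Function.iterate_succ_apply']
        exact (ih.trans ((h _).mono (List.subset_cons_self _ _) (List.Subset.refl _))
          (List.Subset.refl _) (List.Subset.refl _)).setReg _ List.mem_cons_self
    exact key _

/-- As register `0` is never assigned and no loop changes its own counter, each loop makes exactly N
rounds. So the number of steps is bounded by a polynomial in N depending on the program only. -/
theorem exec_compile {N : ℕ} (P : ForProg) (hwf : P.wf = true) (h0 : 0 ∉ P.regs) (s : Store)
    (hs : s.reg 0 = N) :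
    ∃ t, t ≤ P.cost.eval N ∧ Exec inp P.compile s t (P.den inp s) := by
  induction P generalizing s with
  | skip => exact ⟨1, by simp [cost], .skip s⟩
  | assign x e => exact ⟨_, by simp [cost], .assign x e s⟩
  | write a i j e => exact ⟨_, by simp [cost], .write a i j e s⟩
  | seq P₁ P₂ h₁ h₂ =>
    simp only [wf, Bool.and_eq_true, regs, List.mem_append, not_or] at hwf h0
    obtain ⟨t₁, ht₁, e₁⟩ := h₁ hwf.1 h0.1 s hs
    obtain ⟨t₂, ht₂, e₂⟩ := h₂ hwf.2 h0.2 _ (((den_same P₁ s).reg h0.1).trans hs)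
    exact ⟨_, by simpa [cost] using add_le_add ht₁ ht₂, .seq e₁ e₂⟩
  | cond e P₁ P₂ h₁ h₂ =>
    simp only [wf, Bool.and_eq_true, regs, List.mem_append, not_or] at hwf h0
    by_cases he : e.eval inp s = 0
    · obtain ⟨t₂, ht₂, e₂⟩ := h₂ hwf.2 h0.2 s hs
      refine ⟨_, ?_, by simpa only [den, if_pos he, compile] using Exec.cond_false he e₂⟩
      simp only [cost, Polynomial.eval_add, Polynomial.eval_natCast]
      simp
      omega
    · obtain ⟨t₁, ht₁, e₁⟩ := h₁ hwf.1 h0.1 s hs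
      refine ⟨_, ?_, by simpa only [den, if_neg he, compile] using Exec.cond_true he e₁⟩
      simp only [cost, Polynomial.eval_add, Polynomial.eval_natCast]
      simp
      omega
  | forLoop x P h =>
    simp only [wf, Bool.and_eq_true, decide_eq_true_eq, regs, List.mem_cons, not_or] at hwf h0
    -- A round costs 4 steps for the test and 4 for the increment besides the body, and the last,
    -- failing test costs 4. With the 2 steps of the initial assignment these are the constants 8
    -- and 6 of `cost`.
    have key : ∀ k s, s.reg 0 = N → s.reg x + k = N → ∃ t, t ≤ k * (P.cost.eval N + 8) + 4 ∧
        Exec inp (.loop (.lt (.reg x) (.reg 0))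
          (.seq P.compile (.assign x (.add (.reg x) (.const 1))))) s t
          ((fun t => (P.den inp t).setReg x ((P.den inp t).reg x + 1))^[k] s) := by
      intro k
      induction k with
      | zero =>
        intro s hs hx
        exact ⟨4, by simp, Exec.loop_false (e := .lt (.reg x) (.reg 0))
          (if_neg (by simp only [Expr.eval]; omega))⟩
      | succ k ih =>
        intro s hs hx
        obtain ⟨t₁, ht₁, e₁⟩ := h hwf.2 h0.2 s hs
        have hx' : (P.den inp s).reg x = s.reg x := (den_same P s).reg hwf.1
        obtain ⟨t₂, ht₂, e₂⟩ := ih ((P.den inp s).setReg x ((P.den inp s).reg x + 1))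
          (by rw [Store.setReg_reg, if_neg h0.1, (den_same P s).reg h0.2, hs])
          (by rw [Store.setReg_reg, if_pos rfl, hx']; omega)
        refine ⟨_, ?_, Exec.loop_true
          (by rw [Expr.eval, if_pos (by simp only [Expr.eval]; omega)]; exact one_ne_zero)
          (Exec.seq e₁ (Exec.assign _ _ _)) e₂⟩
        simp only [Expr.steps]
        rw [add_mul]
        omega
    obtain ⟨t, ht, e⟩ := key N (s.setReg x 0) (by simpa [h0.1] using hs) (by simp)
    refine ⟨_, ?_, Exec.seq (Exec.assign x (.const 0) s) (by rw [den, hs]; exact e)⟩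
    simp only [Expr.steps, cost, Polynomial.eval_add, Polynomial.eval_mul, Polynomial.eval_X,
      Polynomial.eval_ofNat]
    omega

/-! ### Rules for loops -/

/-- The invariant rule. A round may use, besides the invariant, the value of the counter and that
everything outside the registers and arrays of the loop is as it was before the loop. -/
theorem den_for_induct {x : ℕ} {P : ForProg} {s : Store} (hx : x ∉ P.regs)
    (J : ℕ → Store → Prop) (h0 : J 0 (s.setReg x 0))
    (hs : ∀ i t, i < s.reg 0 → t.reg x = i → s.Same (x :: P.regs) P.arrs t → J i t →
      J (i + 1) ((P.den inp t).setReg x (i + 1))) :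
    J (s.reg 0) ((ForProg.forLoop x P).den inp s) := by
  have key : ∀ k, k ≤ s.reg 0 →
      (fun t => J k t ∧ t.reg x = k ∧ s.Same (x :: P.regs) P.arrs t)
        ((fun t => (P.den inp t).setReg x ((P.den inp t).reg x + 1))^[k] (s.setReg x 0)) := by
    intro k
    induction k with
    | zero =>
      exact fun _ => ⟨h0, by simp, (Store.Same.refl _ _ s).setReg _ List.mem_cons_self⟩
    | succ k ih =>
      intro hk
      rw [Function.iterate_succ_apply']
      obtain ⟨h1, h2, h3⟩ := ih (by omega)
      set t := (fun t => (P.den inp t).setReg x ((P.den inp t).reg x + 1))^[k] (s.setReg x 0)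
      have h4 : (P.den inp t).reg x = k := ((den_same P t).reg hx).trans h2
      rw [h4]
      exact ⟨hs k t (by omega) h2 h3 h1, by simp,
        (h3.trans ((den_same P t).mono (List.subset_cons_self _ _) (List.Subset.refl _))
          (List.Subset.refl _) (List.Subset.refl _)).setReg _ List.mem_cons_self⟩
  exact (key _ le_rfl).1

/-- Loops that establish `D i` in round `i` and never destroy it. -/
theorem den_for_forall {x : ℕ} {P : ForProg} {s : Store} (hx : x ∉ P.regs)
    (J : Store → Prop) (D : ℕ → Store → Prop)
    (hJ : ∀ t c, J t → J (t.setReg x c)) (hD : ∀ i t c, D i t → D i (t.setReg x c))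
    (h0 : J s)
    (hs : ∀ i t, i < s.reg 0 → t.reg x = i → s.Same (x :: P.regs) P.arrs t → J t →
      J (P.den inp t) ∧ D i (P.den inp t) ∧ ∀ i', D i' t → D i' (P.den inp t)) :
    J ((ForProg.forLoop x P).den inp s) ∧ ∀ i, i < s.reg 0 → D i ((ForProg.forLoop x P).den inp s) := by
  refine den_for_induct hx (fun k t => J t ∧ ∀ i, i < k → D i t) ⟨hJ _ _ h0, by simp⟩ ?_
  rintro i t hi ht hst ⟨h1, h2⟩
  obtain ⟨h3, h4, h5⟩ := hs i t hi ht hst h1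
  refine ⟨hJ _ _ h3, fun i' hi' => hD _ _ _ ?_⟩
  rcases Nat.lt_succ_iff_lt_or_eq.1 hi' with h | rfl
  · exact h5 _ (h2 _ h)
  · exact h4

/-- The form used for searching or processing all pairs: round (i, j) establishes `D i j`, and no
round destroys any instance of `D`. The body must leave register `0` alone because the inner loop
reads its bound anew each time. -/
theorem den_for_forall₂ {x y : ℕ} {P : ForProg} {s : Store} (hx : x ∉ y :: P.regs)
    (hy : y ∉ P.regs) (h0y : 0 ∉ x :: y :: P.regs)
    (J : Store → Prop) (D : ℕ → ℕ → Store → Prop)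
    (hJ : ∀ z ∈ [x, y], ∀ t c, J t → J (t.setReg z c))
    (hD : ∀ z ∈ [x, y], ∀ i j t c, D i j t → D i j (t.setReg z c))
    (h0 : J s)
    (hs : ∀ i j t, i < s.reg 0 → j < s.reg 0 → t.reg x = i → t.reg y = j →
      s.Same (x :: y :: P.regs) P.arrs t → J t →
      J (P.den inp t) ∧ D i j (P.den inp t) ∧ ∀ i' j', D i' j' t → D i' j' (P.den inp t)) :
    J ((ForProg.forLoop x (.forLoop y P)).den inp s) ∧ ∀ i j, i < s.reg 0 → j < s.reg 0 →
      D i j ((ForProg.forLoop x (.forLoop y P)).den inp s) := by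
  have main := den_for_forall (inp := inp) (x := x) (P := .forLoop y P) (s := s) hx J
    (fun i t => ∀ j, j < s.reg 0 → D i j t) (hJ x (by simp))
    (fun i t c h j hj => hD x (by simp) i j t c (h j hj)) h0 ?_
  · exact ⟨main.1, fun i j hi hj => main.2 i hi j hj⟩
  intro i t hi ht hst hJt
  have e0 : t.reg 0 = s.reg 0 := hst.reg h0y
  have inner : ∀ D' : ℕ → ℕ → Store → Prop,
      (∀ i j t c, D' i j t → D' i j (t.setReg y c)) →
      (∀ i j t, i < s.reg 0 → j < s.reg 0 → t.reg x = i → t.reg y = j →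
        s.Same (x :: y :: P.regs) P.arrs t → J t → D' i j (P.den inp t) ∧
        ∀ i' j', D' i' j' t → D' i' j' (P.den inp t)) →
      J ((ForProg.forLoop y P).den inp t) ∧
        ∀ j, j < t.reg 0 → D' i j ((ForProg.forLoop y P).den inp t) := by
    intro D' hD' hs'
    refine den_for_forall hy J (D' i) (hJ y (by simp)) (fun j t c h => hD' i j t c h) hJt ?_
    intro j t' hj ht' hst' hJt'
    have hsame : s.Same (x :: y :: P.regs) P.arrs t' :=
      hst.trans (hst'.mono (List.subset_cons_self _ _) (List.Subset.refl _))
        (List.Subset.refl _) (List.Subset.refl _)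
    have hxt : t'.reg x = i := (hst'.reg hx).trans ht
    obtain ⟨h1, h2⟩ := hs' i j t' hi (e0 ▸ hj) hxt ht' hsame hJt'
    exact ⟨(hs i j t' hi (e0 ▸ hj) hxt ht' hsame hJt').1, h1, h2 i⟩
  obtain ⟨h1, h2⟩ := inner D (hD y (by simp))
    (fun i j t hi hj hx hy hs1 hJ => (hs i j t hi hj hx hy hs1 hJ).2)
  refine ⟨h1, fun j hj => h2 j (e0.symm ▸ hj), fun i' hi' j hj => ?_⟩
  -- What an earlier outer round established has to survive a complete inner loop.
  refine (den_for_induct hy (fun _ t => J t ∧ D i' j t)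
    ⟨hJ y (by simp) _ _ hJt, hD y (by simp) _ _ _ _ (hi' j hj)⟩ ?_).2
  rintro j' t' hj' ht' hst' ⟨hJt', hD'⟩
  have hsame : s.Same (x :: y :: P.regs) P.arrs t' :=
    hst.trans (hst'.mono (List.subset_cons_self _ _) (List.Subset.refl _))
      (List.Subset.refl _) (List.Subset.refl _)
  have := hs i j' t' hi (e0 ▸ hj') ((hst'.reg hx).trans ht) ht' hsame hJt'
  exact ⟨hJ y (by simp) _ _ this.1, hD y (by simp) _ _ _ _ (this.2.2 i' j hD')⟩

/-- Loops that either reach `done` or increase a measure in every round. -/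
theorem den_for_progress {x : ℕ} {P : ForProg} {s : Store} (hx : x ∉ P.regs)
    (J done : Store → Prop) (μ : Store → ℕ) (c : ℕ)
    (hJ : ∀ t c, J t → J (t.setReg x c)) (hd : ∀ t c, done t → done (t.setReg x c))
    (hμ : ∀ t c, μ (t.setReg x c) = μ t) (h0 : J s)
    (hs : ∀ t, J t → J (P.den inp t) ∧ (done t → done (P.den inp t)) ∧
      (done (P.den inp t) ∨ μ t + c ≤ μ (P.den inp t))) :
    J ((ForProg.forLoop x P).den inp s) ∧
      (done s → done ((ForProg.forLoop x P).den inp s)) ∧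
      (done ((ForProg.forLoop x P).den inp s) ∨
        μ s + s.reg 0 * c ≤ μ ((ForProg.forLoop x P).den inp s)) := by
  refine den_for_induct hx
    (fun k t => J t ∧ (done s → done t) ∧ (done t ∨ μ s + k * c ≤ μ t)) ?_ ?_
  · exact ⟨hJ _ _ h0, hd _ _, Or.inr (by rw [hμ]; simp)⟩
  · rintro i t hi ht hst ⟨h1, h2, h3⟩
    obtain ⟨h4, h5, h6⟩ := hs t h1
    refine ⟨hJ _ _ h4, fun h => hd _ _ (h5 (h2 h)), ?_⟩
    rcases h3 with h3 | h3
    · exact Or.inl (hd _ _ (h5 h3))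
    · rcases h6 with h6 | h6
      · exact Or.inl (hd _ _ h6)
      · right
        rw [hμ, add_mul]
        omega

/-- Loops that compute the entries of a row of an array one by one. -/
theorem den_for_map {x a ρ : ℕ} {c r e : Expr} {s : Store} (g : ℕ → ℕ)
    (h : ∀ i t, i < s.reg 0 → t.reg x = i → s.Same [x] [a] t → t.mem a ρ i = s.mem a ρ i →
      r.eval inp t = ρ ∧ (if c.eval inp t = 0 then s.mem a ρ i else e.eval inp t) = g i) :
    (∀ i, i < s.reg 0 →
      ((ForProg.forLoop x (.cond c (.write a r (.reg x) e) .skip)).den inp s).mem a ρ i = g i) ∧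
    ∀ ρ' i, ρ' ≠ ρ →
      ((ForProg.forLoop x (.cond c (.write a r (.reg x) e) .skip)).den inp s).mem a ρ' i =
        s.mem a ρ' i := by
  have main := den_for_induct (inp := inp) (x := x)
    (P := .cond c (.write a r (.reg x) e) .skip) (s := s) (by simp [regs])
    (fun k t => (∀ i, i < k → t.mem a ρ i = g i) ∧ (∀ i, k ≤ i → t.mem a ρ i = s.mem a ρ i) ∧
      ∀ ρ' i, ρ' ≠ ρ → t.mem a ρ' i = s.mem a ρ' i) (by simp) ?_
  · exact ⟨main.1, main.2.2⟩
  rintro i t hi ht hst ⟨h1, h2, h3⟩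
  obtain ⟨h4, h5⟩ := h i t hi ht (by simpa [regs, arrs] using hst) (h2 i le_rfl)
  have hden : ∀ ρ' j, (((cond c (.write a r (.reg x) e) skip).den inp t).setReg x (i + 1)).mem
      a ρ' j = if ρ' = ρ ∧ j = i then g i else t.mem a ρ' j := by
    intro ρ' j
    rw [Store.setReg_mem, den]
    split_ifs with hc hj hj
    · rw [if_pos hc] at h5
      rw [hj.1, hj.2, den, ← h5, h2 i le_rfl]
    · rw [den]
    · rw [if_neg hc] at h5
      rw [den, hj.1, hj.2]
      simp [h4, Expr.eval, ht, h5]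
    · rw [den, Store.setMem_mem, h4]
      simp only [Expr.eval, ht]
      rw [if_neg]
      exact fun h => hj h.2
  refine ⟨fun j hj => ?_, fun j hj => ?_, fun ρ' j hρ => ?_⟩
  · rw [hden]
    split_ifs with h
    · rw [h.2]
    · exact h1 j (by omega)
  · rw [hden, if_neg (by omega)]
    exact h2 j (by omega)
  · rw [hden, if_neg (by tauto)]
    exact h3 ρ' j hρ

end ForProg

/-! ### Boolean expressions -/

/-- Conjunction. -/
def Expr.and (e₁ e₂ : Expr) : Expr :=
  .lt (.const 1) (.add (.lt (.const 0) e₁) (.lt (.const 0) e₂))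

/-- Inequality. -/
def Expr.ne (e₁ e₂ : Expr) : Expr := .eq (.eq e₁ e₂) (.const 0)

namespace Expr

variable {inp : ℕ → ℕ → ℕ} {s : Store} {e₁ e₂ : Expr}

@[simp] theorem eval_and_eq_zero : (e₁.and e₂).eval inp s = 0 ↔
    ¬ (e₁.eval inp s ≠ 0 ∧ e₂.eval inp s ≠ 0) := by
  simp only [Expr.and, eval, ← Nat.pos_iff_ne_zero]
  by_cases h₁ : 0 < e₁.eval inp s <;> by_cases h₂ : 0 < e₂.eval inp s <;> simp [h₁, h₂]

@[simp] theorem eval_ne_eq_zero : (e₁.ne e₂).eval inp s = 0 ↔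
    e₁.eval inp s = e₂.eval inp s := by
  simp [Expr.ne, eval]

@[simp] theorem eval_eq_eq_zero : (Expr.eq e₁ e₂).eval inp s = 0 ↔
    e₁.eval inp s ≠ e₂.eval inp s := by
  simp [eval]

@[simp] theorem eval_lt_eq_zero : (Expr.lt e₁ e₂).eval inp s = 0 ↔
    ¬ e₁.eval inp s < e₂.eval inp s := by
  simp [eval]

end Expr

end RAM

/-! ## Paths of blocks -/

namespace BlockPath

/-- A connected symmetric relation on the numbers below `N`. -/
structure Network (N : ℕ) (A : ℕ → ℕ → Prop) : Prop where
  symm : ∀ {u w}, A u w → A w u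
  lt : ∀ {u w}, A u w → u < N
  conn : ∀ {u w}, u < N → w < N → Relation.ReflTransGen A u w

variable {N : ℕ} {A : ℕ → ℕ → Prop} {lab pos pos' : ℕ → ℕ} {m j f y : ℕ}

theorem Network.lt' (hA : Network N A) {u w : ℕ} (h : A u w) : w < N := hA.lt (hA.symm h)

/-- The blocks of `lab` at the positions `1, …, m` form a path; `0` is the position of the blocks
that are not on the path. -/
structure IsPath (N : ℕ) (A : ℕ → ℕ → Prop) (lab pos : ℕ → ℕ) (m : ℕ) : Prop where
  one_le : 1 ≤ m
  congr : ∀ u w, u < N → w < N → lab u = lab w → pos u = pos w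
  inj : ∀ u w, u < N → w < N → pos u = pos w → pos u ≠ 0 → lab u = lab w
  le : ∀ u, u < N → pos u ≤ m
  surj : ∀ p, 1 ≤ p → p ≤ m → ∃ u, u < N ∧ pos u = p
  arc : ∀ p, 1 ≤ p → p < m → ∃ u w, A u w ∧ pos u = p ∧ pos w = p + 1

/-- The lowest position of a neighbour of the block at position `p` is `j`, attained by the arc from
`f` to `y`. -/
structure IsLow (A : ℕ → ℕ → Prop) (lab pos : ℕ → ℕ) (p j f y : ℕ) : Prop where
  arc : A f y
  src : pos f = p
  ne : lab y ≠ lab f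
  eq : pos y = j
  le : ∀ u w, A u w → pos u = p → lab w ≠ lab u → j ≤ pos w

/-- The lowest position of a neighbour of the block at position `p`. -/
noncomputable def low (A : ℕ → ℕ → Prop) (lab pos : ℕ → ℕ) (p : ℕ) : ℕ :=
  sInf {j | ∃ u w, A u w ∧ pos u = p ∧ lab w ≠ lab u ∧ pos w = j}

theorem low_le {p u w : ℕ} (h : A u w) (hu : pos u = p) (hne : lab w ≠ lab u) :
    low A lab pos p ≤ pos w :=
  Nat.sInf_le ⟨u, w, h, hu, hne, rfl⟩

theorem IsLow.low_eq {p : ℕ} (h : IsLow A lab pos p j f y) : low A lab pos p = j := by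
  refine le_antisymm (h.eq ▸ low_le h.arc h.src h.ne) ?_
  obtain ⟨u, w, h1, h2, h3, h4⟩ := Nat.sInf_mem (s := {j | ∃ u w, A u w ∧ pos u = p ∧
    lab w ≠ lab u ∧ pos w = j}) ⟨_, f, y, h.arc, h.src, h.ne, rfl⟩
  have := h.le u w h1 h2 h3
  unfold low
  omega

/-- A potential of paths. -/
noncomputable def potential (N : ℕ) (A : ℕ → ℕ → Prop) (lab pos : ℕ → ℕ) (m : ℕ) : ℕ :=
  m * (N + 1) + (N - low A lab pos m)

/-- Each of the positions 1, …, m is taken by one of the N vertices. -/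
theorem IsPath.length_le (h : IsPath N A lab pos m) : m ≤ N := by
  have : Finset.Icc 1 m ⊆ (Finset.range N).image pos := by
    intro p hp
    rw [Finset.mem_Icc] at hp
    obtain ⟨u, hu, e⟩ := h.surj p hp.1 hp.2
    exact Finset.mem_image.2 ⟨u, Finset.mem_range.2 hu, e⟩
  have := (Finset.card_le_card this).trans Finset.card_image_le
  simpa using this

theorem IsPath.potential_le (h : IsPath N A lab pos m) :
    potential N A lab pos m ≤ N * (N + 1) + N :=
  add_le_add (Nat.mul_le_mul_right _ h.length_le) (Nat.sub_le _ _)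

/-- By connectivity, a walk from the last block to another block contains an arc leaving the last
block; so the lowest neighbour of the end exists. -/
theorem IsPath.exists_arc (hA : Network N A) (h : IsPath N A lab pos m)
    (hlab : ∃ u w, u < N ∧ w < N ∧ lab u ≠ lab w) :
    ∃ f y, A f y ∧ pos f = m ∧ lab y ≠ lab f := by
  obtain ⟨u, w, hu, hw, hne⟩ := hlab
  obtain ⟨v, hv, e⟩ := h.surj m h.one_le le_rfl
  have : ∃ z, z < N ∧ lab z ≠ lab v := by
    by_cases hz : lab u = lab v
    · exact ⟨w, hw, fun h' => hne (hz.trans h'.symm)⟩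
    · exact ⟨u, hu, hz⟩
  obtain ⟨z, hz, hzv⟩ := this
  obtain ⟨x, y, hxy, hx, hy⟩ := exists_arc_of_reflTransGen (hA.conn hv hz)
    (fun x => lab x = lab v) rfl hzv
  exact ⟨x, y, hxy, (h.congr x v (hA.lt hxy) hv hx).trans e, fun e' => hy (e'.trans hx)⟩

theorem IsPath.pos_ne (hA : Network N A) (h : IsPath N A lab pos m) {u w : ℕ} (hw : A u w)
    (hu : pos u ≠ 0) (hne : lab w ≠ lab u) : pos w ≠ pos u :=
  fun e => hne (h.inj u w (hA.lt hw) (hA.lt' hw) e.symm hu).symm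

/-- A neighbouring block has position at most m, and not m, since a nonzero position belongs to only
one block. -/
theorem IsLow.lt (hA : Network N A) (h : IsPath N A lab pos m) (hl : IsLow A lab pos m j f y) :
    j < m := by
  have h1 := h.le y (hA.lt' hl.arc)
  have h2 := h.pos_ne hA hl.arc (by have := hl.src; have := h.one_le; omega) hl.ne
  have h3 := hl.src
  have h4 := hl.eq
  omega

/-! ### Modifications of a path -/

theorem isPath_single {v : ℕ} (hv : v < N)
    (hp : ∀ u, u < N → pos u = if lab u = lab v then 1 else 0) : IsPath N A lab pos 1 where
  one_le := le_rfl
  congr u w hu hw e := by rw [hp u hu, hp w hw, e]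
  inj u w hu hw e h0 := by
    rw [hp u hu] at e h0
    rw [hp w hw] at e
    split_ifs at e h0 with h1 h2 <;> simp_all
  le u hu := by
    rw [hp u hu]
    split_ifs <;> omega
  surj p h1 h2 := ⟨v, hv, by rw [hp v hv, if_pos rfl]; omega⟩
  arc p h1 h2 := by omega

theorem IsPath.extend (hA : Network N A) (h : IsPath N A lab pos m) (hfy : A f y)
    (hf : pos f = m) (hy : pos y = 0)
    (hp : ∀ v, v < N → pos' v = if lab v = lab y then m + 1 else pos v) :
    IsPath N A lab pos' (m + 1) := by
  have hyN := hA.lt' hfy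
  have h0 : ∀ v, v < N → lab v = lab y → pos v = 0 := fun v hv e =>
    (h.congr v y hv hyN e).trans hy
  have hne : ∀ v, v < N → pos v ≠ 0 → pos' v = pos v := fun v hv hv0 => by
    rw [hp v hv, if_neg fun e => hv0 (h0 v hv e)]
  refine ⟨by omega, fun u w hu hw e => ?_, fun u w hu hw e hu0 => ?_, fun u hu => ?_,
    fun p h1 h2 => ?_, fun p h1 h2 => ?_⟩
  · rw [hp u hu, hp w hw, e, h.congr u w hu hw e]
  · have hu' := h.le u hu
    have hw' := h.le w hw
    rw [hp u hu] at e hu0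
    rw [hp w hw] at e
    split_ifs at e hu0 with h1 h2 h2
    · exact h1.trans h2.symm
    · omega
    · omega
    · exact h.inj u w hu hw e hu0
  · have := h.le u hu
    rw [hp u hu]
    split_ifs <;> omega
  · rcases Nat.lt_or_ge m p with h3 | h3
    · exact ⟨y, hyN, by rw [hp y hyN, if_pos rfl]; omega⟩
    · obtain ⟨u, hu, e⟩ := h.surj p h1 h3
      exact ⟨u, hu, by rw [hne u hu (by omega), e]⟩
  · rcases Nat.lt_or_ge p m with h3 | h3
    · obtain ⟨u, w, ha, hu, hw⟩ := h.arc p h1 h3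
      exact ⟨u, w, ha, by rw [hne u (hA.lt ha) (by omega), hu],
        by rw [hne w (hA.lt' ha) (by omega), hw]⟩
    · have := h.one_le
      exact ⟨f, y, hfy, by rw [hne f (hA.lt hfy) (by omega)]; omega,
        by rw [hp y hyN, if_pos rfl]; omega⟩

/-- The new order is 1, …, j, m, m - 1, …, j + 1. The arc from the end to position j, traversed
backwards, is the new link; the reversed part uses the old arcs backwards. -/
theorem IsPath.reverse (hA : Network N A) (h : IsPath N A lab pos m) (hfy : A f y)
    (hf : pos f = m) (hy : pos y = j) (hj : 0 < j)
    (hp : ∀ v, v < N → pos' v = if j < pos v then m + j + 1 - pos v else pos v) :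
    IsPath N A lab pos' m := by
  refine ⟨h.one_le, fun u w hu hw e => ?_, fun u w hu hw e hu0 => ?_, fun u hu => ?_,
    fun p h1 h2 => ?_, fun p h1 h2 => ?_⟩
  · rw [hp u hu, hp w hw, h.congr u w hu hw e]
  · have hu' := h.le u hu
    have hw' := h.le w hw
    rw [hp u hu] at e hu0
    rw [hp w hw] at e
    split_ifs at e hu0 with h1 h2 h2 <;> first | omega | exact h.inj u w hu hw (by omega) (by omega)
  · have := h.le u hu
    rw [hp u hu]
    split_ifs <;> omega
  · rcases Nat.lt_or_ge j p with h3 | h3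
    · obtain ⟨u, hu, e⟩ := h.surj (m + j + 1 - p) (by omega) (by omega)
      exact ⟨u, hu, by rw [hp u hu, if_pos (by omega)]; omega⟩
    · obtain ⟨u, hu, e⟩ := h.surj p h1 (by omega)
      exact ⟨u, hu, by rw [hp u hu, if_neg (by omega), e]⟩
  · rcases Nat.lt_trichotomy p j with h3 | h3 | h3
    · obtain ⟨u, w, ha, hu, hw⟩ := h.arc p h1 (by omega)
      exact ⟨u, w, ha, by rw [hp u (hA.lt ha), if_neg (by omega), hu],
        by rw [hp w (hA.lt' ha), if_neg (by omega), hw]⟩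
    · exact ⟨y, f, hA.symm hfy, by rw [hp y (hA.lt' hfy), if_neg (by omega)]; omega,
        by rw [hp f (hA.lt hfy), if_pos (by omega)]; omega⟩
    · obtain ⟨u, w, ha, hu, hw⟩ := h.arc (m + j - p) (by omega) (by omega)
      exact ⟨w, u, hA.symm ha, by rw [hp w (hA.lt' ha), if_pos (by omega)]; omega,
        by rw [hp u (hA.lt ha), if_pos (by omega)]; omega⟩

theorem IsPath.replace (hA : Network N A) (h : IsPath N A lab pos m) (hfy : A f y)
    (hf : pos f + 1 = m) (hy : pos y = 0) (hm : 2 ≤ m)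
    (hp : ∀ v, v < N → pos' v = if lab v = lab y then m else if pos v = m then 0 else pos v) :
    IsPath N A lab pos' m := by
  have hyN := hA.lt' hfy
  have h0 : ∀ v, v < N → lab v = lab y → pos v = 0 := fun v hv e =>
    (h.congr v y hv hyN e).trans hy
  have hne : ∀ v, v < N → pos v ≠ 0 → pos v < m → pos' v = pos v := fun v hv hv0 hvm => by
    rw [hp v hv, if_neg fun e => hv0 (h0 v hv e), if_neg (by omega)]
  refine ⟨by omega, fun u w hu hw e => ?_, fun u w hu hw e hu0 => ?_, fun u hu => ?_,
    fun p h1 h2 => ?_, fun p h1 h2 => ?_⟩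
  · rw [hp u hu, hp w hw, e, h.congr u w hu hw e]
  · rw [hp u hu] at e hu0
    rw [hp w hw] at e
    split_ifs at e hu0 with h1 h2 h2 <;>
      first
      | omega
      | exact h1.trans h2.symm
      | exact h.inj u w hu hw e hu0
  · have := h.le u hu
    rw [hp u hu]
    split_ifs <;> omega
  · rcases Nat.lt_or_ge p m with h3 | h3
    · obtain ⟨u, hu, e⟩ := h.surj p h1 h2
      exact ⟨u, hu, by rw [hne u hu (by omega) (by omega), e]⟩
    · exact ⟨y, hyN, by rw [hp y hyN, if_pos rfl]; omega⟩
  · rcases Nat.lt_or_ge (p + 1) m with h3 | h3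
    · obtain ⟨u, w, ha, hu, hw⟩ := h.arc p h1 h2
      exact ⟨u, w, ha, by rw [hne u (hA.lt ha) (by omega) (by omega), hu],
        by rw [hne w (hA.lt' ha) (by omega) (by omega), hw]⟩
    · exact ⟨f, y, hfy, by rw [hne f (hA.lt hfy) (by omega) (by omega)]; omega,
        by rw [hp y hyN, if_pos rfl]; omega⟩

/-- One more block contributes N + 1, while the second summand of the potential can drop by at most
N. -/
theorem potential_lt_of_length_lt {m' : ℕ} (h : m < m') :
    potential N A lab pos m + 1 ≤ potential N A lab pos' m' := by
  have : (m + 1) * (N + 1) ≤ m' * (N + 1) := Nat.mul_le_mul_right _ h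
  unfold potential
  rw [add_mul] at this
  omega

/-- The bound by N is needed for the truncated subtraction to be strictly monotone. -/
theorem potential_lt_of_low_lt (hN : low A lab pos m ≤ N)
    (h : low A lab pos' m < low A lab pos m) :
    potential N A lab pos m + 1 ≤ potential N A lab pos' m := by
  unfold potential
  omega

/-- The new end is the block formerly at j + 1, and its neighbour below j has not moved. -/
theorem IsPath.low_reverse (hA : Network N A) (h : IsPath N A lab pos m)
    (hl : IsLow A lab pos m j f y)
    (hp : ∀ v, v < N → pos' v = if j < pos v then m + j + 1 - pos v else pos v) {u w : ℕ}
    (ha : A u w) (hu : pos u = j + 1) (hne : lab w ≠ lab u) (hw : pos w < j) :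
    potential N A lab pos m + 1 ≤ potential N A lab pos' m := by
  have hjm := hl.lt hA h
  have := h.length_le
  refine potential_lt_of_low_lt (by rw [hl.low_eq]; omega) ?_
  rw [hl.low_eq]
  refine lt_of_le_of_lt (low_le ha ?_ hne) (b := pos' w) ?_
  · rw [hp u (hA.lt ha), if_pos (by omega)]
    omega
  · rw [hp w (hA.lt' ha), if_neg (by omega)]
    exact hw

/-- A neighbour of the new end that is not at j was either below j, or it was the old end, which is
now off the path and has position 0. -/
theorem IsPath.low_replace (hA : Network N A) (h : IsPath N A lab pos m)
    (hl : IsLow A lab pos m j f y) (hj : 0 < j) (hjm : j + 1 = m) {z : ℕ}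
    (hp : ∀ v, v < N → pos' v = if lab v = lab z then m else if pos v = m then 0 else pos v)
    {u w : ℕ} (ha : A u w) (hu : lab u = lab z) (hne : lab w ≠ lab z) (hw : pos w ≠ j) :
    potential N A lab pos m + 1 ≤ potential N A lab pos' m := by
  have := h.length_le
  have hwm := h.le w (hA.lt' ha)
  refine potential_lt_of_low_lt (by rw [hl.low_eq]; omega) ?_
  rw [hl.low_eq]
  refine lt_of_le_of_lt (low_le ha ?_ (fun e => hne (e.trans hu))) (b := pos' w) ?_
  · rw [hp u (hA.lt ha), if_pos hu]
  · rw [hp w (hA.lt' ha), if_neg hne]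
    split_ifs <;> omega

/-! ### Paths that cannot be modified -/

/-- The situation in which the path is not modified any more. -/
def Terminal (A : ℕ → ℕ → Prop) (lab pos : ℕ → ℕ) (m j f y : ℕ) : Prop :=
  0 < j ∧ IsLow A lab pos m j f y ∧
    (j + 1 < m ∧ (∀ u w, A u w → pos u = j + 1 → lab w ≠ lab u → j ≤ pos w) ∨
      j + 1 = m ∧ ∀ u y y' w, A u y → pos u = j → pos y = 0 → lab y' = lab y → A y' w →
        lab w ≠ lab y → pos w = j)

/-- Every vertex of `C` with an arc leaving `C` is in `W` and has all its arcs to `W`. -/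
def InternalCut (A : ℕ → ℕ → Prop) (W C : ℕ → Prop) : Prop :=
  ∀ v w, A v w → C v → ¬ C w → W v ∧ ∀ x, A v x → W x

/-- The cycle (or single vertex) formed by the positions `i, …, pos f`, closed by the star `f`,
extends to a perfect set for which the cuts `C₁` and `C₂` are internal. -/
structure IsCore (N : ℕ) (A : ℕ → ℕ → Prop) (lab pos : ℕ → ℕ) (f i : ℕ) (C₁ C₂ : ℕ → Prop) :
    Prop where
  one_le : 1 ≤ i
  le : i ≤ pos f
  closing : i = pos f ∨ ∃ x, A f x ∧ pos x = i
  star : ∃ x, A f x ∧ lab x ≠ lab f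
  sat₁ : ∀ u w, u < N → w < N → lab u = lab w → C₁ u → C₁ w
  sat₂ : ∀ u w, u < N → w < N → lab u = lab w → C₂ u → C₂ w
  nonempty₁ : ∃ u, u < N ∧ C₁ u
  nonempty₂ : ∃ u, u < N ∧ C₂ u
  disj : ∀ u, u < N → ¬ (C₁ u ∧ C₂ u)
  internal : ∀ W : ℕ → Prop, (∀ u w, u < N → w < N → lab u = lab w → W u → W w) →
    (∀ v, v < N → i ≤ pos v → pos v ≤ pos f → W v) → (∀ x, A f x → W x) →
    InternalCut A W C₁ ∧ InternalCut A W C₂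

/-- Neither the end nor the block at j + 1 has a neighbour below j, so all their arcs stay on the
cycle j, …, m, which any admissible `W` contains. The cuts are different blocks because j + 1 < m.
-/
theorem IsPath.isCore_cycle (hA : Network N A) (h : IsPath N A lab pos m)
    (hl : IsLow A lab pos m j f y) (hj : 0 < j) (hjm : j + 1 < m)
    (hl' : ∀ u w, A u w → pos u = j + 1 → lab w ≠ lab u → j ≤ pos w) :
    IsCore N A lab pos f j (fun v => pos v = m) (fun v => pos v = j + 1) := by
  have hsat : ∀ p u w, u < N → w < N → lab u = lab w → pos u = p → pos w = p :=
    fun p u w hu hw e hp => (h.congr u w hu hw e).symm.trans hp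
  have hfm := hl.src
  refine ⟨hj, by omega, Or.inr ⟨y, hl.arc, hl.eq⟩, ⟨y, hl.arc, hl.ne⟩, hsat _, hsat _,
    h.surj m h.one_le le_rfl, h.surj (j + 1) (by omega) (by omega), fun u _ hu => by omega, ?_⟩
  intro W hW hcyc hf
  have hW' : ∀ v x, A v x → j ≤ pos v → (lab x ≠ lab v → j ≤ pos x) → W x := by
    intro v x hx hv hxv
    refine hcyc x (hA.lt' hx) ?_ (hfm ▸ h.le x (hA.lt' hx))
    by_cases e : lab x = lab v
    · rwa [h.congr x v (hA.lt' hx) (hA.lt hx) e]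
    · exact hxv e
  constructor
  · intro v w hvw hv _
    exact ⟨hcyc v (hA.lt hvw) (by omega) (by omega),
      fun x hx => hW' v x hx (by omega) (hl.le v x hx hv)⟩
  · intro v w hvw hv _
    exact ⟨hcyc v (hA.lt hvw) (by omega) (by omega),
      fun x hx => hW' v x hx (by omega) (hl' v x hx hv)⟩

/-- The lowest position reached by a star that leads from position `m - 1` to the leaf at position
`m` is `i`, attained by the arc from `f` to `x`. -/
structure IsLowLeaf (A : ℕ → ℕ → Prop) (lab pos : ℕ → ℕ) (m j i f x : ℕ) : Prop where
  src : pos f = j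
  leaf : ∃ z, A f z ∧ pos z = m
  attained : i = j ∨ A f x ∧ pos x = i ∧ lab x ≠ lab f
  le_src : i ≤ j
  le : ∀ u z x, A u z → A u x → pos u = j → pos z = m → lab x ≠ lab u → i ≤ pos x

/-- The end is adjacent only to the block at j = m - 1. That block is in the core, and the end
itself is in `W` because the star `g` reaches it. -/
theorem IsPath.leaf_internal (hA : Network N A) (h : IsPath N A lab pos m)
    (hl : IsLow A lab pos m j f y) (hjm : j + 1 = m) {g i : ℕ}
    (hg : pos g = j) (hgz : ∃ z, A g z ∧ pos z = m) (hij : i ≤ j) {W : ℕ → Prop}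
    (hW : ∀ u w, u < N → w < N → lab u = lab w → W u → W w)
    (hcyc : ∀ v, v < N → i ≤ pos v → pos v ≤ pos g → W v) (hWg : ∀ x, A g x → W x) :
    (∀ v, v < N → pos v = m → W v) ∧ InternalCut A W fun v => pos v = m := by
  have hm := h.one_le
  obtain ⟨z, hz, hzm⟩ := hgz
  have hWm : ∀ v, v < N → pos v = m → W v := fun v hv hvm =>
    hW z v (hA.lt' hz) hv (h.inj z v (hA.lt' hz) hv (by omega) (by omega)) (hWg z hz)
  refine ⟨hWm, fun v w hvw hv _ => ⟨hWm v (hA.lt hvw) hv, fun x hx => ?_⟩⟩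
  by_cases e : lab x = lab v
  · exact hW v x (hA.lt hx) (hA.lt' hx) e.symm (hWm v (hA.lt hvw) hv)
  · have h1 := hl.le v x hx hv e
    have h2 := h.le x (hA.lt' hx)
    have h3 := h.pos_ne hA hx (by omega) e
    exact hcyc x (hA.lt' hx) (by omega) (by omega)

theorem IsLowLeaf.star (hA : Network N A) (h : IsPath N A lab pos m) (hjm : j + 1 = m)
    {g i x : ℕ} (hg : IsLowLeaf A lab pos m j i g x) : ∃ x, A g x ∧ lab x ≠ lab g := by
  obtain ⟨z, hz, hzm⟩ := hg.leaf
  refine ⟨z, hz, fun e => ?_⟩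
  have := h.congr z g (hA.lt' hz) (hA.lt hz) e
  have := hg.src
  omega

/-- The star `g` reaches the end and a block off the path. As the end cannot be replaced, this block
too is adjacent only to the block at j. So the single star `g` is a core: its source and its heads
already include both leaves and their only neighbour. -/
theorem IsPath.isCore_two_leaves (hA : Network N A) (h : IsPath N A lab pos m)
    (hl : IsLow A lab pos m j f y) (hj : 0 < j) (hjm : j + 1 = m)
    (hleaf : ∀ u y y' w, A u y → pos u = j → pos y = 0 → lab y' = lab y → A y' w →
      lab w ≠ lab y → pos w = j) {g x : ℕ} (hg : IsLowLeaf A lab pos m j 0 g x) :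
    IsCore N A lab pos g j (fun v => pos v = m) (fun v => lab v = lab x) := by
  have hgj := hg.src
  obtain ⟨hgx, hx0, hxg⟩ := hg.attained.resolve_left (by omega)
  refine ⟨hj, by omega, Or.inl hgj.symm, hg.star hA h hjm,
    fun u w hu hw e hp => (h.congr u w hu hw e).symm.trans hp,
    fun u w _ _ e hu => e.symm.trans hu, h.surj m h.one_le le_rfl, ⟨x, hA.lt' hgx, rfl⟩, ?_, ?_⟩
  · rintro u hu ⟨h1, h2⟩
    have := h.congr u x hu (hA.lt' hgx) h2
    omega
  · intro W hW hcyc hWg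
    refine ⟨(h.leaf_internal hA hl hjm hgj hg.leaf le_rfl hW hcyc hWg).2, ?_⟩
    intro v w hvw hv _
    have hWv : W v := hW x v (hA.lt' hgx) (hA.lt hvw) hv.symm (hWg x hgx)
    refine ⟨hWv, fun z hz => ?_⟩
    by_cases e : lab z = lab x
    · exact hW v z (hA.lt hz) (hA.lt' hz) (hv.trans e.symm) hWv
    · have := hleaf g x v z hgx hgj hx0 hv hz e
      exact hcyc z (hA.lt' hz) (by omega) (by omega)

/-- A star crossing the complement of the end starts at position j and reaches the end. By the
choice of `g` such a star goes back no further than i, so all its heads lie on the cycle or at the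
end. -/
theorem IsPath.isCore_leaf (hA : Network N A) (h : IsPath N A lab pos m)
    (hl : IsLow A lab pos m j f y) (hjm : j + 1 = m) {g i x : ℕ} (hi : 0 < i)
    (hg : IsLowLeaf A lab pos m j i g x) :
    IsCore N A lab pos g i (fun v => pos v = m) (fun v => pos v ≠ m) := by
  have hgj := hg.src
  refine ⟨hi, by have := hg.le_src; omega, ?_, hg.star hA h hjm,
    fun u w hu hw e hp => (h.congr u w hu hw e).symm.trans hp,
    fun u w hu hw e hp => fun hp' => hp ((h.congr u w hu hw e).trans hp'),
    h.surj m h.one_le le_rfl, ⟨g, ?_, by omega⟩, fun u _ hu => hu.2 hu.1, ?_⟩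
  · rcases hg.attained with h1 | ⟨h1, h2, -⟩
    · exact Or.inl (h1.trans hgj.symm)
    · exact Or.inr ⟨x, h1, h2⟩
  · obtain ⟨z, hz, -⟩ := hg.leaf
    exact hA.lt hz
  · intro W hW hcyc hWg
    obtain ⟨hWm, h1⟩ := h.leaf_internal hA hl hjm hgj hg.leaf hg.le_src hW hcyc hWg
    refine ⟨h1, fun v w hvw hv hw => ?_⟩
    have hw : pos w = m := not_not.1 hw
    have hm := h.one_le
    -- By symmetry of arcs, `v` is a neighbour of the leaf, whose neighbours are all at position j.
    have hvj : pos v = j := by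
      have h2 := h.le v (hA.lt hvw)
      have h3 := hl.le w v (hA.symm hvw) hw fun e =>
        hv ((h.congr v w (hA.lt hvw) (hA.lt' hvw) e).trans hw)
      omega
    have hi' := hg.le_src
    have hWv : W v := hcyc v (hA.lt hvw) (by omega) (by omega)
    refine ⟨hWv, fun z hz => ?_⟩
    by_cases e : lab z = lab v
    · exact hW v z (hA.lt hz) (hA.lt' hz) e.symm hWv
    · have h2 := hg.le v w z hvw hz hvj hw e
      have h3 := h.le z (hA.lt' hz)
      by_cases h4 : pos z = m
      · exact hWm z (hA.lt' hz) h4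
      · exact hcyc z (hA.lt' hz) h2 (by omega)

/-! ### Perfect sets -/

/-- `v` is the star selected by `st`, which maps the label of a block to the successor of the
selected star of the block, and to `0` if there is none. -/
def Sel (N : ℕ) (lab st : ℕ → ℕ) (v : ℕ) : Prop := v < N ∧ st (lab v) = v + 1

/-- An arc of a selected star to the block of a selected star. -/
def SelArc (N : ℕ) (A : ℕ → ℕ → Prop) (lab st : ℕ → ℕ) (u v : ℕ) : Prop :=
  Sel N lab st u ∧ Sel N lab st v ∧ ∃ w, A u w ∧ lab w = lab v

/-- `st` selects a quasiperfect set of stars that contains `f`. -/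
structure IsSelection (N : ℕ) (A : ℕ → ℕ → Prop) (lab st : ℕ → ℕ) (f : ℕ) : Prop where
  mem : Sel N lab st f
  sel : ∀ l, l < N → st l ≠ 0 → ∃ v, st l = v + 1 ∧ v < N ∧ lab v = l ∧ ∃ x, A v x ∧ lab x ≠ lab v
  conn : ∀ v, Sel N lab st v → Relation.ReflTransGen (SelArc N A lab st) v f ∧
    Relation.ReflTransGen (SelArc N A lab st) f v

variable {st st' : ℕ → ℕ}

/-- Selected stars lead one position up until `f` is reached, and `f` leads back to position i,
unless i is its own position and `f` is alone. Connection to `f` is by induction on the distance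
below `f`, connection from `f` by induction on the distance above i. -/
theorem IsCore.isSelection (hA : Network N A) (h : IsPath N A lab pos m) {i : ℕ}
    {C₁ C₂ : ℕ → Prop} (hc : IsCore N A lab pos f i C₁ C₂) (hlab : ∀ v, v < N → lab v < N)
    (hf : st (lab f) = f + 1)
    (hst : ∀ l, l < N → st l ≠ 0 → l ≠ lab f → ∃ v, st l = v + 1 ∧ v < N ∧ lab v = l ∧ i ≤ pos v ∧
      pos v < pos f ∧ ∃ w, A v w ∧ pos w = pos v + 1)
    (hst' : ∀ v, v < N → i ≤ pos v → pos v < pos f → st (lab v) ≠ 0) :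
    IsSelection N A lab st f := by
  obtain ⟨x₀, hx₀, hx₀f⟩ := hc.star
  have hfN := hA.lt hx₀
  have hi := hc.one_le
  have hif := hc.le
  have hsel : ∀ v, v < N → i ≤ pos v → pos v ≤ pos f → ∃ v', Sel N lab st v' ∧ lab v' = lab v := by
    intro v hv h1 h2
    rcases Nat.lt_or_eq_of_le h2 with h2 | h2
    · have h3 : lab v ≠ lab f := fun e => h2.ne (h.congr v f hv hfN e)
      obtain ⟨v', e, hv', e', -⟩ := hst _ (hlab v hv) (hst' v hv h1 h2) h3
      exact ⟨v', ⟨hv', e' ▸ e⟩, e'⟩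
    · exact ⟨f, ⟨hfN, hf⟩, (h.inj v f hv hfN h2 (by omega)).symm⟩
  have hprop : ∀ v, Sel N lab st v → v = f ∨ i ≤ pos v ∧ pos v < pos f ∧
      ∃ w, A v w ∧ pos w = pos v + 1 := by
    intro v hv
    by_cases e : lab v = lab f
    · left
      have := hv.2
      rw [e, hf] at this
      omega
    · obtain ⟨v', e', hv', e'', h1⟩ := hst (lab v) (hlab v hv.1) (by rw [hv.2]; omega) e
      have : v' = v := by have := hv.2; omega
      exact Or.inr (this ▸ h1)
  refine ⟨⟨hfN, hf⟩, fun l hlN hl => ?_, ?_⟩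
  · by_cases e : l = lab f
    · exact ⟨f, e ▸ hf, hfN, e.symm, x₀, hx₀, hx₀f⟩
    · obtain ⟨v, h1, h2, h3, h4, h5, w, h6, h7⟩ := hst l hlN hl e
      refine ⟨v, h1, h2, h3, w, h6, fun e => ?_⟩
      have := h.congr w v (hA.lt' h6) h2 e
      omega
  · have hto : ∀ n v, Sel N lab st v → pos v + n = pos f →
        Relation.ReflTransGen (SelArc N A lab st) v f := by
      intro n
      induction n with
      | zero =>
        intro v hv hn
        rcases hprop v hv with rfl | ⟨-, h1, -⟩
        · exact .refl
        · omega
      | succ n ih =>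
        intro v hv hn
        rcases hprop v hv with rfl | ⟨h1, h2, w, hw, hwv⟩
        · exact .refl
        · obtain ⟨v', hv', e⟩ := hsel w (hA.lt' hw) (by omega) (by omega)
          have h3 := h.congr v' w hv'.1 (hA.lt' hw) e
          exact (ih v' hv' (by omega)).head ⟨hv, hv', w, hw, e.symm⟩
    have hfrom : ∀ n v, Sel N lab st v → pos v = i + n →
        Relation.ReflTransGen (SelArc N A lab st) f v := by
      intro n
      induction n with
      | zero =>
        intro v hv hn
        rcases hprop v hv with rfl | ⟨h1, h2, -⟩
        · exact .refl
        · rcases hc.closing with h3 | ⟨x, hx, hxi⟩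
          · omega
          · exact .single ⟨⟨hfN, hf⟩, hv, x, hx,
              h.inj x v (hA.lt' hx) hv.1 (by omega) (by omega)⟩
      | succ n ih =>
        intro v hv hn
        have hvf : pos v ≤ pos f := by
          rcases hprop v hv with rfl | ⟨-, h2, -⟩
          · exact le_rfl
          · exact h2.le
        obtain ⟨u, hu, hui⟩ := h.surj (i + n) (by omega) (by have := h.le f hfN; omega)
        obtain ⟨u', hu', e⟩ := hsel u hu (by omega) (by omega)
        have h3 := h.congr u' u hu'.1 hu e
        rcases hprop u' hu' with rfl | ⟨h1, h2, w, hw, hwu⟩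
        · omega
        · exact (ih u' hu' (by omega)).tail ⟨hu', hv, w, hw,
            h.inj w v (hA.lt' hw) hv.1 (by omega) (by omega)⟩
    intro v hv
    have hvf : i ≤ pos v ∧ pos v ≤ pos f := by
      rcases hprop v hv with rfl | ⟨h1, h2, -⟩
      · exact ⟨hif, le_rfl⟩
      · exact ⟨h1, h2.le⟩
    exact ⟨hto (pos f - pos v) v hv (by omega), hfrom (pos v - i) v hv (by omega)⟩

/-- The arc from `u` to `w`, together with its reverse, connects the newly selected star `w` with
`u` in both directions. This is where bidirectedness makes the greedy completion work. -/
theorem IsSelection.insert (hA : Network N A) (h : IsSelection N A lab st f) {u w : ℕ}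
    (hu : st (lab u) = u + 1) (huw : A u w) (hw : st (lab w) = 0) (hlab : ∀ v, v < N → lab v < N)
    (hst : ∀ l, l < N → st' l = if l = lab w then w + 1 else st l) : IsSelection N A lab st' f := by
  have hsel : ∀ v, Sel N lab st v → Sel N lab st' v := by
    intro v hv
    refine ⟨hv.1, ?_⟩
    rw [hst _ (hlab v hv.1), if_neg fun e => ?_, hv.2]
    have := hv.2
    rw [e, hw] at this
    omega
  have hsel' : ∀ v, Sel N lab st' v → Sel N lab st v ∨ v = w := by
    intro v hv
    have := hv.2
    rw [hst _ (hlab v hv.1)] at this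
    split_ifs at this
    · right
      omega
    · exact Or.inl ⟨hv.1, this⟩
  have hmono : ∀ a b, SelArc N A lab st a b → SelArc N A lab st' a b :=
    fun a b ⟨h1, h2, h3⟩ => ⟨hsel a h1, hsel b h2, h3⟩
  have huS : Sel N lab st u := ⟨hA.lt huw, hu⟩
  have hwS : Sel N lab st' w := ⟨hA.lt' huw, by rw [hst _ (hlab w (hA.lt' huw)), if_pos rfl]⟩
  have hne : lab u ≠ lab w := fun e => by
    rw [e, hw] at hu
    omega
  refine ⟨hsel f h.mem, fun l hlN hl => ?_, fun v hv => ?_⟩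
  · rw [hst l hlN] at hl ⊢
    split_ifs at hl ⊢ with e
    · exact ⟨w, rfl, hA.lt' huw, e.symm, u, hA.symm huw, hne⟩
    · exact h.sel l hlN hl
  · have lift : ∀ a b, Relation.ReflTransGen (SelArc N A lab st) a b →
        Relation.ReflTransGen (SelArc N A lab st') a b :=
      fun a b => Relation.ReflTransGen.mono hmono a b
    rcases hsel' v hv with hv | rfl
    · exact ⟨lift _ _ (h.conn v hv).1, lift _ _ (h.conn v hv).2⟩
    · exact ⟨(lift _ _ (h.conn u huS).1).head ⟨hwS, hsel u huS, u, hA.symm huw, rfl⟩,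
        (lift _ _ (h.conn u huS).2).tail ⟨hsel u huS, hwS, v, huw, rfl⟩⟩

/-- All arcs of the selected stars lead to blocks of selected stars. -/
def SelClosed (A : ℕ → ℕ → Prop) (lab st : ℕ → ℕ) : Prop :=
  ∀ u w, A u w → st (lab u) = u + 1 → st (lab w) ≠ 0

end BlockPath

/-! ## The algorithm -/

namespace RAM

open BlockPath

/-! Registers: `1` number of iterations; `2` length `m` of the path; `3`, `4`, `5` the lowest
position `j` of a neighbour of the end of the path and an arc from `f` to `y` attaining it; `6` set
when the path is final; `7` first position of the cycle; `8`–`14` auxiliary; `20`–`28` counters.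
Arrays: `0`–`3` output; `4` labels of the blocks; `5` positions on the path; `6` selected stars. -/

/-- The labels of the vertices. -/
abbrev Store.lab (s : Store) : ℕ → ℕ := s.mem 4 0

/-- The position of the block of a vertex. -/
abbrev Store.pos (s : Store) : ℕ → ℕ := s.mem 5 0

/-- The selected star of the block with a given label, plus one. -/
abbrev Store.st (s : Store) : ℕ → ℕ := s.mem 6 0

namespace Expr

def lab (e : Expr) : Expr := .read 4 (.const 0) e

def pos (e : Expr) : Expr := .read 5 (.const 0) e

def st (e : Expr) : Expr := .read 6 (.const 0) e

def succ (e : Expr) : Expr := .add e (.const 1)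

variable {inp : ℕ → ℕ → ℕ} {s : Store} {e : Expr}

@[simp] theorem eval_lab : (lab e).eval inp s = s.lab (e.eval inp s) := rfl

@[simp] theorem eval_pos : (pos e).eval inp s = s.pos (e.eval inp s) := rfl

@[simp] theorem eval_st : (st e).eval inp s = s.st (e.eval inp s) := rfl

@[simp] theorem eval_succ : (succ e).eval inp s = e.eval inp s + 1 := rfl

@[simp] theorem eval_reg {x : ℕ} : (reg x).eval inp s = s.reg x := rfl

@[simp] theorem eval_const {c : ℕ} : (const c).eval inp s = c := rfl

@[simp] theorem eval_input {e' : Expr} :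
    (input e e').eval inp s = inp (e.eval inp s) (e'.eval inp s) := rfl

end Expr

/-- The arcs of an input matrix. -/
def InputArc (inp : ℕ → ℕ → ℕ) (u w : ℕ) : Prop := inp u w ≠ 0

namespace ForProg

open RAM.Expr (lab pos st succ)

/-- Conditional execution. -/
def when (e : Expr) (P : ForProg) : ForProg := .cond e P .skip

variable {inp : ℕ → ℕ → ℕ}

theorem den_seq (P₁ P₂ : ForProg) (s : Store) :
    (seq P₁ P₂).den inp s = P₂.den inp (P₁.den inp s) := rfl

theorem den_assign (x : ℕ) (e : Expr) (s : Store) :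
    (assign x e).den inp s = s.setReg x (e.eval inp s) := rfl

theorem den_write (a : ℕ) (i j e : Expr) (s : Store) :
    (write a i j e).den inp s = s.setMem a (i.eval inp s) (j.eval inp s) (e.eval inp s) := rfl

theorem den_cond_pos {e : Expr} {P₁ P₂ : ForProg} {s : Store} (h : e.eval inp s ≠ 0) :
    (cond e P₁ P₂).den inp s = P₁.den inp s := if_neg h

theorem den_cond_neg {e : Expr} {P₁ P₂ : ForProg} {s : Store} (h : e.eval inp s = 0) :
    (cond e P₁ P₂).den inp s = P₂.den inp s := if_pos h

theorem den_when_pos {e : Expr} {P : ForProg} {s : Store} (h : e.eval inp s ≠ 0) :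
    (when e P).den inp s = P.den inp s := if_neg h

theorem den_when_neg {e : Expr} {P : ForProg} {s : Store} (h : e.eval inp s = 0) :
    (when e P).den inp s = s := if_pos h

/-- Computes the lowest position of a neighbour of the block at position `p`. -/
def lowest (p : Expr) (j f y : ℕ) : ForProg :=
  .seq (.assign j (.reg 2)) (.forLoop 20 (.forLoop 21 (when
    (.and (.input (.reg 20) (.reg 21)) (.and (.eq (pos (.reg 20)) p)
      (.and (.ne (lab (.reg 21)) (lab (.reg 20))) (.lt (pos (.reg 21)) (.reg j)))))
    (.seq (.assign j (pos (.reg 21))) (.seq (.assign f (.reg 20)) (.assign y (.reg 21)))))))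

/-- The minimum is initialized with the path length, so the first alternative is the case that no
neighbour below that value was found. -/
theorem den_lowest {p : Expr} {j f y ρ : ℕ} {s : Store} {N : ℕ} (hN : s.reg 0 = N)
    (hA : Network N (InputArc inp)) (hreg : [0, 2, 20, 21, j, f, y].Nodup)
    (hp : ∀ t, s.Same [20, 21, j, f, y] [] t → p.eval inp t = ρ) {s' : Store}
    (hs' : s' = (lowest p j f y).den inp s) :
    (s'.reg j = s.reg 2 ∧ (∀ u w, InputArc inp u w → s.pos u = ρ → s.lab w ≠ s.lab u →
        s.reg 2 ≤ s.pos w)) ∨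
      IsLow (InputArc inp) s.lab s.pos ρ (s'.reg j) (s'.reg f) (s'.reg y) := by
  simp only [List.nodup_cons, List.mem_cons, not_or, List.not_mem_nil, or_false,
    not_false_eq_true, List.nodup_nil, and_true] at hreg
  obtain ⟨⟨h0, -, -, h0j, h0f, h0y⟩, ⟨-, -, h2j, h2f, h2y⟩, ⟨-, h20j, h20f, h20y⟩,
    ⟨h21j, h21f, h21y⟩, ⟨hjf, hjy⟩, hfy⟩ := hreg
  have main := den_for_forall₂ (inp := inp) (x := 20) (y := 21) (P := when
    (.and (.input (.reg 20) (.reg 21)) (.and (.eq (pos (.reg 20)) p)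
      (.and (.ne (lab (.reg 21)) (lab (.reg 20))) (.lt (pos (.reg 21)) (.reg j)))))
    (.seq (.assign j (pos (.reg 21))) (.seq (.assign f (.reg 20)) (.assign y (.reg 21)))))
    (s := s.setReg j (s.reg 2)) (by simp [when, regs]; tauto) (by simp [when, regs]; tauto)
    (by simp [when, regs]; tauto)
    (fun t => t.reg j = s.reg 2 ∨ InputArc inp (t.reg f) (t.reg y) ∧ s.pos (t.reg f) = ρ ∧
      s.lab (t.reg y) ≠ s.lab (t.reg f) ∧ s.pos (t.reg y) = t.reg j)
    (fun u w t => InputArc inp u w → s.pos u = ρ → s.lab w ≠ s.lab u → t.reg j ≤ s.pos w)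
    (by
      intro z hz t c h
      simp only [List.mem_cons, List.not_mem_nil, or_false] at hz
      have e1 : j ≠ z := by omega
      have e2 : f ≠ z := by omega
      have e3 : y ≠ z := by omega
      simpa [e1, e2, e3] using h)
    (by
      intro z hz u w t c h
      simp only [List.mem_cons, List.not_mem_nil, or_false] at hz
      have e1 : j ≠ z := by omega
      simpa [e1] using h)
    (by simp) ?_
  · rw [Store.setReg_reg, if_neg h0j, hN] at main
    rw [hs', lowest, den_seq, den_assign, Expr.eval_reg]
    obtain ⟨h1, h2⟩ := main
    rcases h1 with h1 | ⟨h1, h3, h4, h5⟩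
    · refine Or.inl ⟨h1, fun u w ha hu hne => ?_⟩
      rw [← h1]
      exact h2 u w (hA.lt ha) (hA.lt' ha) ha hu hne
    · exact Or.inr ⟨h1, h3, h4, h5,
        fun u w ha hu hne => h2 u w (hA.lt ha) (hA.lt' ha) ha hu hne⟩
  · intro u w t hu hw htu htw hst hJ
    have hmem : t.mem = s.mem := funext fun a => by
      simpa using hst.mem (a := a) (by simp [when, arrs])
    have hpt : p.eval inp t = ρ := by
      refine hp t ⟨fun {x} hx => ?_, fun _ => by rw [hmem]⟩
      simp only [List.mem_cons, List.not_mem_nil, or_false, not_or] at hx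
      rw [hst.reg (by simp [when, regs]; tauto), Store.setReg_reg, if_neg hx.2.2.1]
    by_cases hc : InputArc inp u w ∧ s.pos u = ρ ∧ s.lab w ≠ s.lab u ∧ s.pos w < t.reg j
    · rw [den_when_pos (by
        simp only [ne_eq, Expr.eval_and_eq_zero, not_not]
        simpa [hpt, htu, htw, Store.pos, Store.lab, hmem, InputArc] using hc)]
      obtain ⟨h1, h2, h3, h4⟩ := hc
      simp only [den_seq, den_assign, Expr.eval_pos, Expr.eval_reg, htw, Store.setReg_reg,
        if_neg h20j, if_neg h21j, if_neg h21f, htu, Store.pos, hmem, if_neg hjf, if_neg hjy,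
        if_neg hfy, if_pos, if_neg (Ne.symm hfy), if_neg (Ne.symm hjf)]
      refine ⟨Or.inr ⟨h1, h2, h3, trivial⟩, fun _ _ _ => le_rfl, fun u' w' h a b c => ?_⟩
      exact h4.le.trans (h a b c)
    · rw [den_when_neg (by
        simp only [ne_eq, Expr.eval_and_eq_zero, not_not]
        simpa [hpt, htu, htw, Store.pos, Store.lab, hmem, InputArc] using hc)]
      refine ⟨hJ, fun a b c => ?_, fun _ _ h => h⟩
      by_contra h
      exact hc ⟨a, b, c, by omega⟩

end ForProg

end RAM

/-! ### The modifications of a path as programs -/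

namespace RAM

open BlockPath

namespace ForProg

open RAM.Expr (lab pos st succ)

variable {inp : ℕ → ℕ → ℕ}

/-- Overwrites those entries of row `r` of an array whose indices satisfy `c`. -/
def update (a : ℕ) (r c e : Expr) : ForProg := .forLoop 20 (.cond c (.write a r (.reg 20) e) .skip)

theorem den_update {a : ℕ} {c e : Expr} {s : Store} {N : ℕ} (hN : s.reg 0 = N) (g : ℕ → ℕ)
    (h : ∀ i t, t.reg 20 = i → s.Same [20] [a] t → t.mem a 0 i = s.mem a 0 i →
      (if c.eval inp t = 0 then s.mem a 0 i else e.eval inp t) = g i) :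
    ∀ i, i < N → ((update a (.const 0) c e).den inp s).mem a 0 i = g i :=
  hN ▸ (den_for_map g fun i t _ h1 h2 h3 => ⟨rfl, h i t h1 h2 h3⟩).1

/-- Appends the block of `y` to the path. -/
def extendPath : ForProg :=
  .seq (.assign 2 (succ (.reg 2)))
    (update 5 (.const 0) (.eq (lab (.reg 20)) (lab (.reg 5))) (.reg 2))

/-- Reverses the part of the path after position `j`. -/
def reversePath : ForProg :=
  update 5 (.const 0) (.lt (.reg 3) (pos (.reg 20)))
    (.sub (succ (.add (.reg 2) (.reg 3))) (pos (.reg 20)))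

/-- Replaces the end of the path by another block. -/
def replaceEnd : ForProg :=
  .seq (update 5 (.const 0) (.eq (pos (.reg 20)) (.reg 2)) (.const 0))
    (update 5 (.const 0) (.eq (lab (.reg 20)) (lab (.reg 10))) (.reg 2))

/-- Searches a block `y` that can replace the end of the path and has a neighbour that is not at
position `j`. -/
def findEnd : ForProg :=
  .seq (.assign 11 (.const 0)) (.forLoop 20 (.forLoop 21 (.forLoop 22 (.forLoop 23 (when
    (.and (.input (.reg 20) (.reg 21)) (.and (.eq (pos (.reg 20)) (.reg 3))
      (.and (.eq (pos (.reg 21)) (.const 0)) (.and (.eq (lab (.reg 22)) (lab (.reg 21)))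
        (.and (.input (.reg 22) (.reg 23)) (.and (.ne (lab (.reg 23)) (lab (.reg 21)))
          (.ne (pos (.reg 23)) (.reg 3))))))))
    (.assign 11 (succ (.reg 21))))))))

/-- One modification of the path, if possible. -/
def step : ForProg :=
  .seq (lowest (.reg 2) 3 4 5) (.cond (.eq (.reg 3) (.const 0)) extendPath
    (.cond (.lt (succ (.reg 3)) (.reg 2))
      (.seq (lowest (succ (.reg 3)) 8 9 10)
        (.cond (.lt (.reg 8) (.reg 3)) reversePath (.assign 6 (.const 1))))
      (.seq findEnd (.cond (.eq (.reg 11) (.const 0)) (.assign 6 (.const 1))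
        (.seq (.assign 10 (.sub (.reg 11) (.const 1))) replaceEnd)))))

variable {N : ℕ} {s : Store} {l p : ℕ → ℕ} {m j : ℕ}

theorem den_extendPath (hN : s.reg 0 = N) (hA : Network N (InputArc inp)) (el : s.lab = l)
    (ep : s.pos = p) (em : s.reg 2 = m) (h : IsPath N (InputArc inp) l p m) {f : ℕ}
    (hl : IsLow (InputArc inp) l p m 0 f (s.reg 5)) {s' : Store}
    (hs' : s' = extendPath.den inp s) :
    IsPath N (InputArc inp) l s'.pos (s'.reg 2) ∧
      potential N (InputArc inp) l p m + 1 ≤ potential N (InputArc inp) l s'.pos (s'.reg 2) := by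
  have hreg : s'.reg 2 = m + 1 := by
    rw [hs', extendPath, den_seq, (den_same _ _).reg (by simp [update, regs])]
    simp [den_assign, em]
  rw [hreg]
  refine ⟨h.extend hA hl.arc hl.src hl.eq ?_, potential_lt_of_length_lt (Nat.lt_succ_self _)⟩
  rw [hs', extendPath, den_seq]
  refine den_update (by simpa [den_assign] using hN) _ fun i t ht hst hi => ?_
  have e1 : t.reg 2 = m + 1 := (hst.reg (by simp)).trans (by simp [den_assign, em])
  have e2 : t.reg 5 = s.reg 5 := (hst.reg (by simp)).trans (by simp [den_assign])
  have e3 : t.lab = l := (congrFun (hst.mem (a := 4) (by simp)) 0).trans el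
  simp only [Expr.eval_eq_eq_zero, Expr.eval_lab, Expr.eval_reg, e1, e2, e3, ht, den_assign,
    Store.setReg_mem, ← ep]
  simp

theorem den_reversePath (hN : s.reg 0 = N) (hA : Network N (InputArc inp))
    (ep : s.pos = p) (em : s.reg 2 = m) (ej : s.reg 3 = j)
    (h : IsPath N (InputArc inp) l p m) {f y : ℕ} (hl : IsLow (InputArc inp) l p m j f y)
    (hj : 0 < j) {c u w : ℕ} (hl' : IsLow (InputArc inp) l p (j + 1) c u w) (hc : c < j)
    {s' : Store} (hs' : s' = reversePath.den inp s) :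
    IsPath N (InputArc inp) l s'.pos (s'.reg 2) ∧
      potential N (InputArc inp) l p m + 1 ≤ potential N (InputArc inp) l s'.pos (s'.reg 2) := by
  have hreg : s'.reg 2 = m := by
    rw [hs', (den_same _ _).reg (by simp [reversePath, update, regs]), em]
  rw [hreg]
  have hp : ∀ v, v < N → s'.pos v = if j < p v then m + j + 1 - p v else p v := by
    rw [hs', reversePath]
    refine den_update hN _ fun i t ht hst hi => ?_
    have e1 : t.reg 2 = m := (hst.reg (by simp)).trans em
    have e2 : t.reg 3 = j := (hst.reg (by simp)).trans ej
    have e3 : t.pos i = p i := hi.trans (congrFun ep i)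
    have e4 : s.mem 5 0 i = p i := congrFun ep i
    rw [Expr.eval]
    simp only [Expr.eval_lt_eq_zero, Expr.eval_pos, Expr.eval_reg, Expr.eval_succ, e2, e3, e4, ht]
    simp only [Expr.eval, e1, e2]
    split_ifs <;> omega
  exact ⟨h.reverse hA hl.arc hl.src hl.eq hj hp,
    h.low_reverse hA hl hp hl'.arc hl'.src hl'.ne (by rw [hl'.eq]; exact hc)⟩

theorem den_replaceEnd (hN : s.reg 0 = N) (hA : Network N (InputArc inp)) (el : s.lab = l)
    (ep : s.pos = p) (em : s.reg 2 = m) (h : IsPath N (InputArc inp) l p m) {f y z : ℕ}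
    (ez : s.reg 10 = z) (hl : IsLow (InputArc inp) l p m j f y)
    (hj : 0 < j) (hjm : j + 1 = m) {u z' w : ℕ}
    (hu : InputArc inp u z) (hu' : p u = j) (hz : p z = 0)
    (hz' : l z' = l z) (hzw : InputArc inp z' w) (hw : l w ≠ l z)
    (hw' : p w ≠ j) {s' : Store} (hs' : s' = replaceEnd.den inp s) :
    IsPath N (InputArc inp) l s'.pos (s'.reg 2) ∧
      potential N (InputArc inp) l p m + 1 ≤ potential N (InputArc inp) l s'.pos (s'.reg 2) := by
  have hreg : s'.reg 2 = m := by
    rw [hs', (den_same _ _).reg (by simp [replaceEnd, update, regs]), em]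
  rw [hreg]
  have hp : ∀ v, v < N → s'.pos v = if l v = l z then m else if p v = m then 0 else p v := by
    intro v hv
    rw [hs', replaceEnd, den_seq]
    -- The old end is cleared before the new one is placed; in the other order the new end, also at
    -- position m, would be cleared.
    set s₁ := (update 5 (.const 0) (.eq (pos (.reg 20)) (.reg 2)) (.const 0)).den inp s with hs₁
    have hsame : s.Same [20] [5] s₁ :=
      den_same (update 5 (.const 0) (.eq (pos (.reg 20)) (.reg 2)) (.const 0)) s
    have h1 : ∀ v, v < N → s₁.mem 5 0 v = if p v = m then 0 else p v := by
      rw [hs₁]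
      refine den_update hN _ fun i t ht hst hi => ?_
      have e1 : t.reg 2 = m := (hst.reg (by simp)).trans em
      have e3 : t.pos i = p i := hi.trans (congrFun ep i)
      have e4 : s.mem 5 0 i = p i := congrFun ep i
      simp only [Expr.eval_eq_eq_zero, Expr.eval_pos, Expr.eval_reg, Expr.eval_const, e1, e3, e4,
        ht]
      simp only [ne_eq, ite_not]
    have h2 : s₁.lab = l := (congrFun (hsame.mem (a := 4) (by simp)) 0).trans el
    have h3 : s₁.reg 10 = z := (hsame.reg (by simp)).trans ez
    have h4 : s₁.reg 2 = m := (hsame.reg (by simp)).trans em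
    refine (den_update ((hsame.reg (by simp)).trans hN) (fun v =>
      if l v = l z then m else s₁.mem 5 0 v) (fun i t ht hst hi => ?_) v hv).trans ?_
    · have e1 : t.reg 2 = m := (hst.reg (by simp)).trans h4
      have e2 : t.reg 10 = z := (hst.reg (by simp)).trans h3
      have e3 : t.lab = l := (congrFun (hst.mem (a := 4) (by simp)) 0).trans h2
      simp only [Expr.eval_eq_eq_zero, Expr.eval_lab, Expr.eval_reg, e1, e2, e3, ht]
      simp only [ne_eq, ite_not]
    · simp only [h1 v hv]
  exact ⟨h.replace hA hu (by omega) hz (by omega) hp,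
    h.low_replace hA hl hj hjm hp hzw hz' hw hw'⟩

/-- `y` can replace the end of the path, with a neighbour that is not at position `j`. -/
def IsNewEnd (A : ℕ → ℕ → Prop) (lab pos : ℕ → ℕ) (j u y y' w : ℕ) : Prop :=
  A u y ∧ pos u = j ∧ pos y = 0 ∧ lab y' = lab y ∧ A y' w ∧ lab w ≠ lab y ∧ pos w ≠ j

/-- Register `11` holds the found vertex plus one, so that 0 means that none exists. The four loops
are treated as a pair of loops inside a pair. -/
theorem den_findEnd (hN : s.reg 0 = N) (hA : Network N (InputArc inp)) {s' : Store}
    (hs' : s' = findEnd.den inp s) :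
    (s'.reg 11 = 0 ∧ ∀ u y y' w, ¬ IsNewEnd (InputArc inp) s.lab s.pos (s.reg 3) u y y' w) ∨
      ∃ u y y' w, IsNewEnd (InputArc inp) s.lab s.pos (s.reg 3) u y y' w ∧
        s'.reg 11 = y + 1 := by
  set Bad := IsNewEnd (InputArc inp) s.lab s.pos (s.reg 3) with hBad
  rw [findEnd, den_seq] at hs'
  set s₁ := (assign 11 (.const 0)).den inp s with hs₁
  have e0 : s₁.reg 0 = N := by simpa [hs₁, den_assign] using hN
  have e3 : s₁.reg 3 = s.reg 3 := by simp [hs₁, den_assign]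
  have em : s₁.mem = s.mem := rfl
  have hset : ∀ z ∈ [20, 21, 22, 23], ∀ (t : Store) c, (t.setReg z c).reg 11 = t.reg 11 := by
    intro z hz t c
    rw [Store.setReg_reg, if_neg]
    rintro rfl
    simp at hz
  have main := den_for_forall₂ (inp := inp) (x := 20) (y := 21) (s := s₁)
    (P := (.forLoop 22 (.forLoop 23 (when
    (.and (.input (.reg 20) (.reg 21)) (.and (.eq (pos (.reg 20)) (.reg 3))
      (.and (.eq (pos (.reg 21)) (.const 0)) (.and (.eq (lab (.reg 22)) (lab (.reg 21)))
        (.and (.input (.reg 22) (.reg 23)) (.and (.ne (lab (.reg 23)) (lab (.reg 21)))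
          (.ne (pos (.reg 23)) (.reg 3))))))))
    (.assign 11 (succ (.reg 21))))))) (by decide) (by decide) (by decide)
    (fun t => t.reg 11 = 0 ∨ ∃ u y y' w, Bad u y y' w ∧ t.reg 11 = y + 1)
    (fun u y t => t.reg 11 = 0 → ∀ y' w, ¬ Bad u y y' w)
    (fun z hz t c h => by rwa [hset z (by simp at hz ⊢; tauto)])
    (fun z hz i j t c h => by rwa [hset z (by simp at hz ⊢; tauto)])
    (Or.inl (by simp [hs₁, den_assign])) ?_
  · rw [← hs', e0] at main
    rcases main.1 with h | h
    · exact Or.inl ⟨h, fun u y y' w hB => main.2 u y (hA.lt hB.1) (hA.lt' hB.1) h y' w hB⟩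
    · exact Or.inr h
  intro u y t hu hy htu hty hst hJ
  have inner := den_for_forall₂ (inp := inp) (x := 22) (y := 23) (s := t)
    (P := when
    (.and (.input (.reg 20) (.reg 21)) (.and (.eq (pos (.reg 20)) (.reg 3))
      (.and (.eq (pos (.reg 21)) (.const 0)) (.and (.eq (lab (.reg 22)) (lab (.reg 21)))
        (.and (.input (.reg 22) (.reg 23)) (.and (.ne (lab (.reg 23)) (lab (.reg 21)))
          (.ne (pos (.reg 23)) (.reg 3))))))))
    (.assign 11 (succ (.reg 21)))) (by decide) (by decide) (by decide)
    (fun t' => (t'.reg 11 = 0 ∨ ∃ u y y' w, Bad u y y' w ∧ t'.reg 11 = y + 1) ∧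
      (t'.reg 11 = 0 → t.reg 11 = 0))
    (fun y' w t' => t'.reg 11 = 0 → ¬ Bad u y y' w)
    (fun z hz t c h => by rwa [hset z (by simp at hz ⊢; tauto)])
    (fun z hz i j t c h => by rwa [hset z (by simp at hz ⊢; tauto)])
    ⟨hJ, id⟩ ?_
  · rw [show t.reg 0 = N from (hst.reg (by decide)).trans e0] at inner
    exact ⟨inner.1.1, fun h y' w hB =>
      inner.2 y' w (hA.lt hB.2.2.2.2.1) (hA.lt' hB.2.2.2.2.1) h hB,
      fun i' j' h h' => h (inner.1.2 h')⟩
  intro y' w t' hy' hw hty' htw hst' hJ'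
  have hmem : t'.mem = s.mem := (funext fun a => (hst'.mem (a := a) (by simp [when, arrs])).trans
    (hst.mem (a := a) (by simp [when, arrs])))
  have hu' : t'.reg 20 = u := (hst'.reg (by decide)).trans htu
  have hy'' : t'.reg 21 = y := (hst'.reg (by decide)).trans hty
  have h3 : t'.reg 3 = s.reg 3 := ((hst'.reg (by decide)).trans (hst.reg (by decide))).trans e3
  by_cases hc : Bad u y y' w
  · rw [den_when_pos (by
      simp only [ne_eq, Expr.eval_and_eq_zero, not_not]
      simpa [hu', hy'', hty', htw, h3, Store.pos, Store.lab, hmem, InputArc, hBad, IsNewEnd]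
        using hc)]
    have : ((assign 11 (succ (.reg 21))).den inp t').reg 11 = y + 1 := by
      simp [den_assign, hy'']
    simp only [this]
    exact ⟨⟨Or.inr ⟨u, y, y', w, hc, rfl⟩, by omega⟩, by omega, by omega⟩
  · rw [den_when_neg (by
      simp only [ne_eq, Expr.eval_and_eq_zero, not_not]
      simpa [hu', hy'', hty', htw, h3, Store.pos, Store.lab, hmem, InputArc, hBad, IsNewEnd]
        using hc)]
    exact ⟨hJ', fun _ => hc, fun _ _ h => h⟩

theorem den_step (hN : s.reg 0 = N) (hA : Network N (InputArc inp)) (el : s.lab = l)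
    (hlab : ∃ u w, u < N ∧ w < N ∧ l u ≠ l w) (h6 : s.reg 6 = 0)
    (h : IsPath N (InputArc inp) l s.pos (s.reg 2)) {s' : Store}
    (hs' : s' = step.den inp s) :
    IsPath N (InputArc inp) l s'.pos (s'.reg 2) ∧
      (s'.reg 6 = 0 ∧ potential N (InputArc inp) l s.pos (s.reg 2) + 1 ≤
        potential N (InputArc inp) l s'.pos (s'.reg 2) ∨
      s'.reg 6 = 1 ∧
        Terminal (InputArc inp) l s'.pos (s'.reg 2) (s'.reg 3) (s'.reg 4) (s'.reg 5)) := by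
  obtain ⟨p, ep⟩ : ∃ p, s.pos = p := ⟨_, rfl⟩
  obtain ⟨m, em⟩ : ∃ m, s.reg 2 = m := ⟨_, rfl⟩
  rw [ep, em] at h ⊢
  rw [step, den_seq] at hs'
  set s₁ := (lowest (.reg 2) 3 4 5).den inp s with hs₁
  have same₁ : s.Same [3, 20, 21, 3, 4, 5] [] s₁ := den_same (lowest (.reg 2) 3 4 5) s
  have el₁ : s₁.lab = l := (congrFun (same₁.mem (by decide)) 0).trans el
  have ep₁ : s₁.pos = p := (congrFun (same₁.mem (by decide)) 0).trans ep
  have r2 : s₁.reg 2 = m := (same₁.reg (by decide)).trans em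
  have r6 : s₁.reg 6 = 0 := (same₁.reg (by decide)).trans h6
  have r0 : s₁.reg 0 = N := (same₁.reg (by decide)).trans hN
  obtain ⟨j, r3⟩ : ∃ j, s₁.reg 3 = j := ⟨_, rfl⟩
  obtain ⟨f, r4⟩ : ∃ f, s₁.reg 4 = f := ⟨_, rfl⟩
  obtain ⟨y, r5⟩ : ∃ y, s₁.reg 5 = y := ⟨_, rfl⟩
  have hl : IsLow (InputArc inp) l p m j f y := by
    rcases den_lowest (p := .reg 2) (ρ := m) hN hA (by decide)
      (fun t ht => (ht.reg (x := 2) (by decide)).trans em) hs₁ with ⟨-, h1⟩ | h1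
    · rw [el, ep, em] at h1
      -- The default value m is impossible: the end has an arc to another block, and that block has
      -- a position below m.
      obtain ⟨f, y, h2, h3, h4⟩ := h.exists_arc hA hlab
      have h5 := h1 f y h2 h3 h4
      have h6 := h.le y (hA.lt' h2)
      have h7 := h.pos_ne hA h2 (by have := h.one_le; omega) h4
      omega
    · rwa [el, ep, r3, r4, r5] at h1
  have hjm := hl.lt hA h
  clear_value s₁
  by_cases h3 : j = 0
  · rw [den_cond_pos (by simpa [r3] using h3)] at hs'
    obtain ⟨h4, h5⟩ := den_extendPath r0 hA el₁ ep₁ r2 h (f := f) (by rwa [r5, ← h3]) hs'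
    refine ⟨h4, Or.inl ⟨?_, h5⟩⟩
    rw [hs', (den_same _ _).reg (by decide), r6]
  rw [den_cond_neg (by simpa [r3] using h3)] at hs'
  have h3 : 0 < j := by omega
  by_cases h4 : j + 1 < m
  · rw [den_cond_pos (by simpa [r3, r2] using h4), den_seq] at hs'
    set s₂ := (lowest (succ (.reg 3)) 8 9 10).den inp s₁ with hs₂
    have same₂ : s₁.Same [8, 20, 21, 8, 9, 10] [] s₂ :=
      den_same (lowest (succ (.reg 3)) 8 9 10) s₁
    have ep₂ : s₂.pos = p := (congrFun (same₂.mem (by decide)) 0).trans ep₁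
    have e2 : s₂.reg 2 = m := (same₂.reg (by decide)).trans r2
    have e3 : s₂.reg 3 = j := (same₂.reg (by decide)).trans r3
    have e4 : s₂.reg 4 = f := (same₂.reg (by decide)).trans r4
    have e5 : s₂.reg 5 = y := (same₂.reg (by decide)).trans r5
    have e6 : s₂.reg 6 = 0 := (same₂.reg (by decide)).trans r6
    have e0 : s₂.reg 0 = N := (same₂.reg (by decide)).trans r0
    have hc := den_lowest (p := succ (.reg 3)) (ρ := j + 1) r0 hA (by decide)
      (fun t ht => congrArg (· + 1) ((ht.reg (x := 3) (by decide)).trans r3)) hs₂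
    rw [el₁, ep₁, r2] at hc
    clear_value s₂
    by_cases h5 : s₂.reg 8 < j
    · rw [den_cond_pos (by simpa [e3] using h5)] at hs'
      -- The default value m of the search is not below j.
      have hc := hc.resolve_left (by omega)
      obtain ⟨h6, h7⟩ := den_reversePath e0 hA ep₂ e2 e3 h hl h3 hc h5 hs'
      refine ⟨h6, Or.inl ⟨?_, h7⟩⟩
      rw [hs', (den_same _ _).reg (by decide), e6]
    · rw [den_cond_neg (by simpa [e3] using h5), den_assign] at hs'
      rw [show s'.pos = p by rw [hs']; exact ep₂, show s'.reg 2 = m by simp [hs', e2],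
        show s'.reg 3 = j by simp [hs', e3], show s'.reg 4 = f by simp [hs', e4],
        show s'.reg 5 = y by simp [hs', e5]]
      refine ⟨h, Or.inr ⟨by simp [hs'], h3, hl, Or.inl ⟨h4, fun u w ha hu hne => ?_⟩⟩⟩
      rcases hc with ⟨h6, h7⟩ | h6
      · have := h7 u w ha hu hne
        omega
      · have := h6.le u w ha hu hne
        omega
  · rw [den_cond_neg (by simpa [r3, r2] using h4), den_seq] at hs'
    have h4 : j + 1 = m := by omega
    set s₂ := findEnd.den inp s₁ with hs₂
    have same₂ : s₁.Same [11, 20, 21, 22, 23, 11] [] s₂ := den_same findEnd s₁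
    have el₂ : s₂.lab = l := (congrFun (same₂.mem (by decide)) 0).trans el₁
    have ep₂ : s₂.pos = p := (congrFun (same₂.mem (by decide)) 0).trans ep₁
    have e2 : s₂.reg 2 = m := (same₂.reg (by decide)).trans r2
    have e3 : s₂.reg 3 = j := (same₂.reg (by decide)).trans r3
    have e4 : s₂.reg 4 = f := (same₂.reg (by decide)).trans r4
    have e5 : s₂.reg 5 = y := (same₂.reg (by decide)).trans r5
    have e6 : s₂.reg 6 = 0 := (same₂.reg (by decide)).trans r6
    have e0 : s₂.reg 0 = N := (same₂.reg (by decide)).trans r0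
    have hc := den_findEnd r0 hA hs₂
    rw [el₁, ep₁, r3] at hc
    clear_value s₂
    rcases hc with ⟨h5, h6⟩ | ⟨u, z, z', w, ⟨c1, c2, c3, c4, c5, c6, c7⟩, h6⟩
    · rw [den_cond_pos (by simpa using h5), den_assign] at hs'
      rw [show s'.pos = p by rw [hs']; exact ep₂, show s'.reg 2 = m by simp [hs', e2],
        show s'.reg 3 = j by simp [hs', e3], show s'.reg 4 = f by simp [hs', e4],
        show s'.reg 5 = y by simp [hs', e5]]
      refine ⟨h, Or.inr ⟨by simp [hs'], h3, hl,
        Or.inr ⟨h4, fun u y y' w c1 c2 c3 c4 c5 c6 => ?_⟩⟩⟩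
      by_contra c7
      exact h6 u y y' w ⟨c1, c2, c3, c4, c5, c6, c7⟩
    · rw [den_cond_neg (by simp [h6]), den_seq] at hs'
      obtain ⟨h7, h8⟩ := den_replaceEnd (s := (assign 10 (.sub (.reg 11) (.const 1))).den inp s₂)
        (l := l) (p := p) (m := m) (z := z) (by simpa [den_assign] using e0) hA el₂ ep₂
        (by simpa [den_assign] using e2) h (by simp [den_assign, Expr.eval, h6]) hl h3 h4
        c1 c2 c3 c4 c5 c6 c7 hs'
      refine ⟨h7, Or.inl ⟨?_, h8⟩⟩
      rw [hs', (den_same _ _).reg (by decide), den_assign, Store.setReg_reg, if_neg (by decide), e6]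

end ForProg

end RAM

namespace RAM

open BlockPath

/-- `c` is the truth value of `p`. -/
def Indicates (c : ℕ) (p : Prop) : Prop := p ∧ c = 1 ∨ ¬ p ∧ c = 0

theorem indicates_ite (p : Prop) [Decidable p] : Indicates (if p then 1 else 0) p := by
  by_cases h : p <;> simp [Indicates, h]

namespace ForProg

open RAM.Expr (lab pos st succ)

variable {inp : ℕ → ℕ → ℕ} {N : ℕ} {s : Store} {l p : ℕ → ℕ} {m j : ℕ}

/-! ### Finding a path -/

/-- Computes a path that cannot be modified any more. -/
def findPath : ForProg :=
  .seq (update 5 (.const 0) (.const 1) (.eq (lab (.reg 20)) (lab (.const 0))))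
    (.seq (.assign 2 (.const 1)) (.seq (.assign 6 (.const 0))
      (.forLoop 26 (.forLoop 27 (.forLoop 28 (when (.eq (.reg 6) (.const 0)) step))))))

theorem den_findPath (hN : s.reg 0 = N) (hA : Network N (InputArc inp)) (el : s.lab = l)
    (hlab : ∃ u w, u < N ∧ w < N ∧ l u ≠ l w) {s' : Store} (hs' : s' = findPath.den inp s) :
    IsPath N (InputArc inp) l s'.pos (s'.reg 2) ∧
      Terminal (InputArc inp) l s'.pos (s'.reg 2) (s'.reg 3) (s'.reg 4) (s'.reg 5) := by
  have hN2 : 2 ≤ N := by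
    obtain ⟨u, w, hu, hw, hne⟩ := hlab
    by_contra h
    exact hne (by rw [show u = w by omega])
  rw [findPath, den_seq, den_seq, den_seq] at hs'
  set s₁ := (update 5 (.const 0) (.const 1) (.eq (lab (.reg 20)) (lab (.const 0)))).den inp s
    with hs₁
  have same₁ : s.Same [20] [5] s₁ :=
    den_same (update 5 (.const 0) (.const 1) (.eq (lab (.reg 20)) (lab (.const 0)))) s
  have hp : ∀ v, v < N → s₁.mem 5 0 v = if l v = l 0 then 1 else 0 := by
    rw [hs₁]
    refine den_update hN _ fun i t ht hst hi => ?_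
    have e3 : t.lab = l := (congrFun (hst.mem (a := 4) (by simp)) 0).trans el
    simp [Expr.eval, lab, ht, ← e3]
  set s₂ := (assign 6 (.const 0)).den inp ((assign 2 (.const 1)).den inp s₁) with hs₂
  have e2 : s₂.reg 2 = 1 := by simp [hs₂, den_assign]
  have e6 : s₂.reg 6 = 0 := by simp [hs₂, den_assign]
  have e0 : s₂.reg 0 = N := by
    simpa [hs₂, den_assign] using (same₁.reg (by simp)).trans hN
  have el₂ : s₂.lab = l := (congrFun (same₁.mem (a := 4) (by simp)) 0).trans el
  have h₂ : IsPath N (InputArc inp) l s₂.pos (s₂.reg 2) := by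
    rw [e2]
    exact isPath_single (v := 0) (by omega) hp
  let J : Store → Prop := fun t => t.reg 0 = N ∧ t.lab = l ∧
    IsPath N (InputArc inp) l t.pos (t.reg 2) ∧ (t.reg 6 = 0 ∨ t.reg 6 = 1 ∧
      Terminal (InputArc inp) l t.pos (t.reg 2) (t.reg 3) (t.reg 4) (t.reg 5))
  let μ : Store → ℕ := fun t => potential N (InputArc inp) l t.pos (t.reg 2)
  have set_reg : ∀ x ∈ [26, 27, 28], ∀ y ∈ [0, 2, 3, 4, 5, 6], ∀ (t : Store) c,
      (t.setReg x c).reg y = t.reg y := by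
    intro x hx y hy t c
    rw [Store.setReg_reg, if_neg]
    rintro rfl
    revert y
    decide
  have hJ : ∀ x ∈ [26, 27, 28], ∀ t c, J t → J (t.setReg x c) := by
    intro x hx t c h
    have := fun y hy => set_reg x hx y hy t c
    change _ ∧ _ ∧ IsPath _ _ _ t.pos _ ∧ (_ ∨ _ ∧ Terminal _ _ t.pos _ _ _ _)
    rw [this 0 (by decide), this 2 (by decide), this 3 (by decide), this 4 (by decide),
      this 5 (by decide), this 6 (by decide)]
    exact h
  have hd : ∀ x ∈ [26, 27, 28], ∀ (t : Store) c, t.reg 6 = 1 → (t.setReg x c).reg 6 = 1 :=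
    fun x hx t c h => (set_reg x hx 6 (by decide) t c).trans h
  have hμ : ∀ x ∈ [26, 27, 28], ∀ t c, μ (t.setReg x c) = μ t := fun x hx t c =>
    congrArg (potential N (InputArc inp) l t.pos) (set_reg x hx 2 (by decide) t c)
  have body : ∀ t, J t → J ((when (.eq (.reg 6) (.const 0)) step).den inp t) ∧
      (t.reg 6 = 1 → ((when (.eq (.reg 6) (.const 0)) step).den inp t).reg 6 = 1) ∧
      (((when (.eq (.reg 6) (.const 0)) step).den inp t).reg 6 = 1 ∨
        μ t + 1 ≤ μ ((when (.eq (.reg 6) (.const 0)) step).den inp t)) := by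
    rintro t ⟨h0, h1, h2, h3⟩
    by_cases h6 : t.reg 6 = 0
    · rw [den_when_pos (by simpa using h6)]
      obtain ⟨h4, h5⟩ := den_step h0 hA h1 hlab h6 h2 rfl
      refine ⟨⟨((den_same step t).reg (by decide)).trans h0,
        (congrFun ((den_same step t).mem (by decide)) 0).trans h1, h4, ?_⟩,
        fun h => by omega, ?_⟩
      · exact h5.imp (fun h => h.1) id
      · exact h5.elim (fun h => Or.inr h.2) fun h => Or.inl h.1
    · rw [den_when_neg (by simpa using h6)]
      exact ⟨⟨h0, h1, h2, h3⟩, id, Or.inl (h3.resolve_left h6).1⟩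
  have body₁ : ∀ t, J t → _ := fun t ht => den_for_progress (inp := inp) (x := 28)
    (P := when (.eq (.reg 6) (.const 0)) step) (s := t) (by decide) J (fun t => t.reg 6 = 1) μ 1
    (hJ 28 (by decide)) (hd 28 (by decide)) (hμ 28 (by decide)) ht body
  have body₂ : ∀ t, J t → _ := fun t ht => den_for_progress (inp := inp) (x := 27)
    (P := .forLoop 28 (when (.eq (.reg 6) (.const 0)) step)) (s := t) (by decide) J
    (fun t => t.reg 6 = 1) μ (N * 1) (hJ 27 (by decide)) (hd 27 (by decide)) (hμ 27 (by decide))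
    ht fun t ht => ht.1 ▸ body₁ t ht
  have body₃ := den_for_progress (inp := inp) (x := 26)
    (P := .forLoop 27 (.forLoop 28 (when (.eq (.reg 6) (.const 0)) step))) (s := s₂) (by decide) J
    (fun t => t.reg 6 = 1) μ (N * (N * 1)) (hJ 26 (by decide)) (hd 26 (by decide))
    (hμ 26 (by decide)) ⟨e0, el₂, h₂, Or.inl e6⟩ fun t ht => ht.1 ▸ body₂ t ht
  rw [← hs', e0] at body₃
  obtain ⟨⟨-, -, h3, h4⟩, -, h5⟩ := body₃
  refine ⟨h3, ?_⟩
  rcases h5 with h5 | h5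
  · exact (h4.resolve_left (by omega)).2
  -- The potential starts at N + 1 or more and would have grown in each of the N³ rounds, but it is
  -- at most N² + 2N, and N³ ≥ 2N² ≥ N² + 2N because N ≥ 2.
  · exfalso
    have h6 := h3.potential_le
    have h7 : N + 1 ≤ μ s₂ := by
      change N + 1 ≤ _ * _ + _
      rw [e2]
      omega
    have h8 : μ s' ≤ N * (N + 1) + N := h6
    have h9 : 2 * N ≤ N * N := Nat.mul_le_mul_right N hN2
    have h10 : 2 * (N * N) ≤ N * (N * N) := Nat.mul_le_mul_right (N * N) hN2
    rw [mul_one] at h5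
    rw [mul_add] at h8
    omega

/-! ### Choosing the cycle and the cuts -/

/-- Writes the current row of an output array. -/
def writeRow (a : ℕ) (e : Expr) : ForProg := update a (.reg 1) (.const 1) e

theorem den_writeRow {a : ℕ} {e : Expr} (hN : s.reg 0 = N) (g : ℕ → Prop)
    (h : ∀ i t, t.reg 20 = i → s.Same [20] [a] t → Indicates (e.eval inp t) (g i)) :
    (∀ i, i < N → Indicates (((writeRow a e).den inp s).mem a (s.reg 1) i) (g i)) ∧
      ∀ ρ i, ρ ≠ s.reg 1 → ((writeRow a e).den inp s).mem a ρ i = s.mem a ρ i := by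
  classical
  have main := den_for_map (inp := inp) (x := 20) (a := a) (ρ := s.reg 1) (c := .const 1)
    (r := .reg 1) (e := e) (s := s) (fun i => if g i then 1 else 0) fun i t _ ht hst _ => by
      refine ⟨hst.reg (by decide), ?_⟩
      rw [if_neg (by simp)]
      rcases h i t ht hst with h | h
      · rw [if_pos h.1, h.2]
      · rw [if_neg h.1, h.2]
  refine ⟨fun i hi => ?_, main.2⟩
  rw [show ((writeRow a e).den inp s).mem a (s.reg 1) i = _ from main.1 i (hN.symm ▸ hi)]
  exact indicates_ite _

/-- Computes the star of the last inner block that reaches furthest back, among those that reach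
the last block. -/
def lowestLeaf : ForProg :=
  .seq (.assign 7 (.reg 3)) (.seq (.assign 4 (.reg 5)) (.forLoop 20 (.forLoop 21 (when
    (.and (.input (.reg 20) (.reg 21))
      (.and (.eq (pos (.reg 20)) (.reg 3)) (.eq (pos (.reg 21)) (.reg 2))))
    (.forLoop 22 (when
      (.and (.input (.reg 20) (.reg 22))
        (.and (.ne (lab (.reg 22)) (lab (.reg 20))) (.lt (pos (.reg 22)) (.reg 7))))
      (.seq (.assign 7 (pos (.reg 22)))
        (.seq (.assign 4 (.reg 20)) (.assign 5 (.reg 22))))))))))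

/-- The search starts from i = j, attained by no arc in particular, and from a vertex at position j
known to have an arc to the end; so a star reaching the end is available even if no search round
changes anything. -/
theorem den_lowestLeaf (hN : s.reg 0 = N) (hA : Network N (InputArc inp)) (el : s.lab = l)
    (ep : s.pos = p) (em : s.reg 2 = m) (ej : s.reg 3 = j) {f : ℕ}
    (hl : IsLow (InputArc inp) l p m j f (s.reg 5)) {s' : Store}
    (hs' : s' = lowestLeaf.den inp s) :
    IsLowLeaf (InputArc inp) l p m j (s'.reg 7) (s'.reg 4) (s'.reg 5) := by
  rw [lowestLeaf, den_seq, den_seq] at hs'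
  set s₁ := (assign 4 (.reg 5)).den inp ((assign 7 (.reg 3)).den inp s) with hs₁
  have e0 : s₁.reg 0 = N := by simpa [hs₁, den_assign] using hN
  have e2 : s₁.reg 2 = m := by simpa [hs₁, den_assign] using em
  have e3 : s₁.reg 3 = j := by simpa [hs₁, den_assign] using ej
  have e7 : s₁.reg 7 = j := by simpa [hs₁, den_assign] using ej
  have e4 : s₁.reg 4 = s.reg 5 := by simp [hs₁, den_assign]
  let J : Store → Prop := fun t => p (t.reg 4) = j ∧ (∃ z, InputArc inp (t.reg 4) z ∧ p z = m) ∧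
    (t.reg 7 = j ∨ InputArc inp (t.reg 4) (t.reg 5) ∧ p (t.reg 5) = t.reg 7 ∧
      l (t.reg 5) ≠ l (t.reg 4)) ∧ t.reg 7 ≤ j
  have set_reg : ∀ x ∈ [20, 21, 22], ∀ y ∈ [4, 5, 7], ∀ (t : Store) c,
      (t.setReg x c).reg y = t.reg y := by
    intro x hx y hy t c
    rw [Store.setReg_reg, if_neg]
    rintro rfl
    revert y
    decide
  have hJ : ∀ x ∈ [20, 21, 22], ∀ t c, J t → J (t.setReg x c) := by
    intro x hx t c h
    have := fun y hy => set_reg x hx y hy t c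
    simp only [J]
    rw [this 4 (by decide), this 5 (by decide), this 7 (by decide)]
    exact h
  have main := den_for_forall₂ (inp := inp) (x := 20) (y := 21) (s := s₁) (P := (when
    (.and (.input (.reg 20) (.reg 21))
      (.and (.eq (pos (.reg 20)) (.reg 3)) (.eq (pos (.reg 21)) (.reg 2))))
    (.forLoop 22 (when
      (.and (.input (.reg 20) (.reg 22))
        (.and (.ne (lab (.reg 22)) (lab (.reg 20))) (.lt (pos (.reg 22)) (.reg 7))))
      (.seq (.assign 7 (pos (.reg 22)))
        (.seq (.assign 4 (.reg 20)) (.assign 5 (.reg 22)))))))) (by decide) (by decide)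
    (by decide) J (fun u z t => InputArc inp u z → p u = j → p z = m → ∀ x, InputArc inp u x →
      l x ≠ l u → t.reg 7 ≤ p x)
    (fun z hz => hJ z (by simp at hz ⊢; tauto))
    (fun z hz i j t c h => by rwa [set_reg z (by simp at hz ⊢; tauto) 7 (by decide)])
    -- Initially the star is the head `y` of the arc from the end to position j; the reversed arc
    -- leads from `y` to the end.
    ⟨by rw [e4, hl.eq], ⟨f, by rw [e4]; exact hA.symm hl.arc, hl.src⟩, Or.inl e7, e7.le⟩ ?_
  · rw [← hs', e0] at main
    obtain ⟨⟨h1, h2, h3, h4⟩, h5⟩ := main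
    exact ⟨h1, h2, h3, h4, fun u z x hz hx hu hzm hne =>
      h5 u z (hA.lt hz) (hA.lt' hz) hz hu hzm x hx hne⟩
  intro u z t hu hz htu htz hst hJt
  have emem : t.mem = s.mem := funext fun a => hst.mem (by simp [when, arrs])
  have t2 : t.reg 2 = m := (hst.reg (by decide)).trans e2
  have t3 : t.reg 3 = j := (hst.reg (by decide)).trans e3
  have t0 : t.reg 0 = N := (hst.reg (by decide)).trans e0
  have tp : t.pos = p := by rw [Store.pos, emem]; exact ep
  by_cases hc : InputArc inp u z ∧ p u = j ∧ p z = m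
  · rw [den_when_pos (by
      simp only [ne_eq, Expr.eval_and_eq_zero, not_not]
      simpa [htu, htz, t2, t3, tp, InputArc] using hc)]
    have inner := den_for_forall (inp := inp) (x := 22) (s := t) (P := when
      (.and (.input (.reg 20) (.reg 22))
        (.and (.ne (lab (.reg 22)) (lab (.reg 20))) (.lt (pos (.reg 22)) (.reg 7))))
      (.seq (.assign 7 (pos (.reg 22)))
        (.seq (.assign 4 (.reg 20)) (.assign 5 (.reg 22))))) (by decide)
      (fun t' => J t' ∧ t'.reg 7 ≤ t.reg 7)
      (fun x t' => InputArc inp u x → l x ≠ l u → t'.reg 7 ≤ p x)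
      (fun t' c h => ⟨hJ 22 (by decide) t' c h.1,
        by rw [set_reg 22 (by decide) 7 (by decide)]; exact h.2⟩)
      (fun i t c h => by rwa [set_reg 22 (by decide) 7 (by decide)]) ⟨hJt, le_rfl⟩ ?_
    · rw [t0] at inner
      exact ⟨inner.1.1, fun _ _ _ x hx hne => inner.2 x (hA.lt' hx) hx hne,
        fun u' z' h a b c x hx hne => inner.1.2.trans (h a b c x hx hne)⟩
    intro x t' hx htx hst' hJ'
    have emem' : t'.mem = s.mem := (funext fun a => hst'.mem (by simp [when, arrs])).trans emem
    have tp' : t'.pos = p := by rw [Store.pos, emem']; exact ep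
    have tl' : t'.lab = l := by rw [Store.lab, emem']; exact el
    have t20 : t'.reg 20 = u := (hst'.reg (by decide)).trans htu
    by_cases hc' : InputArc inp u x ∧ l x ≠ l u ∧ p x < t'.reg 7
    · rw [den_when_pos (by
        simp only [ne_eq, Expr.eval_and_eq_zero, not_not]
        simpa [t20, htx, tp', tl', InputArc] using hc')]
      have r4 : ((seq (.assign 7 (pos (.reg 22))) (.seq (.assign 4 (.reg 20))
        (.assign 5 (.reg 22)))).den inp t').reg 4 = u := by simp [den_seq, den_assign, t20]
      have r5 : ((seq (.assign 7 (pos (.reg 22))) (.seq (.assign 4 (.reg 20))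
        (.assign 5 (.reg 22)))).den inp t').reg 5 = x := by simp [den_seq, den_assign, htx]
      have r7 : ((seq (.assign 7 (pos (.reg 22))) (.seq (.assign 4 (.reg 20))
        (.assign 5 (.reg 22)))).den inp t').reg 7 = p x := by
        simp [den_seq, den_assign, htx, tp']
      simp only [J, r4, r5, r7]
      obtain ⟨h1, h2, h3⟩ := hc'
      exact ⟨⟨⟨hc.2.1, ⟨z, hc.1, hc.2.2⟩, Or.inr ⟨h1, trivial, h2⟩, h3.le.trans hJ'.1.2.2.2⟩,
        h3.le.trans hJ'.2⟩, fun _ _ => le_rfl, fun i h a b => h3.le.trans (h a b)⟩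
    · rw [den_when_neg (by
        simp only [ne_eq, Expr.eval_and_eq_zero, not_not]
        simpa [t20, htx, tp', tl', InputArc] using hc')]
      refine ⟨hJ', fun a b => ?_, fun _ h => h⟩
      by_contra h
      exact hc' ⟨a, b, by omega⟩
  · rw [den_when_neg (by
      simp only [ne_eq, Expr.eval_and_eq_zero, not_not]
      simpa [htu, htz, t2, t3, tp, InputArc] using hc)]
    exact ⟨hJt, fun a b c => absurd ⟨a, b, c⟩ hc, fun _ _ h => h⟩

/-- Chooses the cycle and writes the second cut. -/
def chooseCore : ForProg :=
  .cond (.lt (succ (.reg 3)) (.reg 2))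
    (.seq (.assign 7 (.reg 3)) (writeRow 3 (.eq (pos (.reg 20)) (succ (.reg 3)))))
    (.seq lowestLeaf (.cond (.eq (.reg 7) (.const 0))
      (.seq (.assign 7 (.reg 3)) (writeRow 3 (.eq (lab (.reg 20)) (lab (.reg 5)))))
      (writeRow 3 (.ne (pos (.reg 20)) (.reg 2)))))

/-- In all three terminal cases the first cut is the end of the path, so only the second one is
chosen and written here. -/
theorem den_chooseCore (hN : s.reg 0 = N) (hA : Network N (InputArc inp)) (el : s.lab = l)
    (ep : s.pos = p) (em : s.reg 2 = m) (h : IsPath N (InputArc inp) l p m)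
    (ht : Terminal (InputArc inp) l p m (s.reg 3) (s.reg 4) (s.reg 5)) {s' : Store}
    (hs' : s' = chooseCore.den inp s) :
    ∃ C : ℕ → Prop, IsCore N (InputArc inp) l p (s'.reg 4) (s'.reg 7) (fun v => p v = m) C ∧
      (∀ v, v < N → Indicates (s'.mem 3 (s.reg 1) v) (C v)) ∧
      ∀ ρ v, ρ ≠ s.reg 1 → s'.mem 3 ρ v = s.mem 3 ρ v := by
  obtain ⟨j, ej⟩ : ∃ j, s.reg 3 = j := ⟨_, rfl⟩
  rw [ej] at ht
  obtain ⟨hj, hl, ht⟩ := ht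
  rw [chooseCore] at hs'
  by_cases hjm : j + 1 < m
  · rw [den_cond_pos (by simpa [ej, em] using hjm), den_seq] at hs'
    have hl' := (ht.resolve_right (by omega)).2
    have e0 : ((assign 7 (.reg 3)).den inp s).reg 0 = N := by simpa [den_assign] using hN
    have e1 : ((assign 7 (.reg 3)).den inp s).reg 1 = s.reg 1 := by simp [den_assign]
    obtain ⟨h1, h2⟩ := den_writeRow (inp := inp) (a := 3)
      (e := .eq (pos (.reg 20)) (succ (.reg 3))) e0 (fun v => p v = j + 1)
      fun i t ht hst => by
        have t3 : t.reg 3 = j := (hst.reg (by decide)).trans (by simpa [den_assign] using ej)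
        have tp : t.pos = p := (congrFun (hst.mem (by decide)) 0).trans ep
        simpa [Expr.eval, pos, succ, ht, t3, ← tp] using indicates_ite _
    rw [e1, ← hs'] at h1 h2
    refine ⟨_, ?_, h1, h2⟩
    have r4 : s'.reg 4 = s.reg 4 := by
      rw [hs', (den_same _ _).reg (by decide)]
      simp [den_assign]
    have r7 : s'.reg 7 = j := by
      rw [hs', (den_same _ _).reg (by decide)]
      simpa [den_assign] using ej
    rw [r4, r7]
    exact h.isCore_cycle hA hl hj hjm hl'
  · rw [den_cond_neg (by simpa [ej, em] using hjm), den_seq] at hs'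
    obtain ⟨hjm, hleaf⟩ := ht.resolve_left (by omega)
    set s₁ := lowestLeaf.den inp s with hs₁
    have same₁ : s.Same lowestLeaf.regs [] s₁ := den_same lowestLeaf s
    have hg := den_lowestLeaf hN hA el ep em ej hl hs₁
    have el₁ : s₁.lab = l := (congrFun (same₁.mem (by decide)) 0).trans el
    have ep₁ : s₁.pos = p := (congrFun (same₁.mem (by decide)) 0).trans ep
    have r0 : s₁.reg 0 = N := (same₁.reg (by decide)).trans hN
    have r1 : s₁.reg 1 = s.reg 1 := same₁.reg (by decide)
    have r2 : s₁.reg 2 = m := (same₁.reg (by decide)).trans em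
    have r3 : s₁.reg 3 = j := (same₁.reg (by decide)).trans ej
    have m3 : s₁.mem 3 = s.mem 3 := same₁.mem (by decide)
    clear_value s₁
    by_cases h7 : s₁.reg 7 = 0
    · rw [den_cond_pos (by simpa using h7), den_seq] at hs'
      rw [h7] at hg
      have e0 : ((assign 7 (.reg 3)).den inp s₁).reg 0 = N := by simpa [den_assign] using r0
      have e1 : ((assign 7 (.reg 3)).den inp s₁).reg 1 = s.reg 1 := by
        simpa [den_assign] using r1
      obtain ⟨h1, h2⟩ := den_writeRow (inp := inp) (a := 3)
        (e := .eq (lab (.reg 20)) (lab (.reg 5))) e0 (fun v => l v = l (s₁.reg 5))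
        fun i t ht hst => by
          have t5 : t.reg 5 = s₁.reg 5 := (hst.reg (by decide)).trans (by simp [den_assign])
          have tp : t.lab = l := (congrFun (hst.mem (by decide)) 0).trans el₁
          simpa [Expr.eval, lab, ht, t5, ← tp] using indicates_ite _
      rw [e1, ← hs'] at h1 h2
      refine ⟨_, ?_, h1, fun ρ v hρ => (h2 ρ v hρ).trans (congrFun (congrFun m3 ρ) v)⟩
      have r4 : s'.reg 4 = s₁.reg 4 := by
        rw [hs', (den_same _ _).reg (by decide)]
        simp [den_assign]
      have r7 : s'.reg 7 = j := by
        rw [hs', (den_same _ _).reg (by decide)]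
        simpa [den_assign] using r3
      rw [r4, r7]
      exact h.isCore_two_leaves hA hl hj hjm hleaf hg
    · rw [den_cond_neg (by simpa using h7)] at hs'
      obtain ⟨h1, h2⟩ := den_writeRow (inp := inp) (a := 3)
        (e := .ne (pos (.reg 20)) (.reg 2)) r0 (fun v => p v ≠ m)
        fun i t ht hst => by
          have t2 : t.reg 2 = m := (hst.reg (by decide)).trans r2
          have tp : t.pos = p := (congrFun (hst.mem (by decide)) 0).trans ep₁
          have := indicates_ite (t.pos i ≠ m)
          rw [tp] at this
          simpa [Expr.eval, Expr.ne, pos, ht, t2, ← tp] using this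
      rw [r1, ← hs'] at h1 h2
      refine ⟨_, ?_, h1, fun ρ v hρ => (h2 ρ v hρ).trans (congrFun (congrFun m3 ρ) v)⟩
      have r4 : s'.reg 4 = s₁.reg 4 := by rw [hs', (den_same _ _).reg (by decide)]
      have r7 : s'.reg 7 = s₁.reg 7 := by rw [hs', (den_same _ _).reg (by decide)]
      rw [r4, r7]
      exact h.isCore_leaf hA hl hjm (Nat.pos_of_ne_zero h7) hg

end ForProg

end RAM

namespace RAM

open BlockPath

namespace ForProg

open RAM.Expr (lab pos st succ)

variable {inp : ℕ → ℕ → ℕ} {N : ℕ} {s : Store} {l p : ℕ → ℕ} {m j : ℕ}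

/-! ### Selecting a perfect set -/

/-- Selects the stars of the path that belong to the cycle. -/
def selectPath : ForProg :=
  .forLoop 20 (.forLoop 21 (when
    (.and (.input (.reg 20) (.reg 21)) (.and (.lt (.reg 7) (succ (pos (.reg 20))))
      (.and (.lt (pos (.reg 20)) (pos (.reg 4))) (.eq (pos (.reg 21)) (succ (pos (.reg 20)))))))
    (.write 6 (.const 0) (lab (.reg 20)) (succ (.reg 20)))))

/-- Selects stars of blocks to which a selected star has an arc. -/
def expand : ForProg :=
  .forLoop 20 (.forLoop 21 (when
    (.and (.input (.reg 20) (.reg 21)) (.and (.eq (st (lab (.reg 20))) (succ (.reg 20)))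
      (.eq (st (lab (.reg 21))) (.const 0))))
    (.write 6 (.const 0) (lab (.reg 21)) (succ (.reg 21)))))

/-- Selects a perfect set. -/
def selectStars : ForProg :=
  .seq (update 6 (.const 0) (.const 1) (.const 0)) (.seq selectPath
    (.seq (.write 6 (.const 0) (lab (.reg 4)) (succ (.reg 4))) (.forLoop 24 expand)))

/-- Several vertices of a block may be written for the same label. The last one prevails, which is
harmless since each has an arc to the next position. -/
theorem den_selectPath (hN : s.reg 0 = N) (hA : Network N (InputArc inp)) (el : s.lab = l)
    (ep : s.pos = p) {i f : ℕ} (ei : s.reg 7 = i) (ef : s.reg 4 = f)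
    (hst : ∀ a, a < N → s.st a = 0) {s' : Store} (hs' : s' = selectPath.den inp s) :
    (∀ a, a < N → s'.st a ≠ 0 → ∃ v, s'.st a = v + 1 ∧ v < N ∧ l v = a ∧ i ≤ p v ∧ p v < p f ∧
      ∃ w, InputArc inp v w ∧ p w = p v + 1) ∧
    ∀ v w, InputArc inp v w → i ≤ p v → p v < p f → p w = p v + 1 → s'.st (l v) ≠ 0 := by
  have main := den_for_forall₂ (inp := inp) (x := 20) (y := 21) (s := s) (P := when
    (.and (.input (.reg 20) (.reg 21)) (.and (.lt (.reg 7) (succ (pos (.reg 20))))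
      (.and (.lt (pos (.reg 20)) (pos (.reg 4))) (.eq (pos (.reg 21)) (succ (pos (.reg 20)))))))
    (.write 6 (.const 0) (lab (.reg 20)) (succ (.reg 20)))) (by decide) (by decide) (by decide)
    (fun t => ∀ a, a < N → t.st a ≠ 0 → ∃ v, t.st a = v + 1 ∧ v < N ∧ l v = a ∧ i ≤ p v ∧
      p v < p f ∧ ∃ w, InputArc inp v w ∧ p w = p v + 1)
    (fun v w t => InputArc inp v w → i ≤ p v → p v < p f → p w = p v + 1 → t.st (l v) ≠ 0)
    (fun _ _ _ _ h => h) (fun _ _ _ _ _ _ h => h) (fun a ha h => absurd (hst a ha) h) ?_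
  · rw [hN] at main
    rw [hs']
    exact ⟨main.1, fun v w ha => main.2 v w (hA.lt ha) (hA.lt' ha) ha⟩
  intro u w t hu hw htu htw hst hJ
  have tl : t.lab = l := (congrFun (hst.mem (by decide)) 0).trans el
  have tp : t.pos = p := (congrFun (hst.mem (by decide)) 0).trans ep
  have t7 : t.reg 7 = i := (hst.reg (by decide)).trans ei
  have t4 : t.reg 4 = f := (hst.reg (by decide)).trans ef
  by_cases hc : InputArc inp u w ∧ i < p u + 1 ∧ p u < p f ∧ p w = p u + 1
  · rw [den_when_pos (by
      simp only [ne_eq, Expr.eval_and_eq_zero, not_not]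
      simpa [htu, htw, t7, t4, tp, InputArc] using hc)]
    have hden : ∀ a, ((write 6 (.const 0) (lab (.reg 20)) (succ (.reg 20))).den inp t).st a =
        if a = l u then u + 1 else t.st a := by
      intro a
      simp [den_write, htu, tl, Store.st]
    obtain ⟨h1, h2, h3, h4⟩ := hc
    refine ⟨fun a ha h => ?_, fun _ _ _ _ => ?_, fun v' w' h a b c d => ?_⟩
    · rw [hden] at h ⊢
      split_ifs at h ⊢ with e
      · exact ⟨u, rfl, hN ▸ hu, e.symm, by omega, h3, w, h1, h4⟩
      · exact hJ a ha h
    · rw [hden, if_pos rfl]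
      omega
    · rw [hden]
      split_ifs
      · omega
      · exact h a b c d
  · rw [den_when_neg (by
      simp only [ne_eq, Expr.eval_and_eq_zero, not_not]
      simpa [htu, htw, t7, t4, tp, InputArc] using hc)]
    exact ⟨hJ, fun a b c d => absurd ⟨a, by omega, c, d⟩ hc, fun _ _ h => h⟩

/-- A round makes progress or nothing is left to do, and it does not change a closed selection; so
it can be repeated a fixed number of times. -/
theorem den_expand_round (hN : s.reg 0 = N) (hA : Network N (InputArc inp)) (el : s.lab = l)
    (hlab : ∀ v, v < N → l v < N) {f : ℕ} (h : IsSelection N (InputArc inp) l s.st f)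
    {s' : Store} (hs' : s' = expand.den inp s) :
    IsSelection N (InputArc inp) l s'.st f ∧ (∀ a, s.st a ≠ 0 → s'.st a = s.st a) ∧
      (SelClosed (InputArc inp) l s.st → s'.st = s.st) ∧
      (SelClosed (InputArc inp) l s.st ∨ ∃ a, a < N ∧ s.st a = 0 ∧ s'.st a ≠ 0) := by
  have main := den_for_forall₂ (inp := inp) (x := 20) (y := 21) (s := s) (P := when
    (.and (.input (.reg 20) (.reg 21)) (.and (.eq (st (lab (.reg 20))) (succ (.reg 20)))
      (.eq (st (lab (.reg 21))) (.const 0))))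
    (.write 6 (.const 0) (lab (.reg 21)) (succ (.reg 21)))) (by decide) (by decide) (by decide)
    (fun t => IsSelection N (InputArc inp) l t.st f ∧ (∀ a, s.st a ≠ 0 → t.st a = s.st a) ∧
      (SelClosed (InputArc inp) l s.st → t.st = s.st))
    (fun v w t => InputArc inp v w → s.st (l v) = v + 1 → t.st (l w) ≠ 0)
    (fun _ _ _ _ h => h) (fun _ _ _ _ _ _ h => h) ⟨h, fun _ _ => rfl, fun _ => rfl⟩ ?_
  · rw [hN] at main
    rw [hs']
    refine ⟨main.1.1, main.1.2.1, main.1.2.2, ?_⟩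
    -- Every head of an initially selected star has a selected block after the round. If no block
    -- was added, this block had a selected star before, so the selection was closed.
    by_contra! hcon
    refine hcon.1 fun u w ha hu hw => ?_
    exact main.2 u w (hA.lt ha) (hA.lt' ha) ha hu (hcon.2 (l w) (hlab w (hA.lt' ha)) hw)
  rintro u w t hu hw htu htw hst ⟨hJ1, hJ2, hJ3⟩
  have tl : t.lab = l := (congrFun (hst.mem (by decide)) 0).trans el
  by_cases hc : InputArc inp u w ∧ t.st (l u) = u + 1 ∧ t.st (l w) = 0
  · rw [den_when_pos (by
      simp only [ne_eq, Expr.eval_and_eq_zero, not_not]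
      simpa [htu, htw, tl, InputArc] using hc)]
    obtain ⟨h1, h2, h3⟩ := hc
    have hden : ∀ a, ((write 6 (.const 0) (lab (.reg 21)) (succ (.reg 21))).den inp t).st a =
        if a = l w then w + 1 else t.st a := by
      intro a
      simp [den_write, htw, tl, Store.st]
    refine ⟨⟨hJ1.insert hA h2 h1 h3 hlab fun a _ => hden a, fun a ha => ?_, fun hcl => ?_⟩,
      fun _ _ => ?_, fun v' w' h a b => ?_⟩
    · rw [hden, if_neg, hJ2 a ha]
      rintro rfl
      exact ha ((hJ2 _ ha).symm.trans h3)
    · rw [hJ3 hcl] at h2 h3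
      exact absurd h3 (hcl u w h1 h2)
    · rw [hden, if_pos rfl]
      omega
    · rw [hden]
      split_ifs
      · omega
      · exact h a b
  · rw [den_when_neg (by
      simp only [ne_eq, Expr.eval_and_eq_zero, not_not]
      simpa [htu, htw, tl, InputArc] using hc)]
    refine ⟨⟨hJ1, hJ2, hJ3⟩, fun a b c => hc ⟨a, ?_, c⟩, fun _ _ h => h⟩
    rw [hJ2 _ (by omega), b]

theorem den_expand (hN : s.reg 0 = N) (hA : Network N (InputArc inp)) (el : s.lab = l)
    (hlab : ∀ v, v < N → l v < N) {f : ℕ} (h : IsSelection N (InputArc inp) l s.st f)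
    {s' : Store} (hs' : s' = (ForProg.forLoop 24 expand).den inp s) :
    IsSelection N (InputArc inp) l s'.st f ∧ SelClosed (InputArc inp) l s'.st ∧
      ∀ a, s.st a ≠ 0 → s'.st a ≠ 0 := by
  let μ : Store → ℕ := fun t => ((Finset.range N).filter fun a => t.st a ≠ 0).card
  have main := den_for_progress (inp := inp) (x := 24) (P := expand) (s := s) (by decide)
    (fun t => t.reg 0 = N ∧ t.lab = l ∧ IsSelection N (InputArc inp) l t.st f ∧
      ∀ a, s.st a ≠ 0 → t.st a ≠ 0) (fun t => SelClosed (InputArc inp) l t.st) μ 1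
    (fun t c h => ⟨by simpa using h.1, h.2⟩) (fun _ _ h => h) (fun _ _ => rfl)
    ⟨hN, el, h, fun _ => id⟩ ?_
  · rw [← hs', hN] at main
    obtain ⟨⟨-, -, h1, h2⟩, -, h3⟩ := main
    refine ⟨h1, h3.resolve_right fun h3 => ?_, h2⟩
    have h4 : μ s' ≤ N := (Finset.card_filter_le _ _).trans (by simp)
    -- The block of `f` is selected from the start, so N rounds of progress would give more than N
    -- selected labels.
    have h5 : 0 < μ s := Finset.card_pos.2 ⟨l f, Finset.mem_filter.2
      ⟨Finset.mem_range.2 (hlab f h.mem.1), by rw [h.mem.2]; omega⟩⟩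
    omega
  · rintro t ⟨h0, h1, h2, h3⟩
    obtain ⟨h4, h5, h6, h7⟩ := den_expand_round h0 hA h1 hlab h2 rfl
    have same := den_same (inp := inp) expand t
    refine ⟨⟨(same.reg (by decide)).trans h0, (congrFun (same.mem (by decide)) 0).trans h1, h4,
      fun a ha => by rw [h5 a (h3 a ha)]; exact h3 a ha⟩, fun hc => by rw [h6 hc]; exact hc, ?_⟩
    rcases h7 with h7 | ⟨a, ha, ha0, ha1⟩
    · exact Or.inl (by rw [h6 h7]; exact h7)
    · right
      refine Finset.card_lt_card ((Finset.ssubset_iff_of_subset fun b hb => ?_).2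
        ⟨a, Finset.mem_filter.2 ⟨Finset.mem_range.2 ha, ha1⟩, fun h => ?_⟩)
      · obtain ⟨hb1, hb2⟩ := Finset.mem_filter.1 hb
        exact Finset.mem_filter.2 ⟨hb1, by rw [h5 b hb2]; exact hb2⟩
      · exact (Finset.mem_filter.1 h).2 ha0

theorem den_selectStars (hN : s.reg 0 = N) (hA : Network N (InputArc inp)) (el : s.lab = l)
    (ep : s.pos = p) (hlab : ∀ v, v < N → l v < N) (h : IsPath N (InputArc inp) l p m)
    {C₁ C₂ : ℕ → Prop} (hc : IsCore N (InputArc inp) l p (s.reg 4) (s.reg 7) C₁ C₂)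
    {s' : Store} (hs' : s' = selectStars.den inp s) :
    IsSelection N (InputArc inp) l s'.st (s.reg 4) ∧ SelClosed (InputArc inp) l s'.st ∧
      ∀ v, v < N → s.reg 7 ≤ p v → p v ≤ p (s.reg 4) → s'.st (l v) ≠ 0 := by
  obtain ⟨f, ef⟩ : ∃ f, s.reg 4 = f := ⟨_, rfl⟩
  obtain ⟨i, ei⟩ : ∃ i, s.reg 7 = i := ⟨_, rfl⟩
  rw [ef, ei] at hc ⊢
  rw [selectStars, den_seq, den_seq, den_seq] at hs'
  set s₁ := (update 6 (.const 0) (.const 1) (.const 0)).den inp s with hs₁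
  have same₁ : s.Same [20] [6] s₁ := den_same (update 6 (.const 0) (.const 1) (.const 0)) s
  have z₁ : ∀ a, a < N → s₁.st a = 0 :=
    den_update hN (fun _ => 0) fun i t _ _ _ => by simp
  have el₁ : s₁.lab = l := (congrFun (same₁.mem (by decide)) 0).trans el
  have ep₁ : s₁.pos = p := (congrFun (same₁.mem (by decide)) 0).trans ep
  have r0 : s₁.reg 0 = N := (same₁.reg (by decide)).trans hN
  have r4 : s₁.reg 4 = f := (same₁.reg (by decide)).trans ef
  have r7 : s₁.reg 7 = i := (same₁.reg (by decide)).trans ei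
  clear_value s₁
  set s₂ := selectPath.den inp s₁ with hs₂
  have same₂ : s₁.Same [20, 21] [6] s₂ := den_same selectPath s₁
  obtain ⟨h1, h2⟩ := den_selectPath r0 hA el₁ ep₁ r7 r4 z₁ hs₂
  have el₂ : s₂.lab = l := (congrFun (same₂.mem (by decide)) 0).trans el₁
  have e0 : s₂.reg 0 = N := (same₂.reg (by decide)).trans r0
  have e4 : s₂.reg 4 = f := (same₂.reg (by decide)).trans r4
  clear_value s₂
  set s₃ := (write 6 (.const 0) (lab (.reg 4)) (succ (.reg 4))).den inp s₂ with hs₃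
  have hden : ∀ a, s₃.st a = if a = l f then f + 1 else s₂.st a := by
    intro a
    simp [hs₃, den_write, e4, el₂, Store.st]
  have hcyc : ∀ v, v < N → i ≤ p v → p v ≤ p f → s₃.st (l v) ≠ 0 := by
    intro v hv hiv hvf
    rw [hden]
    split_ifs with e
    · omega
    · have hfN : f < N := by
        obtain ⟨x, hx, -⟩ := hc.star
        exact hA.lt hx
      have hi := hc.one_le
      have hvf : p v < p f :=
        lt_of_le_of_ne hvf fun e' => e (h.inj v f hv hfN e' (by omega))
      have hfm := h.le f hfN
      obtain ⟨u, w, ha, hu, hw⟩ := h.arc (p v) (by omega) (by omega)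
      have := h2 u w ha (by omega) (by omega) (by omega)
      rwa [h.inj u v (hA.lt ha) hv hu (by omega)] at this
  have hsel : IsSelection N (InputArc inp) l s₃.st f := by
    refine hc.isSelection hA h hlab (by rw [hden, if_pos rfl]) (fun a ha h0 hne => ?_)
      fun v hv h3 h4 => hcyc v hv h3 h4.le
    rw [hden, if_neg hne] at h0 ⊢
    exact h1 a ha h0
  obtain ⟨h3, h4, h5⟩ := den_expand (s := s₃) e0 hA el₂ hlab hsel hs'
  exact ⟨h3, h4, fun v hv h6 h7 => h5 _ (hcyc v hv h6 h7)⟩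

/-! ### One iteration -/

/-- Writes the output of an iteration and contracts the selected perfect set. -/
def output : ForProg :=
  .seq (writeRow 1 (.eq (st (lab (.reg 20))) (succ (.reg 20))))
    (.seq (writeRow 2 (.eq (pos (.reg 20)) (.reg 2)))
      (.seq (update 0 (.const 0) (.eq (st (lab (.reg 20))) (succ (.reg 20))) (.const 1))
        (.seq (.assign 13 (lab (.reg 4)))
          (.seq (update 4 (.const 0) (.ne (st (lab (.reg 20))) (.const 0)) (.reg 13))
            (.assign 1 (succ (.reg 1)))))))

/-- One iteration of the scheme. -/
def stage : ForProg := .seq findPath (.seq chooseCore (.seq selectStars output))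

/-- The effect of an iteration that starts with the store `s` and ends with the store `s'`. -/
structure StageSpec (N : ℕ) (A : ℕ → ℕ → Prop) (s s' : Store) (st : ℕ → ℕ) (f : ℕ)
    (C₁ C₂ : ℕ → Prop) : Prop where
  sel : IsSelection N A s.lab st f
  closed : SelClosed A s.lab st
  sat₁ : ∀ u w, u < N → w < N → s.lab u = s.lab w → C₁ u → C₁ w
  sat₂ : ∀ u w, u < N → w < N → s.lab u = s.lab w → C₂ u → C₂ w
  nonempty₁ : ∃ u, u < N ∧ C₁ u
  nonempty₂ : ∃ u, u < N ∧ C₂ u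
  disj : ∀ u, u < N → ¬ (C₁ u ∧ C₂ u)
  internal₁ : InternalCut A (fun v => st (s.lab v) ≠ 0) C₁
  internal₂ : InternalCut A (fun v => st (s.lab v) ≠ 0) C₂
  reg_zero : s'.reg 0 = s.reg 0
  reg_one : s'.reg 1 = s.reg 1 + 1
  lab : ∀ v, v < N → s'.lab v = if st (s.lab v) ≠ 0 then s.lab f else s.lab v
  power : ∀ v, v < N → s'.mem 0 0 v = if st (s.lab v) = v + 1 then 1 else s.mem 0 0 v
  stars : ∀ v, v < N → Indicates (s'.mem 1 (s.reg 1) v) (st (s.lab v) = v + 1)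
  cut₁ : ∀ v, v < N → Indicates (s'.mem 2 (s.reg 1) v) (C₁ v)
  cut₂ : ∀ v, v < N → Indicates (s'.mem 3 (s.reg 1) v) (C₂ v)
  rows : ∀ a ∈ [1, 2, 3], ∀ ρ v, ρ ≠ s.reg 1 → s'.mem a ρ v = s.mem a ρ v

theorem den_output (hN : s.reg 0 = N) (el : s.lab = l) (ep : s.pos = p) (em : s.reg 2 = m)
    {s' : Store} (hs' : s' = output.den inp s) :
    s'.reg 0 = N ∧ s'.reg 1 = s.reg 1 + 1 ∧
      (∀ v, v < N → s'.lab v = if s.st (l v) ≠ 0 then l (s.reg 4) else l v) ∧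
      (∀ v, v < N → s'.mem 0 0 v = if s.st (l v) = v + 1 then 1 else s.mem 0 0 v) ∧
      (∀ v, v < N → Indicates (s'.mem 1 (s.reg 1) v) (s.st (l v) = v + 1)) ∧
      (∀ v, v < N → Indicates (s'.mem 2 (s.reg 1) v) (p v = m)) ∧
      s'.mem 3 = s.mem 3 ∧
      ∀ a ∈ [1, 2], ∀ ρ v, ρ ≠ s.reg 1 → s'.mem a ρ v = s.mem a ρ v := by
  rw [output, den_seq, den_seq, den_seq, den_seq, den_seq] at hs'
  set s₁ := (writeRow 1 (.eq (st (lab (.reg 20))) (succ (.reg 20)))).den inp s with hs₁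
  have same₁ : s.Same [20] [1] s₁ :=
    den_same (writeRow 1 (.eq (st (lab (.reg 20))) (succ (.reg 20)))) s
  obtain ⟨h1, h1'⟩ := den_writeRow (inp := inp) (a := 1)
    (e := .eq (st (lab (.reg 20))) (succ (.reg 20))) hN (fun v => s.st (l v) = v + 1)
    fun i t ht hst => by
      have tl : t.lab = l := (congrFun (hst.mem (by decide)) 0).trans el
      have ts : t.st = s.st := congrFun (hst.mem (by decide)) 0
      have := indicates_ite (t.st (t.lab i) = i + 1)
      rw [← tl, ← ts]
      simpa [Expr.eval, lab, st, succ, ht] using this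
  rw [← hs₁] at h1 h1'
  set s₂ := (writeRow 2 (.eq (pos (.reg 20)) (.reg 2))).den inp s₁ with hs₂
  have same₂ : s₁.Same [20] [2] s₂ := den_same (writeRow 2 (.eq (pos (.reg 20)) (.reg 2))) s₁
  obtain ⟨h2, h2'⟩ := den_writeRow (inp := inp) (s := s₁) (N := N) (a := 2)
    (e := .eq (pos (.reg 20)) (.reg 2)) ((same₁.reg (by decide)).trans hN) (fun v => p v = m)
    fun i t ht hst => by
      have tp : t.pos = p :=
        ((congrFun (hst.mem (by decide)) 0).trans (congrFun (same₁.mem (by decide)) 0)).trans ep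
      have tm : t.reg 2 = m :=
        ((hst.reg (by decide)).trans (same₁.reg (by decide))).trans em
      have := indicates_ite (t.pos i = m)
      rw [← tp]
      simpa [Expr.eval, pos, ht, tm] using this
  rw [← hs₂] at h2 h2'
  have same₁₂ : s.Same [20] [1, 2] s₂ :=
    (same₁.mono (List.Subset.refl _) (by simp)).trans (same₂.mono (List.Subset.refl _) (by simp))
      (List.Subset.refl _) (List.Subset.refl _)
  set s₃ := (update 0 (.const 0) (.eq (st (lab (.reg 20))) (succ (.reg 20))) (.const 1)).den inp s₂
    with hs₃
  have same₃ : s₂.Same [20] [0] s₃ := den_same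
    (update 0 (.const 0) (.eq (st (lab (.reg 20))) (succ (.reg 20))) (.const 1)) s₂
  have h3 : ∀ v, v < N → s₃.mem 0 0 v = if s.st (l v) = v + 1 then 1 else s.mem 0 0 v := by
    rw [hs₃]
    refine den_update ((same₁₂.reg (by decide)).trans hN) _ fun i t ht hst _ => ?_
    have tl : t.lab = l :=
      ((congrFun (hst.mem (by decide)) 0).trans (congrFun (same₁₂.mem (by decide)) 0)).trans el
    have ts : t.st = s.st :=
      (congrFun (hst.mem (by decide)) 0).trans (congrFun (same₁₂.mem (by decide)) 0)
    rw [show s₂.mem 0 = s.mem 0 from same₁₂.mem (by decide)]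
    simp [ht, tl, ts]
  have same₁₃ : s.Same [20] [0, 1, 2] s₃ :=
    (same₁₂.mono (List.Subset.refl _) (by simp)).trans (same₃.mono (List.Subset.refl _) (by simp))
      (List.Subset.refl _) (List.Subset.refl _)
  set s₄ := (assign 13 (lab (.reg 4))).den inp s₃ with hs₄
  have same₄ : s₃.Same [13] [] s₄ := den_same (assign 13 (lab (.reg 4))) s₃
  have same₁₄ : s.Same [13, 20] [0, 1, 2] s₄ :=
    (same₁₃.mono (by simp) (List.Subset.refl _)).trans (same₄.mono (by simp) (by simp))
      (List.Subset.refl _) (List.Subset.refl _)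
  have r13 : s₄.reg 13 = l (s.reg 4) := by
    have e1 : s₃.lab = l := (congrFun (same₁₃.mem (by decide)) 0).trans el
    have e2 : s₃.reg 4 = s.reg 4 := same₁₃.reg (by decide)
    simp [hs₄, den_assign, e1, e2]
  -- Relabelling comes after the power and star outputs, which still read the old labels.
  set s₅ := (update 4 (.const 0) (.ne (st (lab (.reg 20))) (.const 0)) (.reg 13)).den inp s₄
    with hs₅
  have same₅ : s₄.Same [20] [4] s₅ :=
    den_same (update 4 (.const 0) (.ne (st (lab (.reg 20))) (.const 0)) (.reg 13)) s₄
  have h5 : ∀ v, v < N → s₅.mem 4 0 v = if s.st (l v) ≠ 0 then l (s.reg 4) else l v := by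
    rw [hs₅]
    refine den_update ((same₁₄.reg (by decide)).trans hN) _ fun i t ht hst hi => ?_
    have sl : s₄.lab = l := (congrFun (same₁₄.mem (by decide)) 0).trans el
    have tl : t.lab i = l i := hi.trans (congrFun sl i)
    have ts : t.st = s.st :=
      (congrFun (hst.mem (by decide)) 0).trans (congrFun (same₁₄.mem (by decide)) 0)
    have t13 : t.reg 13 = l (s.reg 4) := (hst.reg (by decide)).trans r13
    rw [show s₄.mem 4 0 i = l i from congrFun sl i]
    simp [ht, tl, ts, t13]
  have same₆ : s₅.Same [1] [] s' := hs' ▸ den_same (assign 1 (succ (.reg 1))) s₅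
  have same₄₆ : s₃.Same [1, 13, 20] [4] s' :=
    ((same₄.mono (by simp) (by simp)).trans (same₅.mono (by simp) (List.Subset.refl _))
      (List.Subset.refl _) (List.Subset.refl _)).trans (same₆.mono (by simp) (by simp))
      (List.Subset.refl _) (List.Subset.refl _)
  refine ⟨?_, ?_, ?_, ?_, ?_, ?_, ?_, ?_⟩
  · rw [same₄₆.reg (by decide), same₁₃.reg (by decide), hN]
  · rw [hs', den_assign, Store.setReg_reg, if_pos rfl, Expr.eval_succ, Expr.eval_reg,
      same₅.reg (by decide), same₁₄.reg (by decide)]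
  · intro v hv
    rw [Store.lab, same₆.mem (by decide)]
    exact h5 v hv
  · intro v hv
    rw [same₄₆.mem (by decide)]
    exact h3 v hv
  · intro v hv
    rw [same₄₆.mem (by decide), same₃.mem (by decide), same₂.mem (by decide)]
    exact h1 v hv
  · intro v hv
    rw [same₄₆.mem (by decide), same₃.mem (by decide)]
    rw [show s₁.reg 1 = s.reg 1 from same₁.reg (by decide)] at h2
    exact h2 v hv
  · rw [same₄₆.mem (by decide), same₁₃.mem (by decide)]
  · intro a ha ρ v hρ
    simp only [List.mem_cons, List.not_mem_nil, or_false] at ha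
    rcases ha with rfl | rfl
    · rw [same₄₆.mem (by decide), same₃.mem (by decide), same₂.mem (by decide)]
      exact h1' ρ v hρ
    · rw [same₄₆.mem (by decide), same₃.mem (by decide)]
      rw [show s₁.reg 1 = s.reg 1 from same₁.reg (by decide)] at h2'
      rw [h2' ρ v hρ, same₁.mem (by decide)]

theorem den_stage (hN : s.reg 0 = N) (hA : Network N (InputArc inp))
    (hlab : ∀ v, v < N → s.lab v < N) (hne : ∃ u w, u < N ∧ w < N ∧ s.lab u ≠ s.lab w)
    {s' : Store} (hs' : s' = stage.den inp s) :
    ∃ st f C₁ C₂, StageSpec N (InputArc inp) s s' st f C₁ C₂ := by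
  obtain ⟨l, el⟩ : ∃ l, s.lab = l := ⟨_, rfl⟩
  rw [el] at hlab hne
  rw [stage, den_seq, den_seq, den_seq] at hs'
  set s₁ := findPath.den inp s with hs₁
  -- The unreduced value of `arrs`: one entry per write instruction, all to the array of positions.
  have same₁ : s.Same findPath.regs [5, 5, 5, 5, 5] s₁ := den_same findPath s
  obtain ⟨h1, h2⟩ := den_findPath hN hA el hne hs₁
  have r0 : s₁.reg 0 = N := (same₁.reg (by decide)).trans hN
  have r1 : s₁.reg 1 = s.reg 1 := same₁.reg (by decide)
  have el₁ : s₁.lab = l := (congrFun (same₁.mem (by decide)) 0).trans el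
  obtain ⟨p, ep⟩ : ∃ p, s₁.pos = p := ⟨_, rfl⟩
  obtain ⟨m, em⟩ : ∃ m, s₁.reg 2 = m := ⟨_, rfl⟩
  rw [ep, em] at h1 h2
  clear_value s₁
  set s₂ := chooseCore.den inp s₁ with hs₂
  have same₂ : s₁.Same chooseCore.regs [3, 3, 3] s₂ := den_same chooseCore s₁
  obtain ⟨C, hC, h3, h4⟩ := den_chooseCore r0 hA el₁ ep em h1 h2 hs₂
  have e0 : s₂.reg 0 = N := (same₂.reg (by decide)).trans r0
  have e1 : s₂.reg 1 = s.reg 1 := (same₂.reg (by decide)).trans r1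
  have e2 : s₂.reg 2 = m := (same₂.reg (by decide)).trans em
  have el₂ : s₂.lab = l := (congrFun (same₂.mem (by decide)) 0).trans el₁
  have ep₂ : s₂.pos = p := (congrFun (same₂.mem (by decide)) 0).trans ep
  obtain ⟨f, ef⟩ : ∃ f, s₂.reg 4 = f := ⟨_, rfl⟩
  clear_value s₂
  set s₃ := selectStars.den inp s₂ with hs₃
  have same₃ : s₂.Same selectStars.regs [6, 6, 6, 6] s₃ := den_same selectStars s₂
  obtain ⟨h5, h6, h7⟩ := den_selectStars e0 hA el₂ ep₂ hlab h1 hC hs₃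
  have f0 : s₃.reg 0 = N := (same₃.reg (by decide)).trans e0
  have f1 : s₃.reg 1 = s.reg 1 := (same₃.reg (by decide)).trans e1
  have f2 : s₃.reg 2 = m := (same₃.reg (by decide)).trans e2
  have f4 : s₃.reg 4 = f := (same₃.reg (by decide)).trans ef
  have el₃ : s₃.lab = l := (congrFun (same₃.mem (by decide)) 0).trans el₂
  have ep₃ : s₃.pos = p := (congrFun (same₃.mem (by decide)) 0).trans ep₂
  have m0 : s₃.mem 0 = s.mem 0 :=
    ((same₃.mem (by decide)).trans (same₂.mem (by decide))).trans (same₁.mem (by decide))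
  have m1 : s₃.mem 1 = s.mem 1 :=
    ((same₃.mem (by decide)).trans (same₂.mem (by decide))).trans (same₁.mem (by decide))
  have m2 : s₃.mem 2 = s.mem 2 :=
    ((same₃.mem (by decide)).trans (same₂.mem (by decide))).trans (same₁.mem (by decide))
  have m3 : s₃.mem 3 = s₂.mem 3 := same₃.mem (by decide)
  have m3' : s₁.mem 3 = s.mem 3 := same₁.mem (by decide)
  clear_value s₃
  obtain ⟨g0, g1, g2, g3, g4, g5, g6, g7⟩ := den_output f0 el₃ ep₃ f2 hs'
  rw [f1] at g1 g4 g5 g7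
  rw [f4] at g2
  rw [m0] at g3
  rw [r1] at h3 h4
  rw [ef] at hC h5 h7
  -- Internality is used for the final perfect set: `W` consists of all blocks with a selected star,
  -- which contain the core and, by closedness, the heads of `f`.
  have hint := hC.internal (fun v => s₃.st (l v) ≠ 0)
    (fun u w _ _ e h => by rwa [← e]) h7 fun x hx => h6 f x hx h5.mem.2
  rw [← el] at *
  refine ⟨s₃.st, f, _, C, h5, h6, hC.sat₁, hC.sat₂, hC.nonempty₁, hC.nonempty₂, hC.disj,
    hint.1, hint.2, g0.trans hN.symm, g1, g2, g3, g4, g5, fun v hv => ?_, fun a ha ρ v hρ => ?_⟩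
  · rw [g6, m3]
    exact h3 v hv
  · simp only [List.mem_cons, List.not_mem_nil, or_false] at ha
    rcases ha with rfl | rfl | rfl
    · rw [g7 1 (by decide) ρ v hρ, m1]
    · rw [g7 2 (by decide) ρ v hρ, m2]
    · rw [g6, m3, h4 ρ v hρ, m3']

end ForProg

end RAM

namespace RAM

open BlockPath

namespace ForProg

open RAM.Expr (lab pos st succ)

variable {inp : ℕ → ℕ → ℕ} {N : ℕ} {s : Store}

/-! ### The initial blocks -/

/-- Replaces the label in register `13` by the label in register `14`. -/
def mergeLabels : ForProg :=
  .forLoop 22 (.cond (.eq (lab (.reg 22)) (.reg 13)) (.write 4 (.const 0) (.reg 22) (.reg 14)) .skip)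

/-- Labels the components of the arcs of cost `0`. -/
def labels : ForProg :=
  .seq (update 4 (.const 0) (.const 1) (.reg 20)) (.forLoop 20 (.forLoop 21
    (when (.eq (.input (.reg 20) (.reg 21)) (.const 1))
      (.seq (.assign 13 (lab (.reg 20))) (.seq (.assign 14 (lab (.reg 21))) mergeLabels)))))

theorem den_mergeLabels (hN : s.reg 0 = N) {s' : Store} (hs' : s' = mergeLabels.den inp s) :
    ∀ v, v < N → s'.lab v = if s.lab v = s.reg 13 then s.reg 14 else s.lab v := by
  subst hs' hN
  refine (den_for_map _ fun i t _ ht hst hi => ⟨rfl, ?_⟩).1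
  have e1 : t.reg 13 = s.reg 13 := hst.reg (by decide)
  have e2 : t.reg 14 = s.reg 14 := hst.reg (by decide)
  have e3 : t.lab i = s.lab i := hi
  simp only [Expr.eval_eq_eq_zero, Expr.eval_lab, Expr.eval_reg, ht, e1, e2, e3]
  simp only [ne_eq, ite_not]

/-- Labels are only ever merged along arcs of cost 0, so equal labels imply connection; once the two
ends of such an arc agree, later merges cannot separate them. -/
theorem den_labels (hN : s.reg 0 = N) (hlt : ∀ u w, inp u w = 1 → u < N ∧ w < N)
    (hsymm : ∀ u w, inp u w = 1 → inp w u = 1) {s' : Store} (hs' : s' = labels.den inp s) :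
    (∀ v, v < N → s'.lab v < N) ∧ ∀ u v, u < N → v < N →
      (s'.lab u = s'.lab v ↔ Relation.ReflTransGen (fun u w => inp u w = 1) u v) := by
  rw [labels, den_seq] at hs'
  set s₁ := (update 4 (.const 0) (.const 1) (.reg 20)).den inp s with hs₁
  have same₁ : s.Same [20] [4] s₁ := den_same (update 4 (.const 0) (.const 1) (.reg 20)) s
  have h₁ : ∀ v, v < N → s₁.mem 4 0 v = v :=
    den_update hN _ fun i t ht _ _ => by simp [ht]
  have r0 : s₁.reg 0 = N := (same₁.reg (by decide)).trans hN
  have rsymm : ∀ u v, Relation.ReflTransGen (fun u w => inp u w = 1) u v →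
      Relation.ReflTransGen (fun u w => inp u w = 1) v u := by
    intro u v h
    induction h with
    | refl => exact .refl
    | tail _ h ih => exact ih.head (hsymm _ _ h)
  have main := den_for_forall₂ (inp := inp) (x := 20) (y := 21) (s := s₁) (P :=
    when (.eq (.input (.reg 20) (.reg 21)) (.const 1))
      (.seq (.assign 13 (lab (.reg 20))) (.seq (.assign 14 (lab (.reg 21))) mergeLabels)))
    (by decide) (by decide) (by decide)
    (fun t => (∀ v, v < N → t.lab v < N) ∧ ∀ u v, u < N → v < N → t.lab u = t.lab v →
      Relation.ReflTransGen (fun u w => inp u w = 1) u v)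
    (fun u w t => inp u w = 1 → t.lab u = t.lab w)
    (fun _ _ _ _ h => h) (fun _ _ _ _ _ _ h => h)
    ⟨fun v hv => by rw [Store.lab, h₁ v hv]; exact hv, fun u v hu hv e => by
      rw [Store.lab, h₁ u hu, h₁ v hv] at e
      rw [e]⟩ ?_
  · rw [← hs', r0] at main
    obtain ⟨⟨h2, h3⟩, h4⟩ := main
    refine ⟨h2, fun u v hu hv => ⟨h3 u v hu hv, fun h => ?_⟩⟩
    clear hv
    induction h with
    | refl => rfl
    | tail _ h ih => exact ih.trans (h4 _ _ (hlt _ _ h).1 (hlt _ _ h).2 h)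
  · rintro u w t hu hw htu htw hst ⟨hJ1, hJ2⟩
    rw [r0] at hu hw
    by_cases hc : inp u w = 1
    · rw [den_when_pos (by simpa [htu, htw] using hc), den_seq, den_seq]
      set t' := (assign 14 (lab (.reg 21))).den inp ((assign 13 (lab (.reg 20))).den inp t)
        with ht'
      have e0 : t'.reg 0 = N := by
        simpa [ht', den_assign] using (hst.reg (by decide)).trans r0
      have hm := den_mergeLabels (inp := inp) e0 rfl
      have e13 : t'.reg 13 = t.lab u := by simp [ht', den_assign, htu]
      have e14 : t'.reg 14 = t.lab w := by
        simp [ht', den_assign, htw, lab, Expr.eval]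
      have el : t'.lab = t.lab := rfl
      rw [e13, e14, el] at hm
      refine ⟨⟨fun v hv => ?_, fun a b ha hb e => ?_⟩, fun _ => ?_, fun u' w' h h' => ?_⟩
      · rw [hm v hv]
        split_ifs
        · exact hJ1 w hw
        · exact hJ1 v hv
      · have huw : Relation.ReflTransGen (fun u w => inp u w = 1) u w := .single hc
        rw [hm a ha, hm b hb] at e
        -- The cases are whether `a` and `b` had the label of `u`, which is now replaced by that of
        -- `w`; the mixed cases pass through the arc from `u` to `w`.
        split_ifs at e with h1 h2 h2
        · exact hJ2 a b ha hb (h1.trans h2.symm)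
        · exact ((hJ2 a u ha hu h1).trans huw).trans (hJ2 w b hw hb e)
        · exact ((hJ2 a w ha hw e).trans (rsymm _ _ huw)).trans (hJ2 u b hu hb h2.symm)
        · exact hJ2 a b ha hb e
      · rw [hm u hu, hm w hw, if_pos rfl, ite_self]
      · rw [hm u' (hlt _ _ h').1, hm w' (hlt _ _ h').2, h h']
    · rw [den_when_neg (by simpa [htu, htw] using hc)]
      exact ⟨⟨hJ1, hJ2⟩, fun h => absurd h hc, fun _ _ h => h⟩

/-! ### The whole algorithm -/

/-- Tests whether there is more than one block. -/
def testBlocks : ForProg :=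
  .seq (.assign 12 (.const 0))
    (.forLoop 20 (when (.ne (lab (.reg 20)) (lab (.const 0))) (.assign 12 (.const 1))))

/-- The approximation algorithm. -/
def algorithm : ForProg :=
  .seq labels (.forLoop 25 (.seq testBlocks (when (.eq (.reg 12) (.const 1)) stage)))

theorem den_testBlocks (hN : s.reg 0 = N) {s' : Store} (hs' : s' = testBlocks.den inp s) :
    s'.reg 12 = 1 ∧ (∃ v, v < N ∧ s.lab v ≠ s.lab 0) ∨
      s'.reg 12 = 0 ∧ ∀ v, v < N → s.lab v = s.lab 0 := by
  rw [testBlocks, den_seq] at hs'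
  have main := den_for_forall (inp := inp) (x := 20) (s := (assign 12 (.const 0)).den inp s)
    (P := when (.ne (lab (.reg 20)) (lab (.const 0))) (.assign 12 (.const 1))) (by decide)
    (fun t => t.reg 12 = 1 ∧ (∃ v, v < N ∧ s.lab v ≠ s.lab 0) ∨ t.reg 12 = 0)
    (fun v t => t.reg 12 = 0 → s.lab v = s.lab 0)
    (fun t c h => by simpa using h) (fun i t c h => by simpa using h)
    (Or.inr (by simp [den_assign])) ?_
  · rw [← hs'] at main
    rcases main.1 with h | h
    · exact Or.inl h
    · exact Or.inr ⟨h, fun v hv => main.2 v (by simpa [den_assign, hN] using hv) h⟩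
  · intro v t hv htv hst hJ
    have hvN : v < N := by simpa [den_assign, hN] using hv
    have tl : t.lab = s.lab := congrFun (hst.mem (by decide)) 0
    by_cases hc : s.lab v = s.lab 0
    · rw [den_when_neg (by simpa [htv, tl] using hc)]
      exact ⟨hJ, fun _ => hc, fun _ h => h⟩
    · rw [den_when_pos (by simpa [htv, tl] using hc)]
      have e : ((assign 12 (.const 1)).den inp t).reg 12 = 1 := by simp [den_assign]
      simp only [e]
      exact ⟨Or.inl ⟨trivial, v, hvN, hc⟩, by omega, by omega⟩

end ForProg

/-! ### Correctness -/

open DPAInstance ForProg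

variable {N : ℕ} {I : DPAInstance N}

theorem inputArc_code {u w : ℕ} :
    InputArc I.code u w ↔ ∃ (hu : u < N) (hw : w < N), I.Arc ⟨u, hu⟩ ⟨w, hw⟩ := by
  unfold InputArc DPAInstance.code
  split_ifs with h h'
  · exact iff_of_true (Nat.succ_ne_zero _) ⟨h.1, h.2, h'⟩
  · exact iff_of_false (by simp) fun ⟨_, _, h''⟩ => h' h''
  · exact iff_of_false (by simp) fun ⟨hu, hw, _⟩ => h ⟨hu, hw⟩

theorem inputArc_code_fin {u w : Fin N} : InputArc I.code u w ↔ I.Arc u w :=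
  inputArc_code.trans ⟨fun ⟨_, _, h⟩ => h, fun h => ⟨u.2, w.2, h⟩⟩

theorem code_eq_one {u w : ℕ} :
    I.code u w = 1 ↔ ∃ (hu : u < N) (hw : w < N), I.PowerArc 0 ⟨u, hu⟩ ⟨w, hw⟩ := by
  unfold DPAInstance.code
  split_ifs with h h'
  · have : I.cost ⟨u, h.1⟩ ⟨w, h.2⟩ + 1 = 1 ↔ I.cost ⟨u, h.1⟩ ⟨w, h.2⟩ = 0 := by omega
    rw [this]
    constructor
    · exact fun h0 => ⟨h.1, h.2, h', by simp [h0]⟩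
    · rintro ⟨_, _, -, h0⟩
      simpa using h0
  · exact iff_of_false (by simp) fun ⟨_, _, h''⟩ => h' h''.1
  · exact iff_of_false (by simp) fun ⟨hu, hw, _⟩ => h ⟨hu, hw⟩

theorem network_code (I : DPAInstance N) : Network N (InputArc I.code) where
  symm h := by
    obtain ⟨hu, hw, h⟩ := inputArc_code.1 h
    exact inputArc_code.2 ⟨hw, hu, I.arc_symm _ _ h⟩
  lt h := (inputArc_code.1 h).1
  conn {u w} hu hw := Relation.ReflTransGen.lift (fun v : Fin N => (v : ℕ))
    (fun _ _ h => inputArc_code_fin.2 h.2.2) _ _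
    (I.stronglyConnected ⟨u, hu⟩ (Finset.mem_univ _) ⟨w, hw⟩ (Finset.mem_univ _))

/-- The labels of the vertices. -/
def Store.finLab (N : ℕ) (s : Store) : Fin N → ℕ := fun v => s.lab v

theorem isComponents_of_labels {s : Store}
    (h : ∀ u v, u < N → v < N → (s.lab u = s.lab v ↔
      Relation.ReflTransGen (fun u w => I.code u w = 1) u v)) :
    I.IsComponents (s.finLab N) := by
  intro u v
  refine (h u v u.2 v.2).trans ⟨fun h => ?_, fun h => ?_⟩
  -- The walk is in the natural numbers, but its vertices are below N because the entry 1 occurs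
  -- only inside the matrix.
  · have key : ∀ b : ℕ, Relation.ReflTransGen (fun u w => I.code u w = 1) u b →
        ∀ hb : b < N, Relation.ReflTransGen (I.PowerArc 0) u ⟨b, hb⟩ := by
      intro b h
      induction h with
      | refl => exact fun _ => .refl
      | tail _ h ih =>
        intro hb
        obtain ⟨h1, h2, h3⟩ := code_eq_one.1 h
        exact (ih h1).tail h3
    exact key v h v.2
  · exact Relation.ReflTransGen.lift (fun v : Fin N => (v : ℕ))
      (fun a b h => code_eq_one.2 ⟨a.2, b.2, h⟩) _ _ h

/-! ### One machine iteration as a stage of the scheme -/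

section Stage

open Classical

variable {s s' : Store} {st : ℕ → ℕ} {f : ℕ} {C₁ C₂ : ℕ → Prop}

/-- The selected stars. -/
noncomputable def selected (N : ℕ) (s : Store) (st : ℕ → ℕ) : Finset (Fin N) :=
  Finset.univ.filter fun v => st (s.lab v) = v + 1

/-- The vertices with a given property. -/
noncomputable def vertexSet (N : ℕ) (C : ℕ → Prop) : Finset (Fin N) :=
  Finset.univ.filter fun v => C v

theorem mem_selected {v : Fin N} : v ∈ selected N s st ↔ st (s.lab v) = v + 1 := by
  simp [selected]

theorem mem_vertexSet {C : ℕ → Prop} {v : Fin N} : v ∈ vertexSet N C ↔ C v := by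
  simp [vertexSet]

theorem ForProg.StageSpec.exists_selected_iff (hlab : ∀ v, v < N → s.lab v < N)
    (h : StageSpec N (InputArc I.code) s s' st f C₁ C₂) {v : Fin N} :
    (∃ q ∈ selected N s st, s.finLab N q = s.finLab N v) ↔ st (s.lab v) ≠ 0 := by
  constructor
  · rintro ⟨q, hq, e⟩
    rw [show s.lab v = s.lab q from e.symm, mem_selected.1 hq]
    omega
  · intro h0
    obtain ⟨q, hq, hqN, e, -⟩ := h.sel.sel _ (hlab v v.2) h0
    exact ⟨⟨q, hqN⟩, mem_selected.2 (by rw [← hq, ← e]), e⟩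

theorem ForProg.StageSpec.internal (hlab : ∀ v, v < N → s.lab v < N)
    (h : StageSpec N (InputArc I.code) s s' st f C₁ C₂) {C : ℕ → Prop}
    (hC : InternalCut (InputArc I.code) (fun v => st (s.lab v) ≠ 0) C) (v : Fin N)
    (hv : I.Leaves (vertexSet N C) v) :
    (∃ q ∈ selected N s st, s.finLab N q = s.finLab N v) ∧
      ∀ w, I.Arc v w → ∃ q ∈ selected N s st, s.finLab N q = s.finLab N w := by
  obtain ⟨hv, w, hw, hwC⟩ := hv
  obtain ⟨h1, h2⟩ := hC v w (inputArc_code_fin.2 hw) (mem_vertexSet.1 hv)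
    fun h' => hwC (mem_vertexSet.2 h')
  exact ⟨(h.exists_selected_iff hlab).2 h1,
    fun x hx => (h.exists_selected_iff hlab).2 (h2 x (inputArc_code_fin.2 hx))⟩

theorem ForProg.StageSpec.isStage (hlab : ∀ v, v < N → s.lab v < N)
    (h : StageSpec N (InputArc I.code) s s' st f C₁ C₂) :
    I.IsStage (s.finLab N) (selected N s st) (vertexSet N C₁) (vertexSet N C₂) where
  nonempty := ⟨⟨f, h.sel.mem.1⟩, mem_selected.2 h.sel.mem.2⟩
  star q hq := by
    have hq := mem_selected.1 hq
    obtain ⟨v, hv, -, -, x, hx, hne⟩ := h.sel.sel _ (hlab q q.2) (by omega)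
    obtain rfl : v = q := by omega
    exact ⟨⟨x, (network_code I).lt' hx⟩, inputArc_code_fin.1 hx, hne⟩
  inj q hq q' hq' e := by
    have hq := mem_selected.1 hq
    have hq' := mem_selected.1 hq'
    rw [show s.lab q = s.lab q' from e] at hq
    exact Fin.ext (by omega)
  closed q hq w hw := (h.exists_selected_iff hlab).2
    (h.closed q w (inputArc_code_fin.2 hw) (mem_selected.1 hq))
  conn q hq q' hq' := by
    have key : ∀ b : ℕ, Relation.ReflTransGen (SelArc N (InputArc I.code) s.lab st) q b →
        ∀ hb : b < N, Relation.ReflTransGen (fun x y => x ∈ selected N s st ∧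
          y ∈ selected N s st ∧ ∃ w, I.Arc x w ∧ s.finLab N w = s.finLab N y) q ⟨b, hb⟩ := by
      intro b h
      induction h with
      | refl => exact fun _ => .refl
      | @tail b c _ h ih =>
        intro hc
        obtain ⟨h1, h2, w, h3, h4⟩ := h
        exact (ih h1.1).tail ⟨mem_selected.2 h1.2, mem_selected.2 h2.2,
          ⟨w, (network_code I).lt' h3⟩, inputArc_code_fin.1 h3, h4⟩
    exact key q' ((h.sel.conn q ⟨q.2, mem_selected.1 hq⟩).1.trans
      (h.sel.conn q' ⟨q'.2, mem_selected.1 hq'⟩).2) q'.2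
  sat₁ u v e hu := mem_vertexSet.2 (h.sat₁ u v u.2 v.2 e (mem_vertexSet.1 hu))
  sat₂ u v e hu := mem_vertexSet.2 (h.sat₂ u v u.2 v.2 e (mem_vertexSet.1 hu))
  nonempty₁ := let ⟨u, hu, hC⟩ := h.nonempty₁; ⟨⟨u, hu⟩, mem_vertexSet.2 hC⟩
  nonempty₂ := let ⟨u, hu, hC⟩ := h.nonempty₂; ⟨⟨u, hu⟩, mem_vertexSet.2 hC⟩
  disj := Finset.disjoint_left.2 fun v h1 h2 =>
    h.disj v v.2 ⟨mem_vertexSet.1 h1, mem_vertexSet.1 h2⟩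
  internal₁ := h.internal hlab h.internal₁
  internal₂ := h.internal hlab h.internal₂

/-- The common new label is the old label of `f`, which belongs to a selected block, so it differs
from the labels of all unselected blocks. -/
theorem ForProg.StageSpec.merges (hlab : ∀ v, v < N → s.lab v < N)
    (h : StageSpec N (InputArc I.code) s s' st f C₁ C₂) :
    Merges (s.finLab N) (selected N s st) (s'.finLab N) := by
  intro u v
  rw [h.exists_selected_iff hlab, h.exists_selected_iff hlab]
  have hf : st (s.lab f) ≠ 0 := by
    rw [h.sel.mem.2]
    omega
  simp only [Store.finLab]
  rw [h.lab u u.2, h.lab v v.2]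
  split_ifs with h1 h2 h2
  · simp [h1, h2]
  · refine iff_of_false (fun e => h2 (by rw [← e]; exact hf)) ?_
    rintro (e | ⟨-, h3⟩)
    · exact h2 (by rw [← e]; exact h1)
    · exact h2 h3
  · refine iff_of_false (fun e => h1 (by rw [e]; exact hf)) ?_
    rintro (e | ⟨h3, -⟩)
    · exact h1 (by rw [e]; exact h2)
    · exact h1 h3
  · simp [h1]

theorem Indicates.eq_ite {c : ℕ} {p q : Prop} [Decidable q] (h : Indicates c p) (hpq : p ↔ q) :
    c = if q then 1 else 0 := by
  rcases h with h | h
  · rw [if_pos (hpq.1 h.1), h.2]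
  · rw [if_neg fun h' => h.1 (hpq.2 h'), h.2]

theorem ForProg.StageSpec.holds (hlab : ∀ v, v < N → s.lab v < N)
    (h : StageSpec N (InputArc I.code) s s' st f C₁ C₂) {L : List (Stage (Fin N))}
    (hL : s.Holds L) : s'.Holds (L ++ [⟨selected N s st,
      (vertexSet N C₁).image (block (s.finLab N)), (vertexSet N C₂).image (block (s.finLab N))⟩]) := by
  refine ⟨by rw [h.reg_one, hL.1, List.length_append, List.length_singleton], fun i hi v => ?_⟩
  rw [List.length_append, List.length_singleton] at hi
  rcases Nat.lt_succ_iff_lt_or_eq.1 hi with hi | rfl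
  · have hrow : i ≠ s.reg 1 := by
      rw [hL.1]
      omega
    rw [List.getElem_append_left hi, h.rows 1 (by simp) i v hrow, h.rows 2 (by simp) i v hrow,
      h.rows 3 (by simp) i v hrow]
    exact hL.2 i hi v
  · rw [List.getElem_concat_length rfl, biUnion_image_block (h.isStage hlab).sat₁,
      biUnion_image_block (h.isStage hlab).sat₂, ← hL.1]
    exact ⟨(h.stars v v.2).eq_ite mem_selected.symm, (h.cut₁ v v.2).eq_ite mem_vertexSet.symm,
      (h.cut₂ v v.2).eq_ite mem_vertexSet.symm⟩

end Stage

/-- The store `s` holds the record `L` of the iterations so far, which started with the labels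
`l`. -/
structure Partial (I : DPAInstance N) (l : Fin N → ℕ) (s : Store) (L : List (Stage (Fin N))) :
    Prop where
  reg : s.reg 0 = N
  lab : ∀ v, v < N → s.lab v < N
  holds : s.Holds L
  power : ∀ v : Fin N, s.mem 0 0 v = if ∃ st ∈ L, v ∈ st.Q then 1 else 0
  run : ∀ L', I.IsRun (s.finLab N) L' → I.IsRun l (L ++ L')

/-- `IsRun` is built from its last stage backwards, whereas the machine appends stages at the end;
therefore `Partial.run` quantifies over all continuations of the run. -/
theorem Partial.stage {l : Fin N → ℕ} {s : Store} {L : List (Stage (Fin N))}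
    (h : Partial I l s L) (hne : ∃ u w, u < N ∧ w < N ∧ s.lab u ≠ s.lab w) :
    (∃ L', Partial I l (stage.den I.code s) L') ∧
      (I.quot ((stage.den I.code s).finLab N)).verts.card <
        (I.quot (s.finLab N)).verts.card := by
  classical
  obtain ⟨st, f, C₁, C₂, hs⟩ := den_stage h.reg (network_code I) h.lab hne rfl
  have h1 := hs.isStage h.lab
  have h2 := hs.merges h.lab
  constructor
  · refine ⟨_, (hs.reg_zero).trans h.reg, fun v hv => ?_, hs.holds h.lab h.holds, fun v => ?_,
      fun L' hL' => ?_⟩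
    · rw [hs.lab v hv]
      split_ifs
      · exact h.lab f hs.sel.mem.1
      · exact h.lab v hv
    · rw [hs.power v v.2, h.power v]
      simp only [List.mem_append, List.mem_singleton, or_and_right, exists_or, exists_eq_left,
        mem_selected]
      by_cases h3 : st (s.lab v) = v + 1 <;> simp [h3]
    · rw [List.append_assoc]
      exact h.run _ (.cons h1 h2 hL')
  · have h3 := h1.card_verts h2
    have h4 := h1.one_lt_card
    omega

/-- While there are several blocks each round removes at least one, so N rounds suffice; with one
block left a round leaves the record alone. -/
theorem exists_partial_algorithm (I : DPAInstance N) :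
    ∃ l L, I.IsComponents l ∧ Partial I l (algorithm.den I.code (start N)) L ∧
      ∀ u v : Fin N, (algorithm.den I.code (start N)).finLab N u =
        (algorithm.den I.code (start N)).finLab N v := by
  have hN : (start N).reg 0 = N := rfl
  set s := labels.den I.code (start N) with hs
  obtain ⟨h1, h2⟩ := den_labels hN
    (fun u w h => ⟨(code_eq_one.1 h).1, (code_eq_one.1 h).2.1⟩)
    (fun u w h => by
      obtain ⟨hu, hw, h⟩ := code_eq_one.1 h
      exact code_eq_one.2 ⟨hw, hu, powerArc_zero_symm h⟩) hs
  have same : (start N).Same [20, 20, 21, 13, 14, 22] [4, 4] s := den_same labels (start N)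
  have r0 : s.reg 0 = N := (same.reg (by decide)).trans hN
  have h0 : Partial I (s.finLab N) s [] := by
    refine ⟨r0, h1, ⟨same.reg (by decide), fun i h => absurd h (Nat.not_lt_zero _)⟩, fun v => ?_,
      fun _ h => h⟩
    rw [same.mem (by decide)]
    simp [start]
  let μ : Store → ℕ := fun t => N - (I.quot (t.finLab N)).verts.card
  have hcard : ∀ t : Store, (I.quot (t.finLab N)).verts.card ≤ N := fun t =>
    Finset.card_image_le.trans (by simp)
  have main := den_for_progress (inp := I.code) (x := 25) (s := s)
    (P := .seq testBlocks (when (.eq (.reg 12) (.const 1)) ForProg.stage)) (by decide)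
    (fun t => ∃ L, Partial I (s.finLab N) t L)
    (fun t => ∀ u v : Fin N, t.finLab N u = t.finLab N v) μ 1
    (fun t c ⟨L, hL⟩ => ⟨L, by simpa using hL.reg, hL.lab, ⟨by simpa using hL.holds.1,
      hL.holds.2⟩, hL.power, hL.run⟩) (fun _ _ h => h) (fun _ _ => rfl) ⟨[], h0⟩ ?_
  · obtain ⟨⟨L, hL⟩, -, h3⟩ := main
    refine ⟨s.finLab N, L, isComponents_of_labels h2, hL, h3.resolve_right fun h3 => ?_⟩
    -- At least one block always remains, so N rounds of progress would push the number of removed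
    -- blocks beyond N - 1.
    have h4 : 0 < (I.quot (((ForProg.forLoop 25 (.seq testBlocks
        (when (.eq (.reg 12) (.const 1)) ForProg.stage))).den I.code s).finLab N)).verts.card :=
      Finset.card_pos.2 (isInstance_quot I _).verts_nonempty
    have h5 := I.pos
    rw [r0] at h3
    simp only [μ] at h3
    omega
  · rintro t ⟨L, hL⟩
    rw [den_seq]
    set t' := testBlocks.den I.code t with ht'
    have same' : t.Same [12, 20, 12] [] t' := den_same testBlocks t
    have el : t'.lab = t.lab := congrFun (same'.mem (by decide)) 0
    have el' : t'.finLab N = t.finLab N := funext fun v => congrFun el v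
    have hmem : t'.mem = t.mem := funext fun a => same'.mem (by simp)
    have hL' : Partial I (s.finLab N) t' L := by
      refine ⟨(same'.reg (by decide)).trans hL.reg, by rw [el]; exact hL.lab,
        ⟨(same'.reg (by decide)).trans hL.holds.1, ?_⟩, ?_, by rw [el']; exact hL.run⟩
      · rw [hmem]
        exact hL.holds.2
      · rw [hmem]
        exact hL.power
    have htest := den_testBlocks hL.reg ht'
    have hμ : μ t' = μ t := by simp only [μ, el']
    rw [← hμ, ← el']
    rw [← el] at htest
    clear_value t'
    rcases htest with ⟨h12, v, hv, hne⟩ | ⟨h12, hall⟩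
    · rw [den_when_pos (by simpa using h12)]
      obtain ⟨h3, h4⟩ := hL'.stage ⟨v, 0, hv, I.pos, hne⟩
      refine ⟨h3, fun h => absurd (h ⟨v, hv⟩ ⟨0, I.pos⟩) hne, Or.inr ?_⟩
      have := hcard t'
      simp only [μ]
      omega
    · rw [den_when_neg (by simp [h12])]
      exact ⟨⟨L, hL'⟩, id, Or.inl fun u v => (hall u u.2).trans (hall v v.2).symm⟩

end RAM

/-! ### The approximation theorem -/

theorem mainTheorem1 :
    ∃ (P : RAM.Program) (q : Polynomial ℕ), ∀ (N : ℕ) (I : DPAInstance N),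
      -- the associated instance of Star Strong Connectivity
      I.ssc.IsInstance ∧ I.ssc.Bidirected ∧
      ∃ (t : ℕ) (s : RAM.Store) (L : List (Stage (Fin N))),
        -- the algorithm halts after polynomially many steps
        RAM.Exec I.code P (RAM.start N) t s ∧ t ≤ q.eval N ∧
        -- it has contracted perfect sets with two star-disjoint internal cuts down to one vertex,
        -- and outputs these sets and cuts
        IsDualRun I.ssc L ∧ s.Holds L ∧
        -- the cuts form an integral dual solution
        IsDualSolution I.ssc (runCuts I.ssc L) ∧
        -- the output gives high power exactly to the vertices of the selected stars
        (∀ v : Fin N, s.power N v = if ∃ st ∈ L, v ∈ st.Q then 1 else 0) ∧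
        I.Feasible (s.power N) ∧
        (∑ v, s.power N v) = (I.ssc.verts.card : ℝ) + (L.length : ℝ) - 1 ∧
        -- comparison with an arbitrary, hence with an optimal, solution
        ∀ p : Fin N → ℝ, I.Feasible p →
          2 * (L.length : ℝ) ≤ ∑ v, p v ∧
          (∑ v, s.power N v) ≤ 3 / 2 * ∑ v, p v ∧
          (2 ≤ I.ssc.verts.card →
            (I.ssc.verts.card : ℝ) ≤ ∑ v, p v ∧
            (∑ v, s.power N v) < 3 / 2 * ∑ v, p v) := by
  refine ⟨RAM.ForProg.algorithm.compile, RAM.ForProg.algorithm.cost, fun N I => ?_⟩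
  obtain ⟨l, L, hl, hL, hone⟩ := RAM.exists_partial_algorithm I
  obtain ⟨t, ht, hexec⟩ := RAM.ForProg.exec_compile (inp := I.code) (N := N)
    RAM.ForProg.algorithm (by decide) (by decide) (RAM.start N) rfl
  have hrun : I.IsRun l L := by
    have := hL.run [] (.nil hone)
    rwa [List.append_nil] at this
  rw [DPAInstance.ssc_eq_quot hl]
  have hp : ∀ v, (RAM.ForProg.algorithm.den I.code (RAM.start N)).power N v =
      if ∃ st ∈ L, v ∈ st.Q then 1 else 0 := by
    intro v
    rw [RAM.Store.power, hL.power v]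
    split_ifs <;> simp
  have hsum := hrun.sum_eq _ hp
  refine ⟨DPAInstance.isInstance_quot I l, DPAInstance.bidirected_quot, t, _, L, hexec, ht,
    hrun.isDualRun, hL.holds, hrun.isDualSolution, hp, hrun.feasible hl _ hp, hsum,
    fun p hfeas => ?_⟩
  have h1 : 2 * (L.length : ℝ) ≤ ∑ v, p v := by
    have := hfeas.length_le hl hrun.vertexCuts_spec hrun.pairwise_vertexCuts
    rw [DPAInstance.length_vertexCuts] at this
    exact_mod_cast this
  have h2 : 2 ≤ (I.quot l).verts.card → ((I.quot l).verts.card : ℝ) ≤ ∑ v, p v :=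
    hfeas.card_verts_le hl
  rw [hsum]
  refine ⟨h1, ?_, fun h => ⟨h2 h, by linarith [h2 h]⟩⟩
  -- For n ≥ 2 combine n ≤ OPT and 2k ≤ OPT in A = n + k - 1. If n ≤ 1, the bound n ≤ OPT may fail,
  -- but then A ≤ k and 2k ≤ OPT suffice.
  by_cases h : 2 ≤ (I.quot l).verts.card
  · linarith [h2 h]
  · have h3 : ((I.quot l).verts.card : ℝ) ≤ 1 := by exact_mod_cast (by omega)
    linarith
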